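/- Let $\Omega\subset\mathbb{R}^d$ be a bounded open set, $T>0$, and let $U_1,U_2\subset\Omega$ be disjoint open sets (the control regions of the leader and of the follower). Let $a:[0,\infty)\times\mathbb{R}^d\to\mathbb{R}^{d\times d}$ be symmetric-matrix valued, Lipschitz and uniformly elliptic, let $\mu:[0,\infty)\times\mathbb{R}^d\to\mathbb{R}^d$ be Lipschitz, and put $$\mathcal{L}=\tfrac12\operatorname{tr}\{a\,D_x^2\}+\mu\cdot\nabla_x .$$ Let $h\in C_b^{1,2}([0,T]\times\mathbb{R}^d)$ be strictly positive with $\partial_t\log h+\mathcal{L}\log h=-\tfrac12\,(a\nabla_x\log h)\cdot\nabla_x\log h$ on $[0,T)\times\mathbb{R}^d$ (such $h$ parametrize the class of perturbed models), and put $\mathcal{L}^h=\mathcal{L}+(a\nabla_x\log h)\cdot\nabla_x$. Write $\mathcal{L}^*$, $\mathcal{L}^{h*}$ for the adjoint operators. Let $\alpha,\beta>0$, $y^{tg}\in L^2(\Omega)$, $y^{rf}\in L^2((0,T)\times\Omega)$, and let $B$ be the closed unit ball of $L^2(\Omega)$. All parabolic problems carry zero Dirichlet data on $(0,T)\times\partial\Omega$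 and are understood in the weak sense, with solutions in $C([0,T];L^2(\Omega))\cap L^2(0,T;H^1_0(\Omega))$. Follower. Given $u_1\in L^2((0,T)\times U_1)$, the follower's response $u_2=F(u_1)\in L^2((0,T)\times U_2)$ and the state $y=y(\cdot\,;(u_1,F(u_1)))$ are defined as follows: $y$ is the state of the perturbed model, $$\partial_t y-\mathcal{L}^h y=u_1\chi_{U_1}+u_2\chi_{U_2},\qquad y(0)=0,$$ and no change $\delta u\in L^2((0,T)\times U_2)$ of $u_2$ lowers the cost $$J_2(y,u_1,u_2)=\tfrac12\iint_{(0,T)\times\Omega}(y-y^{rf})^2+\tfrac{\beta}{2}\Big(\iint_{(0,T)\times U_1}u_1^2+\iint_{(0,T)\times U_2}u_2^2\Big)$$ when its effect is computed with the approximate model, that is, $J_2(y,u_1,u_2)\le J_2(y+\delta y,u_1,u_2+\delta u)$ whenever $\partial_t\delta y-\mathcal{L}\,\delta y=\delta u\,\chi_{U_2}$, $\delta y(0)=0$. Leader. The leader's problem is to minimize $J_1(u_1)=\tfrac12\iint_{(0,T)\times U_1}u_1^2$ over $u_1\in L^2((0,T)\times U_1)$ subject to $y(T;(u_1,F(u_1)))\in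 y^{tg}+\alpha B$. Assume that for every $u_1\in L^2((0,T)\times U_1)$ the coupled system $$\partial_t y-\mathcal{L}^h y=u_1\chi_{U_1}-\tfrac1\beta p\chi_{U_2},\quad -\partial_t p-\mathcal{L}^*p=y-y^{rf},\quad y(0)=0,\ p(T)=0$$ has a unique solution $(y,p)$, and that for every $\xi\in L^2(\Omega)$ the coupled system $$-\partial_t\varphi-\mathcal{L}^{h*}\varphi=\vartheta,\quad \partial_t\vartheta-\mathcal{L}\vartheta=-\tfrac1\beta\varphi\chi_{U_2},\quad \varphi(T)=\xi,\ \vartheta(0)=0$$ has a unique solution $(\varphi,\vartheta)$. Then: (1) For every $\xi\in L^2(\Omega)$ the optimality system $$\begin{aligned}&\partial_t y-\mathcal{L}^h y=\varphi\chi_{U_1}-\tfrac1\beta p\chi_{U_2},\quad && -\partial_t\varphi-\mathcal{L}^{h*}\varphi=\vartheta,\\ &\partial_t\vartheta-\mathcal{L}\vartheta=-\tfrac1\beta\varphi\chi_{U_2},&& -\partial_t p-\mathcal{L}^*p=y-y^{rf},\\ & y(0)=\vartheta(0)=0,&& p(T)=0,\ \varphi(T)=\xi\end{aligned}$$ has a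 unique solution $\{y(\xi),p(\xi),\varphi(\xi),\vartheta(\xi)\}$. (2) If $\xi\in L^2(\Omega)$ satisfies the variational inequality $$\big(y(T;\xi)-y^{tg},\hat\xi-\xi\big)_{L^2(\Omega)}+\alpha\big(\|\hat\xi\|_{L^2(\Omega)}-\|\xi\|_{L^2(\Omega)}\big)\ge0\qquad\text{for all }\hat\xi\in L^2(\Omega),$$ then $u_1^*=\varphi(\xi)\chi_{U_1}$ is the unique optimal strategy of the leader; moreover $u_2^*=-\tfrac1\beta p(\xi)\chi_{U_2}$ is a response of the follower to $u_1^*$, with state $y(\xi)$, and $y(T;\xi)\in y^{tg}+\alpha B$. (3) If the terminal states $y(T;(u_1,F(u_1)))$, $u_1\in L^2((0,T)\times U_1)$, are dense in $L^2(\Omega)$, then there is exactly one $\xi\in L^2(\Omega)$ that satisfies this variational inequality. -/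

import Mathlib

open MeasureTheory Set
open scoped Matrix RealInnerProductSpace ContDiff

noncomputable section

namespace Stackelberg

/-- The Euclidean space `ℝ^d`. -/
abbrev E (d : ℕ) := EuclideanSpace ℝ (Fin d)

/-- The partial derivative `∂ f / ∂ x_i`. -/
def pd {d : ℕ} (i : Fin d) (f : E d → ℝ) (x : E d) : ℝ :=
  fderiv ℝ f x (EuclideanSpace.single i 1)

/-- The Hilbert space `L²(Ω)`. -/
abbrev L2 {d : ℕ} (Ω : Set (E d)) := Lp ℝ 2 (volume.restrict Ω)

/-- The Hilbert space `L²(Ω; ℝ^d)`, in which gradients live. -/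
abbrev L2Vec {d : ℕ} (Ω : Set (E d)) := Lp (E d) 2 (volume.restrict Ω)

/-- The Sobolev space `H¹₀(Ω)`, as a set of pairs `(v, ∇v)`: the closure, in
`L²(Ω) × L²(Ω; ℝ^d)`, of the pairs `(ψ, ∇ψ)` with `ψ` smooth and compactly supported in `Ω`. -/
def H10 {d : ℕ} (Ω : Set (E d)) : Set (L2 Ω × L2Vec Ω) :=
  closure {w | ∃ ψ : E d → ℝ, ContDiff ℝ ∞ ψ ∧ HasCompactSupport ψ ∧ tsupport ψ ⊆ Ω ∧
    (w.1 : E d → ℝ) =ᵐ[volume.restrict Ω] ψ ∧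
    (w.2 : E d → E d) =ᵐ[volume.restrict Ω] gradient ψ}

/-- The data of the controlled system: the horizon `T`, the bounded open set `Ω`, the disjoint open
control regions `U₁` (leader) and `U₂` (follower), and Lipschitz coefficients `a`, `μ` on
`[0, ∞) × ℝ^d` with `a` symmetric and uniformly elliptic. -/
structure ControlSystem (d : ℕ) where
  T : ℝ
  T_pos : 0 < T
  Ω : Set (E d)
  Ω_open : IsOpen Ω
  Ω_bounded : Bornology.IsBounded Ω
  U₁ : Set (E d)
  U₂ : Set (E d)
  U₁_open : IsOpen U₁
  U₂_open : IsOpen U₂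
  U₁_subset : U₁ ⊆ Ω
  U₂_subset : U₂ ⊆ Ω
  U_disjoint : Disjoint U₁ U₂
  a : ℝ → E d → Matrix (Fin d) (Fin d) ℝ
  a_symm : ∀ t, 0 ≤ t → ∀ x, (a t x).IsSymm
  a_lipschitz : ∀ i j, ∃ K, LipschitzOnWith K (fun q : ℝ × E d => a q.1 q.2 i j) (Ici 0 ×ˢ univ)
  a_elliptic : ∃ lam : ℝ, 0 < lam ∧ ∀ t, 0 ≤ t → ∀ x, ∀ v : Fin d → ℝ,
    lam * (v ⬝ᵥ v) ≤ v ⬝ᵥ (a t x *ᵥ v)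
  μ : ℝ → E d → E d
  μ_lipschitz : ∃ K, LipschitzOnWith K (fun q : ℝ × E d => μ q.1 q.2) (Ici 0 ×ˢ univ)

namespace ControlSystem

variable {d : ℕ} (S : ControlSystem d)

/-- The second-order operator with diffusion matrix `a` and drift `b`, acting on a smooth function
of `x` at time `t`: `½ tr(a(t,x) D²f(x)) + b(t,x) · ∇f(x)`. -/
def generator (b : ℝ → E d → Fin d → ℝ) (t : ℝ) (f : E d → ℝ) (x : E d) : ℝ :=
  (1 / 2) * ∑ i, ∑ j, S.a t x i j * pd i (pd j f) x + ∑ i, b t x i * pd i f x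

/-- The drift `μ` of the approximate model (operator `L`). -/
def drift (t : ℝ) (x : E d) (i : Fin d) : ℝ := S.μ t x i

/-- The drift `μ + a ∇ log h` of the perturbed model (operator `L^h`). -/
def driftH (h : ℝ → E d → ℝ) (t : ℝ) (x : E d) (i : Fin d) : ℝ :=
  S.μ t x i + ∑ j, S.a t x i j * pd j (fun z => Real.log (h t z)) x

/-- `h ∈ C_b^{1,2}([0,T] × ℝ^d)`: `h`, `∂ₜh`, `∂ᵢh`, `∂ᵢ∂ⱼh` exist, are jointly continuous and
bounded on `[0,T] × ℝ^d` (with one-sided time derivatives at `0` and `T`). -/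
structure IsCb12 (h : ℝ → E d → ℝ) : Prop where
  diff_time : ∀ x, DifferentiableOn ℝ (fun t => h t x) (Icc 0 S.T)
  diff_space : ∀ t ∈ Icc 0 S.T, ContDiff ℝ 2 (h t)
  cont : ContinuousOn (fun q : ℝ × E d => h q.1 q.2) (Icc 0 S.T ×ˢ univ)
  cont_time : ContinuousOn
    (fun q : ℝ × E d => derivWithin (fun s => h s q.2) (Icc 0 S.T) q.1) (Icc 0 S.T ×ˢ univ)
  cont_space : ∀ i, ContinuousOn (fun q : ℝ × E d => pd i (h q.1) q.2) (Icc 0 S.T ×ˢ univ)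
  cont_space₂ : ∀ i j,
    ContinuousOn (fun q : ℝ × E d => pd i (pd j (h q.1)) q.2) (Icc 0 S.T ×ˢ univ)
  bounded : ∃ C : ℝ, ∀ t ∈ Icc 0 S.T, ∀ x, |h t x| ≤ C ∧
    |derivWithin (fun s => h s x) (Icc 0 S.T) t| ≤ C ∧
    (∀ i, |pd i (h t) x| ≤ C) ∧ ∀ i j, |pd i (pd j (h t)) x| ≤ C

/-- `h` parametrizes an alternative model: it is strictly positive, of class `C_b^{1,2}`, and
`∂ₜ log h + L log h = -½ (a ∇ log h) · ∇ log h` in `[0,T) × ℝ^d`. -/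
structure IsPerturbation (h : ℝ → E d → ℝ) : Prop where
  pos : ∀ t ∈ Icc 0 S.T, ∀ x, 0 < h t x
  smooth : S.IsCb12 h
  eqn : ∀ t ∈ Ico 0 S.T, ∀ x,
    derivWithin (fun s => Real.log (h s x)) (Icc 0 S.T) t
        + S.generator S.drift t (fun z => Real.log (h t z)) x
      = -(1 / 2) * ∑ i, ∑ j, S.a t x i j *
          pd i (fun z => Real.log (h t z)) x * pd j (fun z => Real.log (h t z)) x

/-- The bilinear form on `H¹₀(Ω)` of the operator with diffusion matrix `a` and drift `b`: it is
`-∫_Ω (½ tr(a D²v) + b · ∇v) w dx` after one integration by parts in the second-order term,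
`-½ ∫ aᵢⱼ ∂ᵢ∂ⱼv w = ½ ∫ aᵢⱼ ∂ⱼv ∂ᵢw + ½ ∫ (∂ᵢaᵢⱼ) ∂ⱼv w`. -/
def form (b : ℝ → E d → Fin d → ℝ) (t : ℝ) (v w : L2 S.Ω × L2Vec S.Ω) : ℝ :=
  ∫ x in S.Ω,
    ((1 / 2) * ∑ i, ∑ j, S.a t x i j * v.2 x j * w.2 x i
      + (1 / 2) * ∑ i, ∑ j, pd i (fun z => S.a t z i j) x * v.2 x j * w.1 x
      - ∑ j, b t x j * v.2 x j * w.1 x)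

/-- State trajectories: `C([0,T]; L²(Ω))`. -/
abbrev State := C(Icc (0 : ℝ) S.T, L2 S.Ω)

/-- The value at time `t` of a trajectory (constant extension outside `[0,T]`). -/
def at' (y : S.State) (t : ℝ) : L2 S.Ω := IccExtend S.T_pos.le y t

/-- `g` is the spatial gradient of `y`, and `y ∈ L²(0,T; H¹₀(Ω))`. -/
def HasGrad (y : S.State) (g : ℝ → L2Vec S.Ω) : Prop :=
  MemLp g 2 (volume.restrict (Ioo 0 S.T)) ∧
    ∀ᵐ t ∂(volume.restrict (Ioo 0 S.T)), (S.at' y t, g t) ∈ H10 S.Ω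

/-- `y ∈ C([0,T]; L²(Ω)) ∩ L²(0,T; H¹₀(Ω))` is the weak solution of
`∂ₜy - (½ tr(a D²y) + b · ∇y) = f` in `(0,T) × Ω`, `y(0) = y₀`, `y = 0` on `(0,T) × ∂Ω`. -/
def IsForwardSol (b : ℝ → E d → Fin d → ℝ) (f : ℝ → E d → ℝ) (y₀ : L2 S.Ω) (y : S.State) : Prop :=
  ∃ g : ℝ → L2Vec S.Ω, S.HasGrad y g ∧ ∀ w ∈ H10 S.Ω, ∀ t ∈ Icc 0 S.T,
    ⟪S.at' y t, w.1⟫ = ⟪y₀, w.1⟫ +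
      ∫ s in (0 : ℝ)..t, ((∫ x in S.Ω, f s x * w.1 x) - S.form b s (S.at' y s, g s) w)

/-- `p ∈ C([0,T]; L²(Ω)) ∩ L²(0,T; H¹₀(Ω))` is the weak solution of
`-∂ₜp - M* p = f` in `(0,T) × Ω`, `p(T) = pT`, `p = 0` on `(0,T) × ∂Ω`, with `M*` the adjoint of
`M = ½ tr(a D²) + b · ∇`. -/
def IsBackwardSol (b : ℝ → E d → Fin d → ℝ) (f : ℝ → E d → ℝ) (pT : L2 S.Ω) (p : S.State) : Prop :=
  ∃ g : ℝ → L2Vec S.Ω, S.HasGrad p g ∧ ∀ w ∈ H10 S.Ω, ∀ t ∈ Icc 0 S.T,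
    ⟪S.at' p t, w.1⟫ = ⟪pT, w.1⟫ +
      ∫ s in t..S.T, ((∫ x in S.Ω, f s x * w.1 x) - S.form b s w (S.at' p s, g s))

/-- Functions in `L²((0,T) × U)`: controls for `U = U₁` or `U₂`, reference trajectories for
`U = Ω`. -/
abbrev Control (U : Set (E d)) := Lp ℝ 2 (volume.restrict (Ioo 0 S.T ×ˢ U))

/-- The source `u χ_U` of a control `u ∈ L²((0,T) × U)`. -/
def src {U : Set (E d)} (u : S.Control U) (t : ℝ) (x : E d) : ℝ :=
  U.indicator (fun z => u (t, z)) x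

/-- The control `u ∈ L²((0,T) × U)` is the restriction `c y χ_U` of a multiple of a trajectory. -/
def IsRestriction {U : Set (E d)} (u : S.Control U) (c : ℝ) (y : S.State) : Prop :=
  ∀ᵐ t ∂(volume.restrict (Ioo 0 S.T)), ∀ᵐ x ∂(volume.restrict U), u (t, x) = c * S.at' y t x

/-- The leader's cost `½ ∫∫_{(0,T)×U₁} u₁²`. -/
def J₁ (u₁ : S.Control S.U₁) : ℝ :=
  (1 / 2) * ∫ q in Ioo 0 S.T ×ˢ S.U₁, u₁ q ^ 2

/-- The follower's cost `½ ∫∫_{(0,T)×Ω} (y - y^rf)² + (β/2) ∫∫_{(0,T)×U} u²`, with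
`u = (u₁, u₂)`, as a function of the state trajectory and the two strategies. -/
def J₂ (β : ℝ) (yrf : S.Control S.Ω) (y : S.State) (u₁ : S.Control S.U₁) (u₂ : S.Control S.U₂) : ℝ :=
  (1 / 2) * (∫ t in (0 : ℝ)..S.T, ∫ x in S.Ω, (S.at' y t x - yrf (t, x)) ^ 2)
    + (β / 2) * ((∫ q in Ioo 0 S.T ×ˢ S.U₁, u₁ q ^ 2) + ∫ q in Ioo 0 S.T ×ˢ S.U₂, u₂ q ^ 2)

/-- `u₂ = F(u₁)` and `y = y(·; (u₁, F(u₁)))`: the state `y` evolves by the perturbed model under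
`(u₁, u₂)`, and `u₂` minimizes the follower's cost when the follower computes the effect `δy` of
every change `δu` of his strategy with the approximate model. -/
def IsFollowerResponse (h : ℝ → E d → ℝ) (β : ℝ) (yrf : S.Control S.Ω)
    (u₁ : S.Control S.U₁) (u₂ : S.Control S.U₂) (y : S.State) : Prop :=
  S.IsForwardSol (S.driftH h) (fun t x => S.src u₁ t x + S.src u₂ t x) 0 y ∧
    ∀ (δu : S.Control S.U₂) (δy : S.State), S.IsForwardSol S.drift (S.src δu) 0 δy →
      S.J₂ β yrf y u₁ u₂ ≤ S.J₂ β yrf (y + δy) u₁ (u₂ + δu)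

/-- The constraint `y(T) ∈ y^tg + α B`, with `B` the closed unit ball of `L²(Ω)`. -/
def HitsTarget (ytg : L2 S.Ω) (α : ℝ) (y : S.State) : Prop :=
  S.at' y S.T ∈ Metric.closedBall ytg α

/-- `u₁` solves the leader's problem
`inf J₁(u₁)` subject to `y(T; (u₁, F(u₁))) ∈ y^tg + α B`, in the perturbed model given by `h`. -/
def IsLeaderOptimal (h : ℝ → E d → ℝ) (β : ℝ) (yrf : S.Control S.Ω) (ytg : L2 S.Ω) (α : ℝ)
    (u₁ : S.Control S.U₁) : Prop :=
  (∃ u₂ y, S.IsFollowerResponse h β yrf u₁ u₂ y ∧ S.HitsTarget ytg α y) ∧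
    ∀ v₁ v₂ y, S.IsFollowerResponse h β yrf v₁ v₂ y → S.HitsTarget ytg α y → S.J₁ u₁ ≤ S.J₁ v₁

/-- The terminal states `y(T; (u₁, F(u₁)))`, for all `u₁ ∈ L²((0,T) × U₁)`. -/
def reachable (h : ℝ → E d → ℝ) (β : ℝ) (yrf : S.Control S.Ω) : Set (L2 S.Ω) :=
  {η | ∃ u₁ u₂ y, S.IsFollowerResponse h β yrf u₁ u₂ y ∧ η = S.at' y S.T}

/-- The coupled system for the state `y` and the follower's adjoint state `p` with source `f` in
`(0,T) × Ω`:
`∂ₜy - L^h y = f - β⁻¹ p χ_{U₂}`, `-∂ₜp - L* p = y - y^rf`, `y(0) = 0`, `p(T) = 0`. -/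
def IsStateSystem (h : ℝ → E d → ℝ) (β : ℝ) (yrf : S.Control S.Ω) (f : ℝ → E d → ℝ)
    (y p : S.State) : Prop :=
  S.IsForwardSol (S.driftH h) (fun t x => f t x - β⁻¹ * S.U₂.indicator (S.at' p t) x) 0 y ∧
    S.IsBackwardSol S.drift (fun t x => S.at' y t x - yrf (t, x)) 0 p

/-- The coupled adjoint system with terminal datum `ξ`:
`-∂ₜφ - L^{h*} φ = ϑ`, `∂ₜϑ - L ϑ = -β⁻¹ φ χ_{U₂}`, `φ(T) = ξ`, `ϑ(0) = 0`. -/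
def IsAdjointSystem (h : ℝ → E d → ℝ) (β : ℝ) (ξ : L2 S.Ω) (φ ϑ : S.State) : Prop :=
  S.IsBackwardSol (S.driftH h) (fun t x => S.at' ϑ t x) ξ φ ∧
    S.IsForwardSol S.drift (fun t x => -(β⁻¹ * S.U₂.indicator (S.at' φ t) x)) 0 ϑ

/-- The optimality system: the four coupled equations for `(y, p, φ, ϑ)` with terminal datum `ξ`
and leader's strategy `φ χ_{U₁}`. -/
def IsOptimalitySystem (h : ℝ → E d → ℝ) (β : ℝ) (yrf : S.Control S.Ω) (ξ : L2 S.Ω)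
    (y p φ ϑ : S.State) : Prop :=
  S.IsStateSystem h β yrf (fun t x => S.U₁.indicator (S.at' φ t) x) y p ∧
    S.IsAdjointSystem h β ξ φ ϑ

/-- The variational inequality
`(y(T) - y^tg, ξ' - ξ) + α (‖ξ'‖ - ‖ξ‖) ≥ 0` for all `ξ' ∈ L²(Ω)`. -/
def VarIneq (ytg : L2 S.Ω) (α : ℝ) (y : S.State) (ξ : L2 S.Ω) : Prop :=
  ∀ ξ' : L2 S.Ω, 0 ≤ ⟪S.at' y S.T - ytg, ξ' - ξ⟫ + α * (‖ξ'‖ - ‖ξ‖)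

end ControlSystem

end Stackelberg

end

noncomputable section

open MeasureTheory Set
open scoped Matrix RealInnerProductSpace ContDiff

set_option linter.unusedSectionVars false

/-! The theorem rests on one duality relation in Hilbert space. The follower minimizes a convex
quadratic cost along the approximate dynamics, so his condition is equivalent to stationarity.
Expressed through the backward equation for the adjoint of `L`, stationarity reads `u₂ = -β⁻¹ p
χ_{U₂}`. Responses are therefore exactly the solutions of the coupled state system
(`Game.StateSystem.response`, `Game.Response.exists_stateSystem`). Green's formula for `L^h`,
applied to `(y, φ)`, and for `L`, applied to `(ϑ, p)`, contain the same coupling terms. Subtracting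
them leaves `(y(T), ξ) = (u₁, φ χ_{U₁}) - (ϑ, y^rf)`, which is `Game.inner_final`.

Unique solvability of the coupled systems turns this into maps `Y`, `R`, `ℓ` with `⟪Y u, ξ⟫ = ⟪u, R
ξ⟫ - ℓ ξ`. The identity alone makes `Y` affine and `R` linear. The leader seeks the point of least
norm in `{u | ‖Y u - η‖ ≤ α}`, and the variational inequality is the multiplier rule for this
problem with `u = R ξ`. It gives `⟪v - R ξ, R ξ⟫ ≥ 0` for every admissible `v`, hence optimality and
uniqueness (`norm_sq_add_le_of_varIneq`). Conversely, if `Y` has dense range, then `R` is injective,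
the problem is feasible, and its minimizer is `R ξ` for a suitable `ξ` (`exists_varIneq`,
`varIneq_unique`). The optimality system is triangular: the adjoint pair does not involve the state,
so it can be solved first.

What remains is parabolic theory: Green's formula for weak solutions, and existence for the
uncoupled equations of the approximate model. With `J` the Volterra operator on `L²(0,T;V)`, `V =
H¹₀(Ω)`, and `B = ι† ι` for the embedding `ι` of `V` into `L²(Ω)`, a weak solution with zero initial
value is a pair `(v, F)` with `B v = J F` and `F + A v = f`. The pairs `(J k, B k)` are dense among
the solutions of `B v = J F` (`exists_seq_of_volterra`). By approximation this gives `⟪F, v⟫ ≥ 0`,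
the continuous representative in `L²(Ω)` and Green's formula. Existence follows from positivity,
coercivity and the same argument for the adjoint problem (`exists_volterra_solution`); an
exponential weight in time reduces Gårding's inequality to coercivity. -/

namespace Stackelberg

/-! ### Primitives and integration by parts in `L²(0,T;K)`. -/

section TimeIntegration

/-- Lebesgue measure on `(0,T)`. -/
abbrev timeMeasure (T : ℝ) : Measure ℝ := volume.restrict (Ioo 0 T)

/-- The Bochner space `L²(0,T;K)`. -/
abbrev TimeL2 (T : ℝ) (K : Type*) [NormedAddCommGroup K] := Lp K 2 (timeMeasure T)

variable {T : ℝ} {K K' : Type*} [NormedAddCommGroup K] [InnerProductSpace ℝ K]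
  [NormedAddCommGroup K'] [InnerProductSpace ℝ K']

/-- A bounded family of operators that is measurable in the strong operator topology. -/
structure IsOpFamily {X : Type*} [MeasurableSpace X] (A : X → K →L[ℝ] K') : Prop where
  meas : ∀ v, StronglyMeasurable fun s => A s v
  bdd : ∃ C : ℝ, ∀ s, ‖A s‖ ≤ C

section OpFamily

variable {X : Type*} [MeasurableSpace X] {A : X → K →L[ℝ] K'} {μ : Measure X}

theorem IsOpFamily.stronglyMeasurable_comp [SecondCountableTopology K] (hA : IsOpFamily A)
    {k : X → K} (hk : StronglyMeasurable k) : StronglyMeasurable fun s => A s (k s) := by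
  borelize K
  have h := stronglyMeasurable_uncurry_of_continuous_of_stronglyMeasurable
    (u := fun (v : K) (s : X) => A s v) (fun s => (A s).continuous) hA.meas
  exact h.comp_measurable (hk.measurable.prodMk measurable_id)

theorem IsOpFamily.aestronglyMeasurable [SecondCountableTopology K] (hA : IsOpFamily A)
    {k : X → K} (hk : AEStronglyMeasurable k μ) :
    AEStronglyMeasurable (fun s => A s (k s)) μ := by
  obtain ⟨k', hk', he⟩ := hk
  refine ⟨fun s => A s (k' s), hA.stronglyMeasurable_comp hk', ?_⟩
  filter_upwards [he] with s hs
  rw [hs]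

theorem IsOpFamily.memLp [SecondCountableTopology K] (hA : IsOpFamily A) {k : X → K}
    (hk : MemLp k 2 μ) : MemLp (fun s => A s (k s)) 2 μ := by
  obtain ⟨C, hC⟩ := hA.bdd
  refine MemLp.of_le_mul (c := C) hk (hA.aestronglyMeasurable hk.1) (.of_forall fun s => ?_)
  exact (A s).le_of_opNorm_le (hC s) _

/-- The operator between `L²` spaces which acts as `A s` at the point `s`. -/
def IsOpFamily.pointwise [SecondCountableTopology K] (hA : IsOpFamily A) (μ : Measure X) :
    Lp K 2 μ →L[ℝ] Lp K' 2 μ :=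
  LinearMap.mkContinuous
    { toFun := fun k => (hA.memLp (Lp.memLp k)).toLp _
      map_add' := fun k l => by
        rw [← MemLp.toLp_add]
        refine MemLp.toLp_congr _ _ ?_
        filter_upwards [Lp.coeFn_add k l] with s hs
        rw [hs, Pi.add_apply, map_add, Pi.add_apply]
      map_smul' := fun c k => by
        rw [RingHom.id_apply, ← MemLp.toLp_const_smul]
        refine MemLp.toLp_congr _ _ ?_
        filter_upwards [Lp.coeFn_smul c k] with s hs
        rw [hs, Pi.smul_apply, map_smul, Pi.smul_apply] }
    hA.bdd.choose fun k => by
      refine Lp.norm_le_mul_norm_of_ae_le_mul ?_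
      filter_upwards [MemLp.coeFn_toLp (hA.memLp (Lp.memLp k))] with s hs
      simp only [LinearMap.coe_mk, AddHom.coe_mk]
      rw [hs]
      exact (A s).le_of_opNorm_le (hA.bdd.choose_spec s) _

theorem IsOpFamily.coeFn_pointwise [SecondCountableTopology K] (hA : IsOpFamily A)
    (k : Lp K 2 μ) : (hA.pointwise μ k : X → K') =ᵐ[μ] fun s => A s (k s) :=
  MemLp.coeFn_toLp (hA.memLp (Lp.memLp k))

theorem IsOpFamily.norm_pointwise_le [SecondCountableTopology K] (hA : IsOpFamily A) {C : ℝ}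
    (hC0 : 0 ≤ C) (hC : ∀ s, ‖A s‖ ≤ C) : ‖hA.pointwise μ‖ ≤ C := by
  refine ContinuousLinearMap.opNorm_le_bound _ hC0 fun k => ?_
  refine Lp.norm_le_mul_norm_of_ae_le_mul ?_
  filter_upwards [hA.coeFn_pointwise k] with s hs
  rw [hs]
  exact (A s).le_of_opNorm_le (hC s) _

end OpFamily

/-- The operator `L²(0,T;K) → L²(0,T;K')` which acts as `A s` at time `s`. -/
abbrev IsOpFamily.lift [SecondCountableTopology K] {A : ℝ → K →L[ℝ] K'} (hA : IsOpFamily A)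
    (T : ℝ) : TimeL2 T K →L[ℝ] TimeL2 T K' := hA.pointwise (timeMeasure T)

theorem IsOpFamily.coeFn_lift [SecondCountableTopology K] {A : ℝ → K →L[ℝ] K'}
    (hA : IsOpFamily A) (k : TimeL2 T K) :
    (hA.lift T k : ℝ → K') =ᵐ[timeMeasure T] fun s => A s (k s) := hA.coeFn_pointwise k

theorem isOpFamily_const (L : K →L[ℝ] K') : IsOpFamily fun _ : ℝ => L :=
  ⟨fun _ => stronglyMeasurable_const, ‖L‖, fun _ => le_rfl⟩

theorem timeL2_integrable (k : TimeL2 T K) : Integrable k (timeMeasure T) :=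
  (Lp.memLp k).integrable (by norm_num)

/-- A bound for the norm of the integration functional on `L²(0,T;K)`. -/
def timeConst (T : ℝ) : ℝ :=
  ((timeMeasure T univ) ^ (1 / (1 : ENNReal).toReal - 1 / (2 : ENNReal).toReal)).toReal

theorem timeConst_nonneg (T : ℝ) : 0 ≤ timeConst T := ENNReal.toReal_nonneg

theorem timeL2_integral_norm_le (k : TimeL2 T K) :
    ∫ s, ‖k s‖ ∂timeMeasure T ≤ timeConst T * ‖k‖ := by
  have h := eLpNorm_le_eLpNorm_mul_rpow_measure_univ (μ := timeMeasure T) (f := (k : ℝ → K))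
    (p := 1) (q := 2) (by norm_num) (Lp.aestronglyMeasurable k)
  rw [integral_norm_eq_lintegral_enorm (Lp.aestronglyMeasurable k), ← eLpNorm_one_eq_lintegral_enorm,
    Lp.norm_def, mul_comm, timeConst, ← ENNReal.toReal_mul]
  refine ENNReal.toReal_mono (ENNReal.mul_ne_top (Lp.eLpNorm_ne_top k) ?_) h
  exact ENNReal.rpow_ne_top_of_nonneg (by norm_num) (measure_ne_top _ _)

theorem timeL2_intervalIntegrable (k : TimeL2 T K) (a b : ℝ) :
    IntervalIntegrable k (timeMeasure T) a b :=
  (timeL2_integrable k).intervalIntegrable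

theorem timeL2_norm_intervalIntegral_le (k : TimeL2 T K) (a b : ℝ) :
    ‖∫ s in a..b, k s ∂timeMeasure T‖ ≤ timeConst T * ‖k‖ := by
  refine (intervalIntegral.norm_integral_le_integral_norm_uIoc).trans (le_trans ?_ (timeL2_integral_norm_le k))
  exact setIntegral_le_integral (timeL2_integrable k).norm (.of_forall fun _ => norm_nonneg _)

/-- The operator `k ↦ ∫₀ᵗ k`. -/
def primAt (T : ℝ) (K : Type*) [NormedAddCommGroup K] [InnerProductSpace ℝ K] (t : ℝ) :
    TimeL2 T K →L[ℝ] K :=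
  LinearMap.mkContinuous
    { toFun := fun k => ∫ s in (0 : ℝ)..t, k s ∂timeMeasure T
      map_add' := fun k l => by
        rw [← intervalIntegral.integral_add ((timeL2_intervalIntegrable k _ _)) ((timeL2_intervalIntegrable l _ _))]
        refine intervalIntegral.integral_congr_ae_restrict (ae_restrict_of_ae ?_)
        filter_upwards [Lp.coeFn_add k l] with s hs
        rw [hs]; rfl
      map_smul' := fun c k => by
        rw [RingHom.id_apply, ← intervalIntegral.integral_smul]
        refine intervalIntegral.integral_congr_ae_restrict (ae_restrict_of_ae ?_)
        filter_upwards [Lp.coeFn_smul c k] with s hs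
        rw [hs]; rfl }
    (timeConst T) fun k => (timeL2_norm_intervalIntegral_le k 0 t)

theorem primAt_apply (k : TimeL2 T K) (t : ℝ) :
    primAt T K t k = ∫ s in (0 : ℝ)..t, k s ∂timeMeasure T := rfl

theorem norm_primAt_le (k : TimeL2 T K) (t : ℝ) : ‖primAt T K t k‖ ≤ timeConst T * ‖k‖ :=
  (timeL2_norm_intervalIntegral_le k 0 t)

theorem continuous_primAt (k : TimeL2 T K) : Continuous fun t => primAt T K t k :=
  intervalIntegral.continuous_primitive (fun a b => (timeL2_intervalIntegrable k a b)) 0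

theorem memLp_primAt (k : TimeL2 T K) : MemLp (fun t => primAt T K t k) 2 (timeMeasure T) :=
  MemLp.of_bound (continuous_primAt k).aestronglyMeasurable (timeConst T * ‖k‖)
    (.of_forall fun t => norm_primAt_le k t)

/-- The Volterra operator `(J k)(t) = ∫₀ᵗ k`. -/
def volterra (T : ℝ) (K : Type*) [NormedAddCommGroup K] [InnerProductSpace ℝ K] :
    TimeL2 T K →L[ℝ] TimeL2 T K :=
  LinearMap.mkContinuous
    { toFun := fun k => (memLp_primAt k).toLp _
      map_add' := fun k l => by
        rw [← MemLp.toLp_add]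
        exact MemLp.toLp_congr _ _ (.of_forall fun t => by simp)
      map_smul' := fun c k => by
        rw [RingHom.id_apply, ← MemLp.toLp_const_smul]
        exact MemLp.toLp_congr _ _ (.of_forall fun t => by simp) }
    ((measureUnivNNReal (timeMeasure T) : ℝ) ^ (2 : ENNReal).toReal⁻¹ * timeConst T) fun k => by
      rw [mul_assoc]
      refine Lp.norm_le_of_ae_bound (mul_nonneg (timeConst_nonneg T) (norm_nonneg _)) ?_
      filter_upwards [MemLp.coeFn_toLp (memLp_primAt k)] with s hs
      simp only [LinearMap.coe_mk, AddHom.coe_mk]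
      rw [hs]
      exact norm_primAt_le k s

theorem coeFn_volterra (k : TimeL2 T K) :
    (volterra T K k : ℝ → K) =ᵐ[timeMeasure T] fun t => primAt T K t k :=
  MemLp.coeFn_toLp (memLp_primAt k)

theorem primAt_congr {k l : TimeL2 T K} {t : ℝ} (ht : 0 ≤ t)
    (h : ∀ᵐ s ∂timeMeasure T, s ≤ t → k s = l s) : primAt T K t k = primAt T K t l := by
  rw [primAt_apply, primAt_apply, intervalIntegral.integral_of_le ht,
    intervalIntegral.integral_of_le ht]
  refine setIntegral_congr_ae measurableSet_Ioc ?_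
  filter_upwards [h] with s hs hst using hs hst.2

/-- Integrating against the restricted measure keeps the primitive defined and bounded for all real
`t`; inside `[0,T]` the restriction is invisible. -/
theorem primAt_eq (k : TimeL2 T K) {t : ℝ} (ht : t ∈ Icc 0 T) :
    primAt T K t k = ∫ s in (0 : ℝ)..t, k s := by
  rw [primAt_apply, intervalIntegral.integral_of_le ht.1, intervalIntegral.integral_of_le ht.1,
    integral_Ioc_eq_integral_Ioo, integral_Ioc_eq_integral_Ioo,
    Measure.restrict_restrict measurableSet_Ioo,
    inter_eq_left.2 (Ioo_subset_Ioo_right ht.2)]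

theorem primAt_eq_of_ae (k : TimeL2 T K) {f : ℝ → K} (h : (k : ℝ → K) =ᵐ[timeMeasure T] f)
    {t : ℝ} (ht : t ∈ Icc 0 T) : primAt T K t k = ∫ s in (0 : ℝ)..t, f s := by
  rw [primAt_eq k ht, intervalIntegral.integral_of_le ht.1, intervalIntegral.integral_of_le ht.1,
    integral_Ioc_eq_integral_Ioo, integral_Ioc_eq_integral_Ioo]
  exact integral_congr_ae (ae_restrict_of_ae_restrict_of_subset (Ioo_subset_Ioo_right ht.2) h)

theorem primAt_zero_time (k : TimeL2 T K) : primAt T K 0 k = 0 := by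
  rw [primAt_apply, intervalIntegral.integral_same]

variable [CompleteSpace K] [CompleteSpace K']

theorem primAt_lift_const [SecondCountableTopology K] (L : K →L[ℝ] K') (k : TimeL2 T K) (t : ℝ) :
    primAt T K' t ((isOpFamily_const L).lift T k) = L (primAt T K t k) := by
  rw [primAt_apply, primAt_apply, ← L.intervalIntegral_comp_comm ((timeL2_intervalIntegrable k _ _))]
  exact intervalIntegral.integral_congr_ae_restrict
    (ae_restrict_of_ae ((isOpFamily_const L).coeFn_lift k))

theorem volterra_lift_const [SecondCountableTopology K] (L : K →L[ℝ] K') (k : TimeL2 T K) :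
    volterra T K' ((isOpFamily_const L).lift T k) =
      (isOpFamily_const L).lift T (volterra T K k) := by
  refine Lp.ext ?_
  filter_upwards [coeFn_volterra ((isOpFamily_const L).lift T k), coeFn_volterra k,
    (isOpFamily_const L).coeFn_lift (volterra T K k)] with t h1 h2 h3
  rw [h1, h3, h2, primAt_lift_const]

theorem primAt_toLp (g : BoundedContinuousFunction ℝ K) {t : ℝ} (ht : t ∈ Icc 0 T) :
    primAt T K t (BoundedContinuousFunction.toLp 2 (timeMeasure T) ℝ g) =
      ∫ s in (0 : ℝ)..t, g s :=
  primAt_eq_of_ae _ (BoundedContinuousFunction.coeFn_toLp 2 (timeMeasure T) ℝ g) ht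

theorem volterra_toLp (g : BoundedContinuousFunction ℝ K) :
    (volterra T K (BoundedContinuousFunction.toLp 2 (timeMeasure T) ℝ g) : ℝ → K)
      =ᵐ[timeMeasure T] fun t => ∫ s in (0 : ℝ)..t, g s := by
  filter_upwards [coeFn_volterra (BoundedContinuousFunction.toLp 2 (timeMeasure T) ℝ g),
    ae_restrict_mem measurableSet_Ioo] with t h1 ht
  rw [h1, primAt_toLp g (Ioo_subset_Icc_self ht)]

theorem denseRange_toLp (T : ℝ) (K : Type*) [NormedAddCommGroup K] [InnerProductSpace ℝ K] :
    DenseRange (BoundedContinuousFunction.toLp (E := K) 2 (timeMeasure T) ℝ) :=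
  BoundedContinuousFunction.toLp_denseRange K (timeMeasure T) ℝ (by norm_num)

theorem hasDerivAt_prim {g : ℝ → K} (hg : Continuous g) (t : ℝ) :
    HasDerivAt (fun u => ∫ s in (0 : ℝ)..u, g s) (g t) t :=
  intervalIntegral.integral_hasDerivAt_right (hg.intervalIntegrable _ _)
    hg.stronglyMeasurable.stronglyMeasurableAtFilter hg.continuousAt

/-- Integration by parts in `L²(0,T;K)`. -/
theorem inner_volterra_add (hT : 0 ≤ T) (k l : TimeL2 T K) :
    ⟪volterra T K k, l⟫ + ⟪k, volterra T K l⟫ = ⟪primAt T K T k, primAt T K T l⟫ := by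
  have hT' : T ∈ Icc 0 T := ⟨hT, le_rfl⟩
  revert k l
  suffices h : (fun p : TimeL2 T K × TimeL2 T K =>
      ⟪volterra T K p.1, p.2⟫ + ⟪p.1, volterra T K p.2⟫) =
      fun p => ⟪primAt T K T p.1, primAt T K T p.2⟫ from fun k l => congrFun h (k, l)
  -- Both sides are continuous on `L² × L²`, so bounded continuous functions suffice; their
  -- primitives are differentiable and the product rule applies.
  refine DenseRange.equalizer ((denseRange_toLp T K).prodMap (denseRange_toLp T K))
    (by fun_prop) (by fun_prop) ?_
  funext ⟨g, g'⟩
  simp only [Function.comp, Prod.map]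
  rw [primAt_toLp g hT', primAt_toLp g' hT', L2.inner_def, L2.inner_def]
  have e1 : ∫ s, ⟪(volterra T K (BoundedContinuousFunction.toLp 2 (timeMeasure T) ℝ g) : ℝ → K) s,
      (BoundedContinuousFunction.toLp 2 (timeMeasure T) ℝ g' : ℝ → K) s⟫ ∂timeMeasure T =
      ∫ s in (0 : ℝ)..T, ⟪∫ r in (0 : ℝ)..s, g r, g' s⟫ := by
    rw [intervalIntegral.integral_of_le hT, integral_Ioc_eq_integral_Ioo]
    refine integral_congr_ae ?_
    filter_upwards [volterra_toLp g, BoundedContinuousFunction.coeFn_toLp 2 (timeMeasure T) ℝ g']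
      with s h1 h2
    rw [h1, h2]
  have e2 : ∫ s, ⟪(BoundedContinuousFunction.toLp 2 (timeMeasure T) ℝ g : ℝ → K) s,
      (volterra T K (BoundedContinuousFunction.toLp 2 (timeMeasure T) ℝ g') : ℝ → K) s⟫
        ∂timeMeasure T =
      ∫ s in (0 : ℝ)..T, ⟪g s, ∫ r in (0 : ℝ)..s, g' r⟫ := by
    rw [intervalIntegral.integral_of_le hT, integral_Ioc_eq_integral_Ioo]
    refine integral_congr_ae ?_
    filter_upwards [volterra_toLp g', BoundedContinuousFunction.coeFn_toLp 2 (timeMeasure T) ℝ g]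
      with s h1 h2
    rw [h1, h2]
  have c1 : Continuous fun u => ∫ r in (0 : ℝ)..u, g r :=
    continuous_iff_continuousAt.2 fun t => (hasDerivAt_prim g.continuous t).continuousAt
  have c2 : Continuous fun u => ∫ r in (0 : ℝ)..u, g' r :=
    continuous_iff_continuousAt.2 fun t => (hasDerivAt_prim g'.continuous t).continuousAt
  rw [e1, e2, ← intervalIntegral.integral_add
    ((c1.inner g'.continuous).intervalIntegrable _ _)
    ((g.continuous.inner c2).intervalIntegrable _ _),
    intervalIntegral.integral_eq_sub_of_hasDerivAt
      (fun t _ => (hasDerivAt_prim g.continuous t).inner ℝ (hasDerivAt_prim g'.continuous t))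
      (((c1.inner g'.continuous).add (g.continuous.inner c2)).intervalIntegrable _ _)]
  simp

/-- Lebesgue differentiation: the primitive has derivative `k t` at almost every `t`. -/
theorem eq_zero_of_primAt_eq_zero {k : TimeL2 T K}
    (h : ∀ t ∈ Ioo 0 T, primAt T K t k = 0) : k = 0 := by
  by_cases hT : 0 ≤ T
  swap
  · refine Lp.ext ?_
    simp [timeMeasure, Ioo_eq_empty (fun h => hT h.le), Filter.EventuallyEq]
  have hi : IntervalIntegrable k volume 0 T := by
    rw [intervalIntegrable_iff_integrableOn_Ioo_of_le hT]
    exact (timeL2_integrable k)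
  refine Lp.ext ?_
  filter_upwards [ae_restrict_of_ae hi.ae_hasDerivAt_integral, ae_restrict_mem measurableSet_Ioo,
    Lp.coeFn_zero K 2 (timeMeasure T)] with t h1 ht h0
  rw [h0]
  have h2 := h1 (by rw [uIcc_of_le hT]; exact Ioo_subset_Icc_self ht) 0 (by simp)
  refine h2.unique ((hasDerivAt_const t (0 : K)).congr_of_eventuallyEq ?_)
  filter_upwards [isOpen_Ioo.mem_nhds ht] with s hs
  rw [← primAt_eq k (Ioo_subset_Icc_self hs), h s hs]

theorem ae_forall_Ioo_of_ae_of_continuous {f g : ℝ → K} (hf : ContinuousOn f (Ioo 0 T))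
    (hg : ContinuousOn g (Ioo 0 T)) (h : f =ᵐ[timeMeasure T] g) : ∀ t ∈ Ioo 0 T, f t = g t :=
  Measure.eqOn_of_ae_eq h hf hg (by rw [isOpen_Ioo.interior_eq]; exact subset_closure)

theorem volterra_injective (T : ℝ) (K : Type*) [NormedAddCommGroup K] [InnerProductSpace ℝ K]
    [CompleteSpace K] {k : TimeL2 T K} (h : volterra T K k = 0) : k = 0 := by
  refine eq_zero_of_primAt_eq_zero (ae_forall_Ioo_of_ae_of_continuous
    (continuous_primAt k).continuousOn (g := fun _ => 0) continuousOn_const ?_)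
  filter_upwards [coeFn_volterra k, Lp.coeFn_zero K 2 (timeMeasure T)] with t h1 h0
  rw [← h1, h, h0]; rfl

/-- Constant functions of time. -/
theorem inner_volterra_left (hT : 0 ≤ T) (k l : TimeL2 T K) :
    ⟪volterra T K k, l⟫ = ⟪k, Lp.const 2 (timeMeasure T) (primAt T K T l) - volterra T K l⟫ := by
  have h := inner_volterra_add hT k l
  have h2 : ⟪k, Lp.const 2 (timeMeasure T) (primAt T K T l)⟫ =
      ⟪primAt T K T k, primAt T K T l⟫ := by
    rw [primAt_eq k ⟨hT, le_rfl⟩, intervalIntegral.integral_of_le hT,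
      integral_Ioc_eq_integral_Ioo, real_inner_comm, L2.inner_def, real_inner_comm,
      ← integral_inner (timeL2_integrable k)]
    refine integral_congr_ae ?_
    filter_upwards [Lp.coeFn_const (p := 2) (μ := timeMeasure T) (primAt T K T l)] with s hs
    rw [hs]; rfl
  rw [inner_sub_right, h2]
  linarith

theorem volterra_adjoint_apply (hT : 0 ≤ T) (l : TimeL2 T K) :
    (volterra T K).adjoint l =
      Lp.const 2 (timeMeasure T) (primAt T K T l) - volterra T K l := by
  refine ext_inner_left ℝ fun k => ?_
  rw [ContinuousLinearMap.adjoint_inner_right, inner_volterra_left hT]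

theorem coeFn_volterra_adjoint (hT : 0 ≤ T) (l : TimeL2 T K) :
    ((volterra T K).adjoint l : ℝ → K) =ᵐ[timeMeasure T]
      fun t => primAt T K T l - primAt T K t l := by
  rw [volterra_adjoint_apply hT]
  filter_upwards [Lp.coeFn_sub (Lp.const 2 (timeMeasure T) (primAt T K T l)) (volterra T K l),
    Lp.coeFn_const (p := 2) (μ := timeMeasure T) (primAt T K T l), coeFn_volterra l]
    with t h1 h2 h3
  rw [h1, Pi.sub_apply, h2, h3]; rfl

/-- The adjoint integrates from `t` to `T`. If it annihilates `k`, the primitive from `0` is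
constant on `(0,T)`, and letting `t` tend to `0` shows that the constant is zero. -/
theorem volterra_adjoint_injective (hT : 0 ≤ T) {k : TimeL2 T K}
    (h : (volterra T K).adjoint k = 0) : k = 0 := by
  have h1 : ∀ t ∈ Ioo 0 T, primAt T K T k = primAt T K t k := by
    refine ae_forall_Ioo_of_ae_of_continuous continuousOn_const
      (continuous_primAt k).continuousOn ?_
    filter_upwards [coeFn_volterra_adjoint hT k, Lp.coeFn_zero K 2 (timeMeasure T)] with t h1 h0
    rw [h, h0] at h1
    exact (sub_eq_zero.1 h1.symm)
  by_cases hT0 : T = 0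
  · exact eq_zero_of_primAt_eq_zero fun t ht => absurd (ht.1.trans ht.2) (by simp [hT0])
  have hpos : 0 < T := lt_of_le_of_ne hT (Ne.symm hT0)
  have h2 : primAt T K T k = 0 := by
    have hlim : Filter.Tendsto (fun t => primAt T K t k) (nhdsWithin 0 (Ioi 0)) (nhds 0) := by
      have := (continuous_primAt k).tendsto 0
      rw [primAt_zero_time] at this
      exact this.mono_left nhdsWithin_le_nhds
    refine tendsto_nhds_unique (tendsto_const_nhds.congr' ?_) hlim
    filter_upwards [Ioo_mem_nhdsGT hpos] with t ht using h1 t ht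
  exact eq_zero_of_primAt_eq_zero fun t ht => (h1 t ht).symm.trans h2

/-- Multiplication by `exp (c t)`. -/
theorem isOpFamily_exp (c T : ℝ) (K : Type*) [NormedAddCommGroup K] [InnerProductSpace ℝ K] :
    IsOpFamily fun s : ℝ => Real.exp (c * max 0 (min s T)) • ContinuousLinearMap.id ℝ K := by
  refine ⟨fun v => ?_, ?_⟩
  · simp only [smul_apply]
    exact Continuous.stronglyMeasurable (by fun_prop)
  · refine ⟨Real.exp (|c| * max 0 T), fun s => ?_⟩
    rw [norm_smul, Real.norm_eq_abs, Real.abs_exp]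
    refine (mul_le_of_le_one_right (Real.exp_pos _).le ContinuousLinearMap.norm_id_le).trans ?_
    refine Real.exp_le_exp.2 (mul_le_mul (le_abs_self c) ?_ (le_max_left _ _) (abs_nonneg c))
    exact max_le_max le_rfl (min_le_right _ _)

theorem coeFn_exp_lift [SecondCountableTopology K] (c : ℝ) (k : TimeL2 T K) :
    ((isOpFamily_exp c T K).lift T k : ℝ → K) =ᵐ[timeMeasure T]
      fun s => Real.exp (c * s) • k s := by
  filter_upwards [(isOpFamily_exp c T K).coeFn_lift k, ae_restrict_mem measurableSet_Ioo]
    with s h hs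
  rw [h, min_eq_left hs.2.le, max_eq_right hs.1.le]; rfl

/-- The product rule for `exp (c t) ∫₀ᵗ k`, first for continuous `k` and then by density. It
conjugates `J` with the exponential weight, which later absorbs the lower-order constant of
Gårding's inequality. -/
theorem primAt_exp_lift [SecondCountableTopology K] (c : ℝ) (k : TimeL2 T K) {t : ℝ}
    (ht : t ∈ Icc 0 T) :
    primAt T K t ((isOpFamily_exp c T K).lift T (k + c • volterra T K k)) =
      Real.exp (c * t) • primAt T K t k := by
  revert k
  suffices h : (fun k : TimeL2 T K =>
      primAt T K t ((isOpFamily_exp c T K).lift T (k + c • volterra T K k))) =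
      fun k => Real.exp (c * t) • primAt T K t k from fun k => congrFun h k
  refine DenseRange.equalizer (denseRange_toLp T K) (by fun_prop) (by fun_prop) ?_
  funext g
  simp only [Function.comp]
  set k : TimeL2 T K := BoundedContinuousFunction.toLp 2 (timeMeasure T) ℝ g with hk
  have c1 : Continuous fun u => ∫ r in (0 : ℝ)..u, g r :=
    continuous_iff_continuousAt.2 fun t => (hasDerivAt_prim g.continuous t).continuousAt
  have e : ((isOpFamily_exp c T K).lift T (k + c • volterra T K k) : ℝ → K) =ᵐ[timeMeasure T]
      fun s => Real.exp (c * s) • g s + (Real.exp (c * s) * c) • ∫ r in (0 : ℝ)..s, g r := by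
    filter_upwards [coeFn_exp_lift c (k + c • volterra T K k), Lp.coeFn_add k (c • volterra T K k),
      Lp.coeFn_smul c (volterra T K k), volterra_toLp g,
      BoundedContinuousFunction.coeFn_toLp 2 (timeMeasure T) ℝ g] with s h1 h2 h3 h4 h5
    rw [h1, h2, Pi.add_apply, h3, Pi.smul_apply, hk, h4, h5, smul_add, smul_smul]
  rw [primAt_eq_of_ae _ e ht, primAt_toLp g ht,
    intervalIntegral.integral_eq_sub_of_hasDerivAt (f := fun s =>
      Real.exp (c * s) • ∫ r in (0 : ℝ)..s, g r)]
  · simp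
  · intro s _
    have := (((hasDerivAt_id s).const_mul c).exp).smul (hasDerivAt_prim g.continuous s)
    simp only [id, mul_one] at this
    exact this
  · refine Continuous.intervalIntegrable ?_ _ _
    have := g.continuous
    fun_prop

theorem volterra_exp_lift [SecondCountableTopology K] (c : ℝ) (k : TimeL2 T K) :
    volterra T K ((isOpFamily_exp c T K).lift T (k + c • volterra T K k)) =
      (isOpFamily_exp c T K).lift T (volterra T K k) := by
  refine Lp.ext ?_
  filter_upwards [coeFn_volterra ((isOpFamily_exp c T K).lift T (k + c • volterra T K k)),
    coeFn_volterra k, coeFn_exp_lift c (volterra T K k), ae_restrict_mem measurableSet_Ioo]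
    with t h1 h2 h3 ht
  rw [h1, h3, h2, primAt_exp_lift c k (Ioo_subset_Icc_self ht)]

end TimeIntegration

/-! ### The abstract evolution equation `B v = J F`, `F + A v = f`. -/

section AbstractVolterra

variable {W : Type*} [NormedAddCommGroup W] [InnerProductSpace ℝ W] [CompleteSpace W]

/-- If `J` and its adjoint are injective and commute with the symmetric operator `B`, then the
pairs `(J k, B k)` are dense in the space of solutions `(v, F)` of `B v = J F`. -/
theorem exists_seq_of_volterra {J B : W →L[ℝ] W} (hJ : ∀ k, J k = 0 → k = 0)
    (hJ' : ∀ k, J.adjoint k = 0 → k = 0) (hB : ∀ x y, ⟪B x, y⟫ = ⟪x, B y⟫)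
    (hBJ : ∀ k, B (J k) = J (B k)) {v F : W} (h : B v = J F) :
    ∃ k : ℕ → W, Filter.Tendsto (fun n => J (k n)) Filter.atTop (nhds v) ∧
      Filter.Tendsto (fun n => B (k n)) Filter.atTop (nhds F) := by
  let Φ : W →L[ℝ] WithLp 2 (W × W) :=
    ((WithLp.prodContinuousLinearEquiv 2 ℝ W W).symm : W × W →L[ℝ] WithLp 2 (W × W)) ∘L
      (J.prod B)
  have hΦ1 : ∀ k, (Φ k).fst = J k := fun k => rfl
  have hΦ2 : ∀ k, (Φ k).snd = B k := fun k => rfl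
  let X0 : Submodule ℝ (WithLp 2 (W × W)) := LinearMap.range (Φ : W →ₗ[ℝ] WithLp 2 (W × W))
  let X : Set (WithLp 2 (W × W)) := {p | B p.fst = J p.snd}
  have hX : IsClosed X := isClosed_eq (by fun_prop) (by fun_prop)
  have hX0 : (X0 : Set (WithLp 2 (W × W))) ⊆ X := by
    rintro _ ⟨k, rfl⟩
    exact hBJ k
  have hcl : (X0.topologicalClosure : Set (WithLp 2 (W × W))) ⊆ X := by
    rw [Submodule.topologicalClosure_coe]
    exact closure_minimal hX0 hX
  have : CompleteSpace X0.topologicalClosure :=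
    X0.isClosed_topologicalClosure.completeSpace_coe
  let p : WithLp 2 (W × W) := WithLp.toLp 2 (v, F)
  have hp : p ∈ X := h
  -- The part `r` of `(v, F)` orthogonal to all `(J k, B k)` still satisfies `B r₁ = J r₂`, because
  -- the closure lies in this closed solution space. The goal is `r = 0`.
  obtain ⟨q, hq, r, hr, hqr⟩ := X0.topologicalClosure.exists_add_mem_mem_orthogonal p
  have hqX := hcl hq
  have hrX : B r.fst = J r.snd := by
    have h1 : B p.fst = J p.snd := hp
    have h2 : B q.fst = J q.snd := hqX
    rw [hqr] at h1
    simp only [WithLp.add_fst, WithLp.add_snd, map_add] at h1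
    rw [h2] at h1
    exact add_left_cancel h1
  have horth : ∀ k, ⟪J k, r.fst⟫ + ⟪B k, r.snd⟫ = 0 := by
    intro k
    have := (Submodule.mem_orthogonal _ _).1 hr (Φ k)
      (X0.le_topologicalClosure ⟨k, rfl⟩)
    rwa [WithLp.prod_inner_apply] at this
  have e1 : J.adjoint r.fst + B r.snd = 0 := by
    refine ext_inner_left ℝ fun k => ?_
    rw [inner_add_right, ContinuousLinearMap.adjoint_inner_right, inner_zero_right, ← hB]
    exact horth k
  -- Orthogonality says `J† r₁ = -B r₂`, hence `‖J† r₁‖² = -⟪r₁, J B r₂⟫ = -⟪r₁, B J r₂⟫ = -⟪r₁, B B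
  -- r₁⟫ = -‖B r₁‖²`.
  have e2 : ‖B r.fst‖ ^ 2 + ‖J.adjoint r.fst‖ ^ 2 = 0 := by
    rw [← real_inner_self_eq_norm_sq, ← real_inner_self_eq_norm_sq,
      ContinuousLinearMap.adjoint_inner_right, eq_neg_of_add_eq_zero_left e1, map_neg, ← hBJ,
      ← hrX, inner_neg_left, hB (B r.fst), add_neg_cancel]
  have e3 : J.adjoint r.fst = 0 := by
    have : ‖J.adjoint r.fst‖ ^ 2 = 0 := by nlinarith [sq_nonneg ‖B r.fst‖, sq_nonneg ‖J.adjoint r.fst‖]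
    simpa using this
  have r1 : r.fst = 0 := hJ' _ e3
  have r2 : r.snd = 0 := hJ _ (by rw [← hrX, r1, map_zero])
  have hpq : p = q := by
    rw [hqr]
    have : r = 0 := by
      apply WithLp.ofLp_injective
      exact Prod.ext r1 r2
    rw [this, add_zero]
  rw [← hpq] at hq
  have hq' : p ∈ closure (X0 : Set (WithLp 2 (W × W))) := hq
  obtain ⟨x, hx, hlim⟩ := mem_closure_iff_seq_limit.1 hq'
  choose k hk using hx
  refine ⟨k, ?_, ?_⟩
  · have : Filter.Tendsto (fun n => (x n).fst) Filter.atTop (nhds p.fst) :=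
      ((by fun_prop : Continuous fun z : WithLp 2 (W × W) => z.fst).tendsto _).comp hlim
    refine this.congr fun n => ?_
    rw [← hk n]; rfl
  · have : Filter.Tendsto (fun n => (x n).snd) Filter.atTop (nhds p.snd) :=
      ((by fun_prop : Continuous fun z : WithLp 2 (W × W) => z.snd).tendsto _).comp hlim
    refine this.congr fun n => ?_
    rw [← hk n]; rfl

/-- The energy inequality `⟪F, v⟫ ≥ 0` holds on the pairs `(J k, B k)` by `hpos` and passes to the
limit by density. -/
theorem inner_nonneg_of_volterra {J B : W →L[ℝ] W} (hJ : ∀ k, J k = 0 → k = 0)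
    (hJ' : ∀ k, J.adjoint k = 0 → k = 0) (hB : ∀ x y, ⟪B x, y⟫ = ⟪x, B y⟫)
    (hBJ : ∀ k, B (J k) = J (B k)) (hpos : ∀ k, 0 ≤ ⟪B k, J k⟫) {v F : W} (h : B v = J F) :
    0 ≤ ⟪F, v⟫ := by
  obtain ⟨k, h1, h2⟩ := exists_seq_of_volterra hJ hJ' hB hBJ h
  exact ge_of_tendsto' (h2.inner h1) fun n => hpos _

/-- Solvability of the abstract evolution equation `J⁻¹ B v + A v = f`. -/
theorem exists_volterra_solution {J B : W →L[ℝ] W} (hJ : ∀ k, J k = 0 → k = 0)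
    (hJ' : ∀ k, J.adjoint k = 0 → k = 0) (hB : ∀ x y, ⟪B x, y⟫ = ⟪x, B y⟫)
    (hBJ : ∀ k, B (J k) = J (B k)) (hpos : ∀ k, 0 ≤ ⟪B k, J k⟫) (A : W →L[ℝ] W) {c : ℝ}
    (hc : 0 < c) (hA : ∀ v, c * ‖v‖ ^ 2 ≤ ⟪A v, v⟫) (f : W) :
    ∃ v F, B v = J F ∧ F + A v = f := by
  let X : Submodule ℝ (W × W) := LinearMap.ker
    ((B ∘L ContinuousLinearMap.fst ℝ W W - J ∘L ContinuousLinearMap.snd ℝ W W :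
      W × W →L[ℝ] W) : W × W →ₗ[ℝ] W)
  have hXmem : ∀ p : W × W, p ∈ X ↔ B p.1 = J p.2 := fun p => by
    simp [X, LinearMap.mem_ker, sub_eq_zero]
  have hXc : IsClosed (X : Set (W × W)) := by
    have : (X : Set (W × W)) = {p | B p.1 = J p.2} := Set.ext hXmem
    rw [this]
    exact isClosed_eq (by fun_prop) (by fun_prop)
  have : CompleteSpace X := hXc.completeSpace_coe
  let P : X →L[ℝ] W := (ContinuousLinearMap.snd ℝ W W + A ∘L ContinuousLinearMap.fst ℝ W W) ∘L
    X.subtypeL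
  have hP : ∀ p : X, P p = p.1.2 + A p.1.1 := fun p => rfl
  -- Since `⟪F, v⟫ ≥ 0`, pairing `F + A v` with `v` and coercivity bound `v`; then `F = P p - A v`
  -- is bounded as well. So `P` is bounded below and its range is closed.
  have hest : ∀ p : X, ‖p‖ ≤ (1 / c + (1 + ‖A‖ / c)) * ‖P p‖ := by
    intro p
    have h0 := inner_nonneg_of_volterra hJ hJ' hB hBJ hpos ((hXmem _).1 p.2)
    have h1 : c * ‖p.1.1‖ ^ 2 ≤ ‖P p‖ * ‖p.1.1‖ := by
      refine (hA _).trans (le_trans ?_ (real_inner_le_norm (P p) p.1.1))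
      rw [hP, inner_add_left]
      linarith
    have h2 : ‖p.1.1‖ ≤ 1 / c * ‖P p‖ := by
      rw [one_div, ← div_eq_inv_mul, le_div_iff₀ hc]
      rcases (norm_nonneg p.1.1).eq_or_lt with h | h
      · rw [← h]; simp
      · nlinarith
    have h3 : ‖p.1.2‖ ≤ (1 + ‖A‖ / c) * ‖P p‖ := by
      have : p.1.2 = P p - A p.1.1 := by rw [hP]; abel
      calc ‖p.1.2‖ = ‖P p - A p.1.1‖ := congrArg _ this
        _ ≤ ‖P p‖ + ‖A‖ * ‖p.1.1‖ := (norm_sub_le _ _).trans (by gcongr; exact A.le_opNorm _)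
        _ ≤ ‖P p‖ + ‖A‖ * (1 / c * ‖P p‖) := by gcongr
        _ = _ := by ring
    have h4 : 0 ≤ 1 / c * ‖P p‖ := by positivity
    have h5 : 0 ≤ (1 + ‖A‖ / c) * ‖P p‖ := by positivity
    rw [add_mul]
    exact max_le (h2.trans (le_add_of_nonneg_right h5)) (h3.trans (le_add_of_nonneg_left h4))
  have hCpos : 0 ≤ 1 / c + (1 + ‖A‖ / c) := by positivity
  have hanti : AntilipschitzWith ⟨_, hCpos⟩ P := P.antilipschitz_of_bound hest
  have hclosed : IsClosed (LinearMap.range (P : X →ₗ[ℝ] W) : Set W) := by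
    have := hanti.isClosed_range P.uniformContinuous
    rwa [← ContinuousLinearMap.coe_coe, ← LinearMap.coe_range] at this
  have : CompleteSpace (LinearMap.range (P : X →ₗ[ℝ] W)) := hclosed.completeSpace_coe
  have htop : LinearMap.range (P : X →ₗ[ℝ] W) = ⊤ := by
    rw [← Submodule.orthogonal_eq_bot_iff, Submodule.eq_bot_iff]
    intro g hg
    have h1 : ∀ k, ⟪B k + A (J k), g⟫ = 0 := fun k =>
      (Submodule.mem_orthogonal _ _).1 hg _ ⟨⟨(J k, B k), (hXmem _).2 (hBJ k)⟩, rfl⟩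
    have h2 : B g = J.adjoint (-A.adjoint g) := by
      refine ext_inner_left ℝ fun k => ?_
      rw [ContinuousLinearMap.adjoint_inner_right, inner_neg_right,
        ContinuousLinearMap.adjoint_inner_right, ← hB]
      have := h1 k
      rw [inner_add_left] at this
      linarith
    -- A vector `g` orthogonal to the range solves the adjoint problem, which has the same shape
    -- with `J†` in place of `J`. The energy inequality gives `⟪-A† g, g⟫ ≥ 0`, and coercivity
    -- forces `g = 0`.
    have h3 := inner_nonneg_of_volterra (J := J.adjoint) (B := B) hJ'
      (fun k hk => hJ k (by rwa [ContinuousLinearMap.adjoint_adjoint] at hk)) hB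
      (fun k => ?_) (fun k => ?_) h2
    · rw [inner_neg_left, ContinuousLinearMap.adjoint_inner_left, real_inner_comm] at h3
      have h4 := hA g
      have h5 : ‖g‖ ^ 2 = 0 := by nlinarith [sq_nonneg ‖g‖]
      simpa using h5
    · refine ext_inner_left ℝ fun l => ?_
      rw [← hB, ContinuousLinearMap.adjoint_inner_right, ContinuousLinearMap.adjoint_inner_right,
        ← hBJ, hB]
    · rw [ContinuousLinearMap.adjoint_inner_right, ← hBJ, hB, real_inner_comm]
      have := hpos k
      rwa [real_inner_comm, real_inner_comm] at this
  have hf : f ∈ LinearMap.range (P : X →ₗ[ℝ] W) := htop ▸ Submodule.mem_top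
  obtain ⟨p, hp⟩ := hf
  exact ⟨p.1.1, p.1.2, (hXmem _).1 p.2, hp⟩

end AbstractVolterra

/-! ### Energy identity, continuous representatives and Green's formula. -/

section Evolution

variable {T : ℝ} {V H : Type*} [NormedAddCommGroup V] [InnerProductSpace ℝ V] [CompleteSpace V]
  [SecondCountableTopology V] [NormedAddCommGroup H] [InnerProductSpace ℝ H] [CompleteSpace H]
  [SecondCountableTopology H]

theorem inner_lift_left {A A' : ℝ → V →L[ℝ] V} (hA : IsOpFamily A) (hA' : IsOpFamily A')
    (h : ∀ s ∈ Ioo 0 T, ∀ v w, ⟪A s v, w⟫ = ⟪v, A' s w⟫) (k l : TimeL2 T V) :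
    ⟪hA.lift T k, l⟫ = ⟪k, hA'.lift T l⟫ := by
  rw [L2.inner_def, L2.inner_def]
  refine integral_congr_ae ?_
  filter_upwards [hA.coeFn_lift k, hA'.coeFn_lift l, ae_restrict_mem measurableSet_Ioo]
    with s h1 h2 hs
  rw [h1, h2, h s hs]

theorem inner_lift_const_left (L : V →L[ℝ] H) (k : TimeL2 T V) (l : TimeL2 T H) :
    ⟪(isOpFamily_const L).lift T k, l⟫ = ⟪k, (isOpFamily_const L.adjoint).lift T l⟫ := by
  rw [L2.inner_def, L2.inner_def]
  refine integral_congr_ae ?_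
  filter_upwards [(isOpFamily_const L).coeFn_lift k, (isOpFamily_const L.adjoint).coeFn_lift l]
    with s h1 h2
  rw [h1, h2, ContinuousLinearMap.adjoint_inner_right]

/-- Composition with `ι† ι` on `L²(0,T;V)`. -/
def gramOp (T : ℝ) (ι : V →L[ℝ] H) : TimeL2 T V →L[ℝ] TimeL2 T V :=
  (isOpFamily_const (ι.adjoint ∘L ι)).lift T

theorem coeFn_gramOp (ι : V →L[ℝ] H) (k : TimeL2 T V) :
    (gramOp T ι k : ℝ → V) =ᵐ[timeMeasure T] fun s => ι.adjoint (ι (k s)) :=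
  (isOpFamily_const (ι.adjoint ∘L ι)).coeFn_lift k

theorem gramOp_eq (ι : V →L[ℝ] H) (k : TimeL2 T V) :
    gramOp T ι k =
      (isOpFamily_const ι.adjoint).lift T ((isOpFamily_const ι).lift T k) := by
  refine Lp.ext ?_
  filter_upwards [coeFn_gramOp ι k, (isOpFamily_const ι).coeFn_lift k,
    (isOpFamily_const ι.adjoint).coeFn_lift ((isOpFamily_const ι).lift T k)] with s h1 h2 h3
  rw [h1, h3, h2]

theorem inner_gramOp_left (ι : V →L[ℝ] H) (k l : TimeL2 T V) :
    ⟪gramOp T ι k, l⟫ = ⟪(isOpFamily_const ι).lift T k, (isOpFamily_const ι).lift T l⟫ := by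
  rw [inner_lift_const_left, ← gramOp_eq]
  rw [L2.inner_def, L2.inner_def]
  refine integral_congr_ae ?_
  filter_upwards [coeFn_gramOp ι k, coeFn_gramOp ι l] with s h1 h2
  rw [h1, h2, ContinuousLinearMap.adjoint_inner_left, ContinuousLinearMap.adjoint_inner_right]

theorem gramOp_symm (ι : V →L[ℝ] H) (k l : TimeL2 T V) :
    ⟪gramOp T ι k, l⟫ = ⟪k, gramOp T ι l⟫ := by
  rw [inner_gramOp_left, real_inner_comm, ← inner_gramOp_left, real_inner_comm]

theorem gramOp_volterra (ι : V →L[ℝ] H) (k : TimeL2 T V) :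
    gramOp T ι (volterra T V k) = volterra T V (gramOp T ι k) :=
  (volterra_lift_const _ _).symm

/-- Integration by parts for `ι k` with itself: the energy identity for a trajectory that starts at
zero. -/
theorem inner_gramOp_volterra (hT : 0 ≤ T) (ι : V →L[ℝ] H) (k : TimeL2 T V) :
    2 * ⟪gramOp T ι k, volterra T V k⟫ = ‖ι (primAt T V T k)‖ ^ 2 := by
  have h := inner_volterra_add hT ((isOpFamily_const ι).lift T k) ((isOpFamily_const ι).lift T k)
  rw [volterra_lift_const, primAt_lift_const, real_inner_self_eq_norm_sq, real_inner_comm] at h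
  rw [inner_gramOp_left]
  linarith

/-- Apply the energy identity to `k' = 1_{(-∞,t]} k`: its Gram image vanishes after `t`, and up to
time `t` its primitive is that of `k`. The bound is uniform in `t`, so `L²` convergence of `J k` and
`B k` yields uniform convergence in `H`. -/
theorem norm_sq_primAt_le (hT : 0 ≤ T) (ι : V →L[ℝ] H) (k : TimeL2 T V) {t : ℝ}
    (ht : t ∈ Icc 0 T) :
    ‖ι (primAt T V t k)‖ ^ 2 ≤ 2 * (‖gramOp T ι k‖ * ‖volterra T V k‖) := by
  let k' : TimeL2 T V := ((Lp.memLp k).indicator measurableSet_Iic : MemLp ((Iic t).indicator k) 2 _).toLp _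
  have hk' : (k' : ℝ → V) =ᵐ[timeMeasure T] (Iic t).indicator k := MemLp.coeFn_toLp _
  have e1 : ∀ s, 0 ≤ s → s ≤ t → primAt T V s k' = primAt T V s k := fun s hs hst => by
    refine primAt_congr hs ?_
    filter_upwards [hk'] with r hr hrs
    rw [hr, indicator_of_mem (show r ∈ Iic t from hrs.trans hst)]
  have e2 : primAt T V T k' = primAt T V t k := by
    rw [← e1 t ht.1 le_rfl, primAt_apply, primAt_apply,
      ← intervalIntegral.integral_add_adjacent_intervals
        (timeL2_intervalIntegrable k' 0 t) (timeL2_intervalIntegrable k' t T)]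
    convert add_zero _
    rw [intervalIntegral.integral_of_le ht.2]
    refine setIntegral_eq_zero_of_ae_eq_zero ?_
    filter_upwards [hk'] with r hr hrt
    rw [hr, indicator_of_notMem (by simpa using hrt.1)]
  have e3 : ⟪gramOp T ι k', volterra T V k'⟫ = ⟪gramOp T ι k', volterra T V k⟫ := by
    rw [L2.inner_def, L2.inner_def]
    refine integral_congr_ae ?_
    filter_upwards [coeFn_gramOp ι k', hk', coeFn_volterra k, coeFn_volterra k',
      ae_restrict_mem measurableSet_Ioo] with s h1 h2 h3 h4 hs
    rw [h1, h2, h3, h4]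
    by_cases hst : s ≤ t
    · rw [e1 s hs.1.le hst]
    · rw [indicator_of_notMem (by simpa using hst)]
      simp
  have e4 : ‖gramOp T ι k'‖ ≤ ‖gramOp T ι k‖ := by
    refine Lp.norm_le_norm_of_ae_le ?_
    filter_upwards [coeFn_gramOp ι k', hk', coeFn_gramOp ι k] with s h1 h2 h3
    rw [h1, h2, h3]
    by_cases hst : s ∈ Iic t
    · rw [indicator_of_mem hst]
    · rw [indicator_of_notMem hst]
      simp
  have := inner_gramOp_volterra hT ι k'
  rw [e2, e3] at this
  rw [← this]
  refine mul_le_mul_of_nonneg_left ((real_inner_le_norm _ _).trans ?_) (by norm_num)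
  gcongr

theorem exists_seq_gramOp (hT : 0 ≤ T) (ι : V →L[ℝ] H) {v F : TimeL2 T V}
    (h : gramOp T ι v = volterra T V F) :
    ∃ k : ℕ → TimeL2 T V,
      Filter.Tendsto (fun n => volterra T V (k n)) Filter.atTop (nhds v) ∧
      Filter.Tendsto (fun n => gramOp T ι (k n)) Filter.atTop (nhds F) :=
  exists_seq_of_volterra (fun _ => volterra_injective T V)
    (fun _ => volterra_adjoint_injective hT) (gramOp_symm ι) (gramOp_volterra ι) h

theorem cauchy_of_tendsto (hT : 0 ≤ T) (ι : V →L[ℝ] H) {v F : TimeL2 T V} {k : ℕ → TimeL2 T V}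
    (h1 : Filter.Tendsto (fun n => volterra T V (k n)) Filter.atTop (nhds v))
    (h2 : Filter.Tendsto (fun n => gramOp T ι (k n)) Filter.atTop (nhds F)) {ε : ℝ} (hε : 0 < ε) :
    ∃ N, ∀ m ≥ N, ∀ n ≥ N, ∀ t ∈ Icc 0 T,
      dist (ι (primAt T V t (k m))) (ι (primAt T V t (k n))) < ε := by
  obtain ⟨N1, hN1⟩ := Metric.cauchySeq_iff.1 h1.cauchySeq (ε / 2) (by positivity)
  obtain ⟨N2, hN2⟩ := Metric.cauchySeq_iff.1 h2.cauchySeq (ε / 2) (by positivity)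
  refine ⟨max N1 N2, fun m hm n hn t ht => ?_⟩
  have d1 := hN1 m (le_of_max_le_left hm) n (le_of_max_le_left hn)
  have d2 := hN2 m (le_of_max_le_right hm) n (le_of_max_le_right hn)
  rw [dist_eq_norm, ← map_sub] at d1 d2 ⊢
  rw [← map_sub]
  have h := norm_sq_primAt_le hT ι (k m - k n) ht
  have : ‖gramOp T ι (k m - k n)‖ * ‖volterra T V (k m - k n)‖ ≤ (ε / 2) * (ε / 2) := by gcongr
  refine lt_of_pow_lt_pow_left₀ 2 hε.le ?_
  nlinarith

theorem adjoint_primAt (ι : V →L[ℝ] H) (k : TimeL2 T V) (t : ℝ) :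
    ι.adjoint (ι (primAt T V t k)) = primAt T V t (gramOp T ι k) :=
  (primAt_lift_const (ι.adjoint ∘L ι) k t).symm

/-- Solutions of `B v = J F` have a representative in `C([0,T];H)`. -/
theorem exists_continuous_of_gramOp (hT : 0 ≤ T) {ι : V →L[ℝ] H}
    (hι : ∀ x, ι.adjoint x = 0 → x = 0) {v F : TimeL2 T V}
    (h : gramOp T ι v = volterra T V F) :
    ∃ y : C(Icc (0 : ℝ) T, H), (∀ t, ι.adjoint (y t) = primAt T V t F) ∧
      ∀ᵐ t ∂timeMeasure T, ι (v t) = IccExtend hT y t := by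
  obtain ⟨k, h1, h2⟩ := exists_seq_gramOp hT ι h
  let Y : ℕ → C(Icc (0 : ℝ) T, H) := fun n =>
    ⟨fun t => ι (primAt T V t (k n)),
      ι.continuous.comp ((continuous_primAt (k n)).comp continuous_subtype_val)⟩
  have hY : CauchySeq Y := by
    refine Metric.cauchySeq_iff.2 fun ε hε => ?_
    obtain ⟨N, hN⟩ := cauchy_of_tendsto hT ι h1 h2 hε
    refine ⟨N, fun m hm n hn => ?_⟩
    have : Nonempty (Icc (0 : ℝ) T) := ⟨⟨0, le_rfl, hT⟩⟩
    rw [ContinuousMap.dist_lt_iff_of_nonempty]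
    exact fun t => hN m hm n hn t t.2
  obtain ⟨y, hy⟩ := cauchySeq_tendsto_of_complete hY
  have hyt : ∀ t, ι.adjoint (y t) = primAt T V t F := by
    intro t
    have l1 : Filter.Tendsto (fun n => ι.adjoint (Y n t)) Filter.atTop (nhds (ι.adjoint (y t))) :=
      (ι.adjoint.continuous.tendsto _).comp (((continuous_eval_const t : Continuous fun z : C(Icc (0 : ℝ) T, H) => z t).tendsto _).comp hy)
    have l2 : Filter.Tendsto (fun n => primAt T V t (gramOp T ι (k n))) Filter.atTop
        (nhds (primAt T V t F)) := ((primAt T V t).continuous.tendsto _).comp h2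
    refine tendsto_nhds_unique l1 (l2.congr fun n => ?_)
    rw [← adjoint_primAt]; rfl
  refine ⟨y, hyt, ?_⟩
  -- The uniform limit and `ι v` have the same image `∫₀ᵗ F` under `ι†`, which is injective.
  filter_upwards [coeFn_gramOp ι v, coeFn_volterra F, ae_restrict_mem measurableSet_Ioo]
    with t e1 e2 ht
  rw [h, e2] at e1
  rw [IccExtend_of_mem hT y (Ioo_subset_Icc_self ht), ← sub_eq_zero]
  refine hι _ ?_
  rw [map_sub, hyt, ← e1, sub_self]

/-- The Green formula for a forward solution with zero initial value and a backward solution with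
terminal value `ξ`. -/
theorem inner_eq_of_forward_backward (hT : 0 ≤ T) {ι : V →L[ℝ] H}
    (hι : ∀ x, ι.adjoint x = 0 → x = 0) {v F w G : TimeL2 T V} {x ξ : H}
    (hv : gramOp T ι v = volterra T V F) (hx : ι.adjoint x = primAt T V T F)
    (hw : ∀ᵐ t ∂timeMeasure T,
      ι.adjoint (ι (w t)) = ι.adjoint ξ + (primAt T V T G - primAt T V t G)) :
    ⟪F, w⟫ = ⟪x, ξ⟫ + ⟪v, G⟫ := by
  have hT' : T ∈ Icc 0 T := ⟨hT, le_rfl⟩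
  obtain ⟨k, h1, h2⟩ := exists_seq_gramOp hT ι hv
  have hc : CauchySeq fun n => ι (primAt T V T (k n)) := by
    refine Metric.cauchySeq_iff.2 fun ε hε => ?_
    obtain ⟨N, hN⟩ := cauchy_of_tendsto hT ι h1 h2 hε
    exact ⟨N, fun m hm n hn => hN m hm n hn T hT'⟩
  obtain ⟨z, hz⟩ := cauchySeq_tendsto_of_complete hc
  have hzx : z = x := by
    rw [← sub_eq_zero]
    refine hι _ ?_
    rw [map_sub, sub_eq_zero, hx]
    have l1 : Filter.Tendsto (fun n => ι.adjoint (ι (primAt T V T (k n)))) Filter.atTop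
        (nhds (ι.adjoint z)) := (ι.adjoint.continuous.tendsto _).comp hz
    have l2 : Filter.Tendsto (fun n => primAt T V T (gramOp T ι (k n))) Filter.atTop
        (nhds (primAt T V T F)) := ((primAt T V T).continuous.tendsto _).comp h2
    exact tendsto_nhds_unique l1 (l2.congr fun n => (adjoint_primAt ι _ _).symm)
  -- For `(J k, B k)` Green's formula is mere duality: the backward equation reads `B w = ι† ξ + J†
  -- G`, and `J†` moves over to `k`. The density of such pairs gives the general case.
  have key : ∀ k : TimeL2 T V, ⟪gramOp T ι k, w⟫ =
      ⟪ι (primAt T V T k), ξ⟫ + ⟪volterra T V k, G⟫ := by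
    intro k
    rw [gramOp_symm, ← ContinuousLinearMap.adjoint_inner_right (volterra T V)]
    have e : gramOp T ι w = Lp.const 2 (timeMeasure T) (ι.adjoint ξ) +
        (volterra T V).adjoint G := by
      refine Lp.ext ?_
      filter_upwards [coeFn_gramOp ι w, hw, Lp.coeFn_const (p := 2) (μ := timeMeasure T) (ι.adjoint ξ),
        coeFn_volterra_adjoint hT G,
        Lp.coeFn_add (Lp.const 2 (timeMeasure T) (ι.adjoint ξ)) ((volterra T V).adjoint G)]
        with t e1 e2 e3 e4 e5
      rw [e5, Pi.add_apply, e3, e4, e1, e2]; rfl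
    rw [e, inner_add_right]
    congr 1
    rw [primAt_eq k hT', intervalIntegral.integral_of_le hT, integral_Ioc_eq_integral_Ioo,
      ← ContinuousLinearMap.adjoint_inner_right, real_inner_comm, L2.inner_def, real_inner_comm,
      ← integral_inner (timeL2_integrable k)]
    refine integral_congr_ae ?_
    filter_upwards [Lp.coeFn_const (p := 2) (μ := timeMeasure T) (ι.adjoint ξ)] with s hs
    rw [hs]; rfl
  have l1 : Filter.Tendsto (fun n => ⟪gramOp T ι (k n), w⟫) Filter.atTop (nhds ⟪F, w⟫) :=
    h2.inner tendsto_const_nhds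
  have l2 : Filter.Tendsto (fun n => ⟪ι (primAt T V T (k n)), ξ⟫ + ⟪volterra T V (k n), G⟫)
      Filter.atTop (nhds (⟪z, ξ⟫ + ⟪v, G⟫)) :=
    (hz.inner tendsto_const_nhds).add (h1.inner tendsto_const_nhds)
  rw [← hzx]
  exact tendsto_nhds_unique l1 (l2.congr fun n => (key _).symm)

/-- Existence for the evolution equation under Gårding's inequality, in `L²(0,T;V)`. -/
theorem exists_gramOp_solution (hT : 0 ≤ T) (ι : V →L[ℝ] H) {A : ℝ → V →L[ℝ] V}
    (hA : IsOpFamily A) {c C : ℝ} (hc : 0 < c)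
    (hG : ∀ s ∈ Ioo 0 T, ∀ v, c * ‖v‖ ^ 2 ≤ ⟪A s v, v⟫ + C * ‖ι v‖ ^ 2) (f : TimeL2 T V) :
    ∃ v F, gramOp T ι v = volterra T V F ∧ F + hA.lift T v = f := by
  have hco : ∀ v : TimeL2 T V, c * ‖v‖ ^ 2 ≤ ⟪(hA.lift T + C • gramOp T ι) v, v⟫ := by
    intro v
    have e : (hA.lift T + C • gramOp T ι) v = hA.lift T v + C • gramOp T ι v := rfl
    rw [e, ← real_inner_self_eq_norm_sq, inner_add_left, real_inner_smul_left, L2.inner_def,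
      L2.inner_def, L2.inner_def, ← integral_const_mul, ← integral_const_mul, ← integral_add
        (L2.integrable_inner (hA.lift T v) v) ((L2.integrable_inner (gramOp T ι v) v).const_mul C)]
    refine integral_mono_ae ((L2.integrable_inner v v).const_mul c)
      ((L2.integrable_inner (hA.lift T v) v).add
        ((L2.integrable_inner (gramOp T ι v) v).const_mul C)) ?_
    filter_upwards [hA.coeFn_lift v, coeFn_gramOp ι v, ae_restrict_mem measurableSet_Ioo]
      with s h1 h2 hs
    simp only [h1, h2, ContinuousLinearMap.adjoint_inner_left, real_inner_self_eq_norm_sq]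
    exact hG s hs _
  -- `M C` multiplies by `exp (C t)`. Solve for the coercive operator `A + C B` with right-hand side
  -- `exp (-C t) f`, then multiply back: the time derivative becomes `exp (C t) (F + C J F)`, and `J
  -- F = B v` cancels the added term.
  let M : ℝ → TimeL2 T V →L[ℝ] TimeL2 T V := fun c => (isOpFamily_exp c T V).lift T
  obtain ⟨v, F, h1, h2⟩ := exists_volterra_solution (fun _ => volterra_injective T V)
    (fun _ => volterra_adjoint_injective hT) (gramOp_symm ι) (gramOp_volterra ι) (fun k => by
      have := inner_gramOp_volterra hT ι k
      have := sq_nonneg ‖ι (primAt T V T k)‖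
      linarith) (hA.lift T + C • gramOp T ι) hc hco (M (-C) f)
  refine ⟨M C v, M C (F + C • volterra T V F), ?_, ?_⟩
  · rw [volterra_exp_lift, ← h1]
    refine Lp.ext ?_
    filter_upwards [coeFn_gramOp ι (M C v), coeFn_exp_lift C v, coeFn_exp_lift C (gramOp T ι v),
      coeFn_gramOp ι v] with s e1 e2 e3 e4
    rw [e1, e2, e3, e4, map_smul, map_smul]
  · have e : hA.lift T (M C v) = M C (hA.lift T v) := by
      refine Lp.ext ?_
      filter_upwards [hA.coeFn_lift (M C v), coeFn_exp_lift C v, coeFn_exp_lift C (hA.lift T v),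
        hA.coeFn_lift v] with s e1 e2 e3 e4
      rw [e1, e2, e3, e4, map_smul]
    have e' : M C (M (-C) f) = f := by
      refine Lp.ext ?_
      filter_upwards [coeFn_exp_lift C (M (-C) f), coeFn_exp_lift (-C) f] with s e1 e2
      rw [e1, e2, smul_smul, ← Real.exp_add]
      simp
    rw [e, ← map_add, ← h1]
    conv_rhs => rw [← e', ← h2]
    congr 1
    simp only [add_apply, smul_apply]
    abel

end Evolution

/-! ### Weak solutions of forward and backward equations. -/

section WeakSolutions

variable {T : ℝ} {V H : Type*} [NormedAddCommGroup V] [InnerProductSpace ℝ V] [CompleteSpace V]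
  [SecondCountableTopology V] [NormedAddCommGroup H] [InnerProductSpace ℝ H] [CompleteSpace H]
  [SecondCountableTopology H]

theorem continuous_IccExtend (hT : 0 ≤ T) (y : C(Icc (0 : ℝ) T, H)) :
    Continuous (IccExtend hT y) := y.continuous.Icc_extend'

theorem memLp_IccExtend (hT : 0 ≤ T) (y : C(Icc (0 : ℝ) T, H)) :
    MemLp (IccExtend hT y) 2 (timeMeasure T) :=
  MemLp.of_bound (continuous_IccExtend hT y).aestronglyMeasurable ‖y‖
    (.of_forall fun _ => y.norm_coe_le_norm _)

/-- A continuous trajectory as an element of `L²(0,T;H)`. -/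
def trajL2 (hT : 0 ≤ T) (y : C(Icc (0 : ℝ) T, H)) : TimeL2 T H := (memLp_IccExtend hT y).toLp _

theorem coeFn_trajL2 (hT : 0 ≤ T) (y : C(Icc (0 : ℝ) T, H)) :
    (trajL2 hT y : ℝ → H) =ᵐ[timeMeasure T] IccExtend hT y := MemLp.coeFn_toLp _

/-- Weak solutions of `y' + A y = γ`, `y(0) = 0`. -/
def WeakForward (hT : 0 ≤ T) (ι : V →L[ℝ] H) {A : ℝ → V →L[ℝ] V} (hA : IsOpFamily A)
    (γ : TimeL2 T H) (y : C(Icc (0 : ℝ) T, H)) : Prop :=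
  ∃ v : TimeL2 T V, (∀ᵐ t ∂timeMeasure T, ι (v t) = IccExtend hT y t) ∧
    ∀ t ∈ Icc 0 T, ι.adjoint (IccExtend hT y t) =
      primAt T V t ((isOpFamily_const ι.adjoint).lift T γ - hA.lift T v)

/-- Weak solutions of `-p' + A p = γ`, `p(T) = ξ`. -/
def WeakBackward (hT : 0 ≤ T) (ι : V →L[ℝ] H) {A : ℝ → V →L[ℝ] V} (hA : IsOpFamily A)
    (γ : TimeL2 T H) (ξ : H) (p : C(Icc (0 : ℝ) T, H)) : Prop :=
  ∃ v : TimeL2 T V, (∀ᵐ t ∂timeMeasure T, ι (v t) = IccExtend hT p t) ∧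
    ∀ t ∈ Icc 0 T, ι.adjoint (IccExtend hT p t) = ι.adjoint ξ +
      (primAt T V T ((isOpFamily_const ι.adjoint).lift T γ - hA.lift T v) -
        primAt T V t ((isOpFamily_const ι.adjoint).lift T γ - hA.lift T v))

/-- In `inner_eq_of_forward_backward` the two operator terms cancel because the families are adjoint
to each other; only the sources and the terminal values survive. -/
theorem weakForward_green (hT : 0 ≤ T) {ι : V →L[ℝ] H} (hι : ∀ x, ι.adjoint x = 0 → x = 0)
    {A A' : ℝ → V →L[ℝ] V} {hA : IsOpFamily A} {hA' : IsOpFamily A'}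
    (hAA' : ∀ s ∈ Ioo 0 T, ∀ v w, ⟪A s v, w⟫ = ⟪v, A' s w⟫) {γ γ' : TimeL2 T H} {ξ : H}
    {y p : C(Icc (0 : ℝ) T, H)} (hy : WeakForward hT ι hA γ y)
    (hp : WeakBackward hT ι hA' γ' ξ p) :
    ⟪γ, trajL2 hT p⟫ = ⟪IccExtend hT y T, ξ⟫ + ⟪trajL2 hT y, γ'⟫ := by
  obtain ⟨v, hv1, hv2⟩ := hy
  obtain ⟨w, hw1, hw2⟩ := hp
  have e1 : (isOpFamily_const ι).lift T v = trajL2 hT y := by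
    refine Lp.ext ?_
    filter_upwards [(isOpFamily_const ι).coeFn_lift v, coeFn_trajL2 hT y, hv1] with t h1 h2 h3
    rw [h1, h2, h3]
  have e2 : (isOpFamily_const ι).lift T w = trajL2 hT p := by
    refine Lp.ext ?_
    filter_upwards [(isOpFamily_const ι).coeFn_lift w, coeFn_trajL2 hT p, hw1] with t h1 h2 h3
    rw [h1, h2, h3]
  have hv : gramOp T ι v =
      volterra T V ((isOpFamily_const ι.adjoint).lift T γ - hA.lift T v) := by
    refine Lp.ext ?_
    filter_upwards [coeFn_gramOp ι v,
      coeFn_volterra ((isOpFamily_const ι.adjoint).lift T γ - hA.lift T v), hv1,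
      ae_restrict_mem measurableSet_Ioo] with t h1 h2 h3 ht
    rw [h1, h2, h3, hv2 t (Ioo_subset_Icc_self ht)]
  have h := inner_eq_of_forward_backward hT hι hv (hv2 T ⟨hT, le_rfl⟩) (w := w) (ξ := ξ)
    (G := (isOpFamily_const ι.adjoint).lift T γ' - hA'.lift T w) (by
      filter_upwards [hw1, ae_restrict_mem measurableSet_Ioo] with t h3 ht
      rw [h3, hw2 t (Ioo_subset_Icc_self ht)])
  rw [inner_sub_left, inner_sub_right, inner_lift_left hA hA' hAA', ← inner_lift_const_left, e1,
    real_inner_comm, ← inner_lift_const_left, e2, real_inner_comm] at h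
  linarith

theorem WeakForward.smul {hT : 0 ≤ T} {ι : V →L[ℝ] H} {A : ℝ → V →L[ℝ] V} {hA : IsOpFamily A}
    {γ : TimeL2 T H} {y : C(Icc (0 : ℝ) T, H)} (h : WeakForward hT ι hA γ y) (c : ℝ) :
    WeakForward hT ι hA (c • γ) (c • y) := by
  obtain ⟨v, hv1, hv2⟩ := h
  have e : ∀ t, IccExtend hT (c • y) t = c • IccExtend hT y t := fun t => rfl
  refine ⟨c • v, ?_, fun t ht => ?_⟩
  · filter_upwards [hv1, Lp.coeFn_smul c v] with t h1 h2
    rw [h2, Pi.smul_apply, map_smul, h1, e]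
  · rw [e, map_smul, hv2 t ht, map_smul, map_smul, ← smul_sub, map_smul]

theorem exists_weakForward (hT : 0 ≤ T) {ι : V →L[ℝ] H} (hι : ∀ x, ι.adjoint x = 0 → x = 0)
    {A : ℝ → V →L[ℝ] V} (hA : IsOpFamily A) {c C : ℝ} (hc : 0 < c)
    (hG : ∀ s ∈ Ioo 0 T, ∀ v, c * ‖v‖ ^ 2 ≤ ⟪A s v, v⟫ + C * ‖ι v‖ ^ 2) (γ : TimeL2 T H) :
    ∃ y, WeakForward hT ι hA γ y := by
  obtain ⟨v, F, h1, h2⟩ := exists_gramOp_solution hT ι hA hc hG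
    ((isOpFamily_const ι.adjoint).lift T γ)
  obtain ⟨y, hy1, hy2⟩ := exists_continuous_of_gramOp hT hι h1
  refine ⟨y, v, hy2, fun t ht => ?_⟩
  rw [← h2, add_sub_cancel_right, IccExtend_of_mem hT y ht, hy1]

theorem measurePreserving_reflect (T : ℝ) :
    MeasurePreserving (fun s : ℝ => T - s) (timeMeasure T) (timeMeasure T) := by
  have h := (Measure.measurePreserving_sub_left (volume : Measure ℝ) T).restrict_preimage
    (s := Ioo 0 T) measurableSet_Ioo
  have e : (fun s : ℝ => T - s) ⁻¹' Ioo 0 T = Ioo 0 T := by simp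
  rwa [e] at h

/-- The reflection `t ↦ T - t` preserves the measure on `(0,T)` and Gårding's inequality, and turns
the problem into a forward one. -/
theorem exists_weakBackward (hT : 0 ≤ T) {ι : V →L[ℝ] H} (hι : ∀ x, ι.adjoint x = 0 → x = 0)
    {A : ℝ → V →L[ℝ] V} (hA : IsOpFamily A) {c C : ℝ} (hc : 0 < c)
    (hG : ∀ s ∈ Ioo 0 T, ∀ v, c * ‖v‖ ^ 2 ≤ ⟪A s v, v⟫ + C * ‖ι v‖ ^ 2) (γ : TimeL2 T H) :
    ∃ p, WeakBackward hT ι hA γ 0 p := by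
  have hmp := measurePreserving_reflect T
  have hAr : IsOpFamily fun s => A (T - s) :=
    ⟨fun v => (hA.meas v).comp_measurable (by fun_prop),
      ⟨hA.bdd.choose, fun s => hA.bdd.choose_spec _⟩⟩
  let γr : TimeL2 T H := ((Lp.memLp γ).comp_measurePreserving hmp).toLp _
  have hγr : (γr : ℝ → H) =ᵐ[timeMeasure T] fun s => γ (T - s) := MemLp.coeFn_toLp _
  obtain ⟨y, v, hv1, hv2⟩ := exists_weakForward hT hι hAr hc
    (fun s hs v => hG (T - s) ⟨by linarith [hs.2], by linarith [hs.1]⟩ v) γr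
  let w : TimeL2 T V := ((Lp.memLp v).comp_measurePreserving hmp).toLp _
  have hw : (w : ℝ → V) =ᵐ[timeMeasure T] fun s => v (T - s) := MemLp.coeFn_toLp _
  let p : C(Icc (0 : ℝ) T, H) :=
    ⟨fun t => IccExtend hT y (T - t), (continuous_IccExtend hT y).comp (by fun_prop)⟩
  have hp : ∀ t ∈ Icc 0 T, IccExtend hT p t = IccExtend hT y (T - t) := fun t ht => by
    rw [IccExtend_of_mem hT p ht]; rfl
  refine ⟨p, w, ?_, fun t ht => ?_⟩
  · filter_upwards [hw, hmp.quasiMeasurePreserving.ae hv1, ae_restrict_mem measurableSet_Ioo]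
      with t h1 h2 ht
    rw [h1, h2, hp t (Ioo_subset_Icc_self ht)]
  · have htT : T - t ∈ Icc 0 T := ⟨by linarith [ht.2], by linarith [ht.1]⟩
    set G := (isOpFamily_const ι.adjoint).lift T γ - hA.lift T w with hG
    have e1 : (G : ℝ → V) =ᵐ[timeMeasure T]
        fun s => ι.adjoint (γ s) - A s (v (T - s)) := by
      filter_upwards [(isOpFamily_const ι.adjoint).coeFn_lift γ, hA.coeFn_lift w, hw,
        Lp.coeFn_sub ((isOpFamily_const ι.adjoint).lift T γ) (hA.lift T w)] with s h1 h2 h3 h4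
      rw [hG, h4, Pi.sub_apply, h1, h2, h3]
    have e2 : (((isOpFamily_const ι.adjoint).lift T γr - hAr.lift T v : TimeL2 T V) : ℝ → V)
        =ᵐ[timeMeasure T] fun s => (fun r => (G : ℝ → V) r) (T - s) := by
      filter_upwards [(isOpFamily_const ι.adjoint).coeFn_lift γr, hAr.coeFn_lift v, hγr,
        Lp.coeFn_sub ((isOpFamily_const ι.adjoint).lift T γr) (hAr.lift T v),
        hmp.quasiMeasurePreserving.ae e1] with s h1 h2 h3 h4 h5
      rw [h4, Pi.sub_apply, h1, h2, h3, h5, sub_sub_cancel]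
    have hi : ∀ a ∈ Icc 0 T, ∀ b ∈ Icc 0 T, IntervalIntegrable G volume a b := by
      intro a ha b hb
      have : IntervalIntegrable G volume 0 T := by
        rw [intervalIntegrable_iff_integrableOn_Ioo_of_le hT]
        exact timeL2_integrable G
      refine this.mono_set ?_
      rw [uIcc_of_le hT]
      exact uIcc_subset_Icc ha hb
    rw [hp t ht, hv2 _ htT, primAt_eq_of_ae _ e2 htT, intervalIntegral.integral_comp_sub_left
      (fun r => (G : ℝ → V) r) T, map_zero, zero_add, primAt_eq G ⟨hT, le_rfl⟩, primAt_eq G ht,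
      intervalIntegral.integral_interval_sub_left (hi 0 ⟨le_rfl, hT⟩ T ⟨hT, le_rfl⟩)
        (hi 0 ⟨le_rfl, hT⟩ t ht)]
    simp

end WeakSolutions

/-! ### The minimal norm problem and its variational inequality. -/

section MinimalNorm

variable {U H : Type*} [NormedAddCommGroup U] [InnerProductSpace ℝ U] [CompleteSpace U]
  [NormedAddCommGroup H] [InnerProductSpace ℝ H] {Y : U → H} {R : H → U} {ℓ : H → ℝ}

theorem norm_le_of_inner_add_nonneg {e : H} {α : ℝ} (hα : 0 ≤ α)
    (h : ∀ η : H, 0 ≤ ⟪e, η⟫ + α * ‖η‖) : ‖e‖ ≤ α := by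
  have h1 := h (-e)
  rw [inner_neg_right, real_inner_self_eq_norm_sq, norm_neg] at h1
  rcases (norm_nonneg e).eq_or_lt with h0 | h0
  · rwa [← h0]
  · nlinarith

/-- Testing with `ξ + η` gives the norm bound, and testing with `0` and `2 ξ` gives the equality:
complementary slackness for the ball constraint. -/
theorem varIneq_consequences {e ξ : H} {α : ℝ} (hα : 0 ≤ α)
    (h : ∀ ξ' : H, 0 ≤ ⟪e, ξ' - ξ⟫ + α * (‖ξ'‖ - ‖ξ‖)) :
    ‖e‖ ≤ α ∧ ⟪e, ξ⟫ = -(α * ‖ξ‖) := by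
  constructor
  · refine norm_le_of_inner_add_nonneg hα fun η => ?_
    have h1 := h (ξ + η)
    rw [add_sub_cancel_left] at h1
    have h2 := norm_add_le ξ η
    nlinarith
  · have h1 := h 0
    have h2 := h ((2 : ℝ) • ξ)
    have e2 : (2 : ℝ) • ξ - ξ = ξ := by rw [two_smul, add_sub_cancel_right]
    rw [e2, norm_smul, Real.norm_eq_abs, abs_of_pos (by norm_num : (0 : ℝ) < 2)] at h2
    rw [zero_sub, inner_neg_right, norm_zero] at h1
    linarith

/-- The variational inequality is sufficient for optimality. -/
theorem norm_sq_add_le_of_varIneq (hYR : ∀ u ξ, ⟪Y u, ξ⟫ = ⟪u, R ξ⟫ - ℓ ξ) {η ξ : H} {α : ℝ}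
    (hα : 0 ≤ α) (h : ∀ ξ' : H, 0 ≤ ⟪Y (R ξ) - η, ξ' - ξ⟫ + α * (‖ξ'‖ - ‖ξ‖)) {v : U}
    (hv : ‖Y v - η‖ ≤ α) : ‖R ξ‖ ^ 2 + ‖v - R ξ‖ ^ 2 ≤ ‖v‖ ^ 2 := by
  obtain ⟨-, h2⟩ := varIneq_consequences hα h
  have h3 : -(α * ‖ξ‖) ≤ ⟪Y v - η, ξ⟫ := by
    have := neg_le_of_abs_le (abs_real_inner_le_norm (Y v - η) ξ)
    nlinarith [norm_nonneg ξ]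
  rw [inner_sub_left, hYR] at h2 h3
  -- By the pairing, `⟪v - R ξ, R ξ⟫ = ⟪Y v - Y (R ξ), ξ⟫`. The first term is at least `-α ‖ξ‖`
  -- relative to `η`, and the second equals it.
  have h4 : 0 ≤ ⟪v - R ξ, R ξ⟫ := by
    rw [inner_sub_left]; linarith
  have h5 : v = (v - R ξ) + R ξ := by abel
  have h6 := norm_add_sq_real (v - R ξ) (R ξ)
  rw [← h5] at h6
  linarith

/-- If `R ξ = 0`, then `⟪·, ξ⟫` is constant on a dense set, hence everywhere; compare its values at
`0` and `ξ`. -/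
theorem eq_zero_of_dense (hYR : ∀ u ξ, ⟪Y u, ξ⟫ = ⟪u, R ξ⟫ - ℓ ξ) (hd : Dense (range Y)) {ξ : H}
    (h : R ξ = 0) : ξ = 0 := by
  have h1 : (fun x : H => ⟪x, ξ⟫) = fun _ => -ℓ ξ := by
    refine Continuous.ext_on hd (by fun_prop) (by fun_prop) ?_
    rintro _ ⟨u, rfl⟩
    simp [hYR, h]
  have h2 := congrFun h1 0
  have h3 := congrFun h1 ξ
  simp only [inner_zero_left] at h2 h3
  rw [← h2] at h3
  exact inner_self_eq_zero.1 h3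

/-- The pairing gives `⟪u, R ξ⟫ = ⟪Y u - Y 0, ξ⟫`, which is linear in `ξ`. -/
theorem map_sub_of_pairing (hYR : ∀ u ξ, ⟪Y u, ξ⟫ = ⟪u, R ξ⟫ - ℓ ξ) (ξ ζ : H) :
    R (ξ - ζ) = R ξ - R ζ := by
  refine ext_inner_left ℝ fun u => ?_
  have h : ∀ ξ, ⟪u, R ξ⟫ = ⟪Y u, ξ⟫ - ⟪Y 0, ξ⟫ := fun ξ => by rw [hYR, hYR, inner_zero_left]; ring
  rw [inner_sub_right, h, h, h, inner_sub_right, inner_sub_right]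
  ring

/-- Test each inequality with the other solution and add. The terms in `α`, `η` and `ℓ` cancel,
leaving `‖R (ξ - ζ)‖² ≤ 0`. -/
theorem varIneq_unique (hYR : ∀ u ξ, ⟪Y u, ξ⟫ = ⟪u, R ξ⟫ - ℓ ξ) (hd : Dense (range Y))
    {η ξ ζ : H} {α : ℝ} (hξ : ∀ ξ' : H, 0 ≤ ⟪Y (R ξ) - η, ξ' - ξ⟫ + α * (‖ξ'‖ - ‖ξ‖))
    (hζ : ∀ ξ' : H, 0 ≤ ⟪Y (R ζ) - η, ξ' - ζ⟫ + α * (‖ξ'‖ - ‖ζ‖)) : ξ = ζ := by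
  rw [← sub_eq_zero]
  refine eq_zero_of_dense hYR hd ?_
  have h1 := hξ ζ
  have h2 := hζ ξ
  have h3 : ⟪Y (R ξ), ξ - ζ⟫ - ⟪Y (R ζ), ξ - ζ⟫ ≤ 0 := by
    rw [← neg_sub ξ ζ, inner_neg_right] at h1
    simp only [inner_sub_left (Y _) η] at h1 h2
    linarith
  rw [hYR, hYR, sub_sub_sub_cancel_right, ← inner_sub_left, map_sub_of_pairing hYR,
    real_inner_self_eq_norm_sq] at h3
  rw [map_sub_of_pairing hYR]
  have : ‖R ξ - R ζ‖ ^ 2 = 0 := le_antisymm h3 (sq_nonneg _)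
  simpa using this

/-- The solution of the minimal norm problem has a multiplier, which solves the variational
inequality. -/
theorem exists_varIneq (hYR : ∀ u ξ, ⟪Y u, ξ⟫ = ⟪u, R ξ⟫ - ℓ ξ) (hd : Dense (range Y)) (η : H)
    {α : ℝ} (hα : 0 < α) :
    ∃ ξ : H, ∀ ξ' : H, 0 ≤ ⟪Y (R ξ) - η, ξ' - ξ⟫ + α * (‖ξ'‖ - ‖ξ‖) := by
  have hR0 : R 0 = 0 := by simpa using map_sub_of_pairing hYR 0 0
  have hRsmul : ∀ (c : ℝ) ξ, R (c • ξ) = c • R ξ := fun c ξ => by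
    refine ext_inner_left ℝ fun u => ?_
    have h : ∀ ξ, ⟪u, R ξ⟫ = ⟪Y u, ξ⟫ - ⟪Y 0, ξ⟫ := fun ξ => by
      rw [hYR, hYR, inner_zero_left]; ring
    rw [inner_smul_right, h, h, inner_smul_right, inner_smul_right]
    ring
  let C : Set U := {u | ‖Y u - η‖ ≤ α}
  -- By the pairing the admissible set is an intersection of closed half-spaces, so it is closed and
  -- convex although continuity of `Y` is not assumed.
  have hC : C = ⋂ ξ : H, {u | -(α * ‖ξ‖) ≤ ⟪u, R ξ⟫ - ℓ ξ - ⟪η, ξ⟫} := by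
    ext u
    simp only [C, mem_ofPred_eq, mem_iInter, ← hYR, ← inner_sub_left]
    constructor
    · intro h ξ
      have := neg_le_of_abs_le (abs_real_inner_le_norm (Y u - η) ξ)
      nlinarith [norm_nonneg ξ]
    · intro h
      exact norm_le_of_inner_add_nonneg hα.le fun ξ => by linarith [h ξ]
  have hclosed : IsClosed C := by
    rw [hC]
    exact isClosed_iInter fun ξ => isClosed_le continuous_const (by fun_prop)
  have hconv : Convex ℝ C := by
    rw [hC]
    refine convex_iInter fun ξ => ?_
    intro u hu v hv a b ha hb hab
    simp only [mem_ofPred_eq] at hu hv ⊢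
    rw [inner_add_left, real_inner_smul_left, real_inner_smul_left]
    have h1 := mul_le_mul_of_nonneg_left hu ha
    have h2 := mul_le_mul_of_nonneg_left hv hb
    have hb' : b = 1 - a := by linarith
    subst hb'
    linarith
  have hne : C.Nonempty := by
    obtain ⟨_, ⟨u, rfl⟩, hu⟩ :=
      hd.exists_mem_open Metric.isOpen_ball ⟨η, Metric.mem_ball_self hα⟩
    refine ⟨u, ?_⟩
    have := (Metric.mem_ball.1 hu).le
    rwa [dist_eq_norm] at this
  obtain ⟨w, hwC, hw⟩ := exists_norm_eq_iInf_of_complete_convex hne hclosed.isComplete hconv 0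
  have hproj := (norm_eq_iInf_iff_real_inner_le_zero hconv hwC).1 hw
  set e := Y w - η with he
  have heα : ‖e‖ ≤ α := hwC
  have hmove : ∀ (t : ℝ) z, Y (w + t • z) - η = e + t • (Y z - Y 0) := by
    intro t z
    refine ext_inner_right ℝ fun ξ => ?_
    simp only [he, inner_sub_left, inner_add_left, real_inner_smul_left, hYR, inner_zero_left]
    ring
  have hmin : ∀ (t : ℝ) z, 0 < t → ‖e + t • (Y z - Y 0)‖ ≤ α → 0 ≤ ⟪w, z⟫ := by
    intro t z ht h
    have h1 := hproj (w + t • z) (by simpa only [C, mem_ofPred_eq, hmove] using h)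
    rw [zero_sub, add_sub_cancel_left, inner_neg_left, real_inner_smul_right] at h1
    nlinarith
  by_cases hw0 : w = 0
  · refine ⟨0, fun ξ' => ?_⟩
    rw [hR0, ← hw0, ← he, sub_zero, norm_zero, sub_zero]
    have := neg_le_of_abs_le (abs_real_inner_le_norm e ξ')
    nlinarith [norm_nonneg ξ']
  -- With slack in the constraint, a small step along `-w` would remain admissible and reduce the
  -- norm.
  have hact : ‖e‖ = α := by
    by_contra hlt
    have hlt : ‖e‖ < α := lt_of_le_of_ne heα hlt
    have h1 := hmin ((α - ‖e‖) / (‖Y (-w) - Y 0‖ + 1)) (-w)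
      (div_pos (sub_pos.2 hlt) (by positivity)) (by
        refine (norm_add_le _ _).trans ?_
        rw [norm_smul, Real.norm_eq_abs, abs_of_pos (div_pos (sub_pos.2 hlt) (by positivity))]
        have : (α - ‖e‖) / (‖Y (-w) - Y 0‖ + 1) * ‖Y (-w) - Y 0‖ ≤ α - ‖e‖ := by
          rw [div_mul_eq_mul_div, div_le_iff₀ (by positivity)]
          nlinarith [norm_nonneg (Y (-w) - Y 0)]
        linarith)
    rw [inner_neg_right, real_inner_self_eq_norm_sq] at h1
    have : 0 < ‖w‖ := norm_pos_iff.2 hw0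
    nlinarith
  have he0 : e ≠ 0 := fun h => by rw [h, norm_zero] at hact; exact hα.ne hact
  set r := R e with hr
  have hr0 : r ≠ 0 := fun h => he0 (eq_zero_of_dense hYR hd h)
  have hr0' : 0 < ‖r‖ ^ 2 := by have := norm_pos_iff.2 hr0; positivity
  -- Here `⟪z, r⟫ = ⟪e, Y z - Y 0⟫` is the rate at which half the squared distance to the target
  -- centre changes along `z`; a negative rate makes a short step admissible. The step length makes
  -- `2 t ⟪z, r⟫ + t² ‖k‖²` nonpositive.
  have hhalf : ∀ z, ⟪z, r⟫ < 0 → 0 ≤ ⟪w, z⟫ := by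
    intro z hz
    have hk : ⟪e, Y z - Y 0⟫ = ⟪z, r⟫ := by
      rw [real_inner_comm, inner_sub_left, hYR, hYR, inner_zero_left]; ring
    set k := Y z - Y 0 with hkdef
    have hD : 0 < ‖k‖ ^ 2 + 1 := by positivity
    have ht : 0 < -⟪z, r⟫ / (‖k‖ ^ 2 + 1) := div_pos (neg_pos.2 hz) hD
    refine hmin _ z ht ?_
    set t := -⟪z, r⟫ / (‖k‖ ^ 2 + 1) with htdef
    have ht2 : t * (‖k‖ ^ 2 + 1) = -⟪z, r⟫ := div_mul_cancel₀ _ hD.ne'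
    refine le_of_sq_le_sq ?_ hα.le
    rw [norm_add_sq_real, real_inner_smul_right, hk, norm_smul, mul_pow, Real.norm_eq_abs, sq_abs,
      hact]
    nlinarith
  have hhalf' : ∀ z, ⟪z, r⟫ ≤ 0 → 0 ≤ ⟪w, z⟫ := by
    intro z hz
    have h1 : ∀ ε : ℝ, 0 < ε → 0 ≤ ⟪w, z⟫ - ε * ⟪w, r⟫ := by
      intro ε hε
      have := hhalf (z - ε • r) (by
        rw [inner_sub_left, real_inner_smul_left, real_inner_self_eq_norm_sq]
        nlinarith)
      rwa [inner_sub_right, real_inner_smul_right] at this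
    have hlim : Filter.Tendsto (fun ε : ℝ => ⟪w, z⟫ - ε * ⟪w, r⟫) (nhdsWithin 0 (Ioi 0))
        (nhds (⟪w, z⟫ - 0 * ⟪w, r⟫)) :=
      (Continuous.tendsto (by fun_prop) 0).mono_left nhdsWithin_le_nhds
    rw [zero_mul, sub_zero] at hlim
    refine ge_of_tendsto hlim ?_
    filter_upwards [self_mem_nhdsWithin] with ε hε using h1 ε hε
  obtain ⟨c, hc⟩ : ∃ c, c = ⟪w, r⟫ / ‖r‖ ^ 2 := ⟨_, rfl⟩
  have hc2 : c * ‖r‖ ^ 2 = ⟪w, r⟫ := by rw [hc, div_mul_cancel₀ _ hr0'.ne']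
  have hzr : ⟪w - c • r, r⟫ = 0 := by
    rw [inner_sub_left, real_inner_smul_left, real_inner_self_eq_norm_sq, hc2, sub_self]
  -- The component of `w` orthogonal to `r` is tested with its own negative, so it vanishes.
  have hwr : w = c • r := by
    have h1 := hhalf' (-(w - c • r)) (by rw [inner_neg_left, hzr, neg_zero])
    have h2 : ⟪w, w - c • r⟫ = ‖w - c • r‖ ^ 2 := by
      rw [← real_inner_self_eq_norm_sq]
      conv_rhs => rw [inner_sub_left, real_inner_smul_left, real_inner_comm _ r, hzr]
      ring
    rw [inner_neg_right, h2] at h1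
    have : ‖w - c • r‖ ^ 2 = 0 := le_antisymm (by linarith) (sq_nonneg _)
    exact sub_eq_zero.1 (by simpa using this)
  have hc0 : c ≤ 0 := by
    have h1 := hhalf' (-r) (by
      rw [inner_neg_left, real_inner_self_eq_norm_sq]; linarith)
    rw [inner_neg_right, ← hc2] at h1
    by_contra h
    have := mul_pos (not_le.1 h) hr0'
    linarith
  -- The multiplier is `ξ = c e`, because `R (c e) = c r = w`. As `c ≤ 0` and `‖e‖ = α`, the terms
  -- in `c` cancel and Cauchy–Schwarz remains.
  refine ⟨c • e, fun ξ' => ?_⟩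
  rw [hRsmul, ← hr, ← hwr, ← he, inner_sub_right, real_inner_smul_right,
    real_inner_self_eq_norm_sq, norm_smul, Real.norm_eq_abs, abs_of_nonpos hc0, hact]
  have := neg_le_of_abs_le (abs_real_inner_le_norm e ξ')
  rw [hact] at this
  nlinarith

end MinimalNorm

/-! ### Measurability through inner products. -/

section WeakMeasurability

variable {X K K' : Type*} [MeasurableSpace X] [NormedAddCommGroup K] [InnerProductSpace ℝ K]
  [SecondCountableTopology K] [NormedAddCommGroup K'] [InnerProductSpace ℝ K']
  [SecondCountableTopology K']

theorem norm_le_iff_forall_denseSeq (r : ℝ) (v : K) (hr : 0 ≤ r) :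
    ‖v‖ ≤ r ↔ ∀ n, ⟪TopologicalSpace.denseSeq K n, v⟫ ≤ r * ‖TopologicalSpace.denseSeq K n‖ := by
  constructor
  · intro h n
    refine (real_inner_le_norm _ _).trans ?_
    rw [mul_comm]
    gcongr
  · intro h
    have h1 : ∀ w : K, ⟪w, v⟫ ≤ r * ‖w‖ := by
      intro w
      have hcl : IsClosed {w : K | ⟪w, v⟫ ≤ r * ‖w‖} := isClosed_le (by fun_prop) (by fun_prop)
      have := closure_minimal (range_subset_iff.2 h) hcl
      rw [(TopologicalSpace.denseRange_denseSeq K).closure_range] at this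
      exact this (mem_univ w)
    have h2 := h1 v
    rw [real_inner_self_eq_norm_sq] at h2
    rcases (norm_nonneg v).eq_or_lt with h0 | h0
    · rwa [← h0]
    · nlinarith

/-- Pettis' theorem in a separable Hilbert space. -/
theorem stronglyMeasurable_of_inner {f : X → K} (h : ∀ w, Measurable fun a => ⟪w, f a⟫) :
    StronglyMeasurable f := by
  borelize K
  refine Measurable.stronglyMeasurable (measurable_of_isOpen fun O hO => ?_)
  let c := TopologicalSpace.denseSeq K
  -- A closed ball is cut out by countably many half-spaces, one for each vector of a dense
  -- sequence, and every open set is a countable union of such balls.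
  have hball : ∀ (v : K) (q : ℝ), 0 ≤ q → MeasurableSet (f ⁻¹' Metric.closedBall v q) := by
    intro v q hq
    have : f ⁻¹' Metric.closedBall v q = ⋂ n, {a | ⟪c n, f a⟫ - ⟪c n, v⟫ ≤ q * ‖c n‖} := by
      ext a
      simp only [mem_preimage, Metric.mem_closedBall, dist_eq_norm, mem_iInter, mem_ofPred_eq,
        ← inner_sub_right]
      exact norm_le_iff_forall_denseSeq q _ hq
    rw [this]
    exact MeasurableSet.iInter fun n => measurableSet_le ((h _).sub_const _) measurable_const
  have hO' : O = ⋃ (n : ℕ) (q : ℚ) (_ : 0 ≤ (q : ℝ) ∧ Metric.closedBall (c n) q ⊆ O),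
      Metric.closedBall (c n) (q : ℝ) := by
    ext x
    simp only [mem_iUnion, exists_prop]
    constructor
    · intro hx
      obtain ⟨ε, hε, hεO⟩ := Metric.isOpen_iff.1 hO x hx
      obtain ⟨q, hq0, hq⟩ := exists_rat_btwn (show (0 : ℝ) < ε / 2 by positivity)
      obtain ⟨n, hn⟩ := (TopologicalSpace.denseRange_denseSeq K).exists_dist_lt x hq0
      refine ⟨n, q, ⟨hq0.le, fun z hz => hεO ?_⟩, hn.le⟩
      have hz' := Metric.mem_closedBall.1 hz
      have := dist_triangle z (c n) x
      rw [dist_comm (c n) x] at this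
      exact Metric.mem_ball.2 (by linarith)
    · rintro ⟨n, q, ⟨-, hO⟩, hx⟩
      exact hO hx
  rw [hO']
  simp only [preimage_iUnion]
  exact MeasurableSet.iUnion fun n => MeasurableSet.iUnion fun q => MeasurableSet.iUnion fun hq =>
    hball _ _ hq.1

theorem IsOpFamily.adjoint [CompleteSpace K] [CompleteSpace K'] {A : X → K →L[ℝ] K'}
    (hA : IsOpFamily A) : IsOpFamily fun s => (A s).adjoint := by
  refine ⟨fun v => stronglyMeasurable_of_inner fun w => ?_, hA.bdd.choose, fun s => ?_⟩
  · simp only [ContinuousLinearMap.adjoint_inner_right]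
    exact ((hA.meas w).inner stronglyMeasurable_const).measurable
  · rw [LinearIsometryEquiv.norm_map]
    exact hA.bdd.choose_spec s

theorem isOpFamily_sum {ι : Type*} [Fintype ι] {c : ι → X → ℝ} (hc : ∀ i, Measurable (c i))
    (hM : ∀ i, ∃ M : ℝ, ∀ s, |c i s| ≤ M) (L : ι → K →L[ℝ] K') :
    IsOpFamily fun s => ∑ i, c i s • L i := by
  choose M hM using hM
  refine ⟨fun v => ?_, ∑ i, M i * ‖L i‖, fun s => ?_⟩
  · simp only [sum_apply, smul_apply]
    exact Finset.stronglyMeasurable_fun_sum _ fun i _ => (hc i).stronglyMeasurable.smul_const _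
  · refine (norm_sum_le _ _).trans (Finset.sum_le_sum fun i _ => ?_)
    rw [norm_smul, Real.norm_eq_abs]
    exact mul_le_mul_of_nonneg_right (hM i s) (norm_nonneg _)

variable {Z : Type*} [MeasurableSpace Z] {μ : Measure Z} [SFinite μ]

theorem IsOpFamily.section_left {Q : X × Z → K →L[ℝ] K'} (hQ : IsOpFamily Q) (s : X) :
    IsOpFamily fun z => Q (s, z) :=
  ⟨fun v => (hQ.meas v).comp_measurable (by fun_prop), hQ.bdd.choose,
    fun z => hQ.bdd.choose_spec _⟩

/-- The inner product is the integral over `Z` of a jointly measurable function, hence measurable in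
the parameter. -/
theorem measurable_inner_pointwise {Q : X × Z → K →L[ℝ] K'} (hQ : IsOpFamily Q)
    (v : Lp K 2 μ) (w : Lp K' 2 μ) :
    Measurable fun s => ⟪w, (hQ.section_left s).pointwise μ v⟫ := by
  have e : ∀ s, ⟪w, (hQ.section_left s).pointwise μ v⟫ = ∫ z, ⟪w z, Q (s, z) (v z)⟫ ∂μ := by
    intro s
    rw [L2.inner_def]
    refine integral_congr_ae ?_
    filter_upwards [(hQ.section_left s).coeFn_pointwise v] with z hz
    rw [hz]
  simp only [e]
  have h1 : StronglyMeasurable fun p : X × Z => Q p (v p.2) :=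
    hQ.stronglyMeasurable_comp ((Lp.stronglyMeasurable v).comp_measurable measurable_snd)
  have h2 : StronglyMeasurable fun p : X × Z => (w p.2 : K') :=
    (Lp.stronglyMeasurable w).comp_measurable measurable_snd
  exact (h2.inner h1).integral_prod_right.measurable

end WeakMeasurability

/-! ### The identification of `L²(X × Z)` with `L²(X; L²(Z))`. -/

section Sections

variable {X Z : Type*} [MeasurableSpace X] [MeasurableSpace Z] {m : Measure X} {μ : Measure Z}
  [IsFiniteMeasure m] [SFinite μ] [SecondCountableTopology (Lp ℝ 2 μ)]

/-- An element of `L²(m ⊗ μ)` is a square integrable function with values in `L²(μ)`. -/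
theorem exists_section (G : Lp ℝ 2 (m.prod μ)) :
    ∃ γ : Lp (Lp ℝ 2 μ) 2 m, ∀ᵐ s ∂m, (γ s : Z → ℝ) =ᵐ[μ] fun z => G (s, z) := by
  have hsm : StronglyMeasurable (G : X × Z → ℝ) := Lp.stronglyMeasurable G
  have hsq : Integrable (fun p => G p ^ 2) (m.prod μ) :=
    (memLp_two_iff_integrable_sq (Lp.aestronglyMeasurable G)).1 (Lp.memLp G)
  have hsec : ∀ s, StronglyMeasurable fun z => G (s, z) := fun s =>
    hsm.comp_measurable (by fun_prop)
  classical
  -- Almost every section is square integrable; the value `0` on the measurable exceptional set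
  -- keeps `γ` measurable.
  let γ : X → Lp ℝ 2 μ := fun s =>
    if h : MemLp (fun z => G (s, z)) 2 μ then h.toLp _ else 0
  have hgood : ∀ᵐ s ∂m, MemLp (fun z => G (s, z)) 2 μ := by
    filter_upwards [hsq.prod_right_ae] with s hs
    exact (memLp_two_iff_integrable_sq (hsec s).aestronglyMeasurable).2 hs
  have hγ : ∀ s, MemLp (fun z => G (s, z)) 2 μ → (γ s : Z → ℝ) =ᵐ[μ] fun z => G (s, z) := by
    intro s hs
    simp only [γ, dif_pos hs]
    exact MemLp.coeFn_toLp hs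
  have hmset : MeasurableSet {s | MemLp (fun z => G (s, z)) 2 μ} := by
    have : {s | MemLp (fun z => G (s, z)) 2 μ} = {s | ∫⁻ z, ‖G (s, z)‖ₑ ^ (2 : ℝ) ∂μ < ⊤} := by
      ext s
      simp only [mem_ofPred_eq, MemLp, (hsec s).aestronglyMeasurable, true_and]
      rw [eLpNorm_lt_top_iff_lintegral_rpow_enorm_lt_top (by norm_num) (by norm_num)]
      simp
    rw [this]
    refine measurableSet_lt ?_ measurable_const
    exact Measurable.lintegral_prod_right' (f := fun p : X × Z => ‖G p‖ₑ ^ (2 : ℝ))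
      (hsm.enorm.pow_const _)
  have hmeas : StronglyMeasurable γ := by
    refine stronglyMeasurable_of_inner fun w => ?_
    have e : (fun s => ⟪w, γ s⟫) =
        indicator {s | MemLp (fun z => G (s, z)) 2 μ} fun s => ∫ z, ⟪w z, G (s, z)⟫ ∂μ := by
      funext s
      by_cases hs : MemLp (fun z => G (s, z)) 2 μ
      · rw [indicator_of_mem (show s ∈ {s | MemLp (fun z => G (s, z)) 2 μ} from hs), L2.inner_def]
        refine integral_congr_ae ?_
        filter_upwards [hγ s hs] with z hz
        rw [hz]
      · rw [indicator_of_notMem (show s ∉ {s | MemLp (fun z => G (s, z)) 2 μ} from hs)]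
        simp only [γ, dif_neg hs, inner_zero_right]
    rw [e]
    refine Measurable.indicator ?_ hmset
    have h2 : StronglyMeasurable fun p : X × Z => (w p.2 : ℝ) :=
      (Lp.stronglyMeasurable w).comp_measurable measurable_snd
    exact (h2.inner hsm).integral_prod_right.measurable
  have hmem : MemLp γ 2 m := by
    rw [memLp_two_iff_integrable_sq_norm hmeas.aestronglyMeasurable]
    refine (hsq.integral_prod_left).congr ?_
    filter_upwards [hgood] with s hs
    rw [← real_inner_self_eq_norm_sq, L2.inner_def]
    refine integral_congr_ae ?_
    filter_upwards [hγ s hs] with z hz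
    rw [hz, real_inner_self_eq_norm_sq, Real.norm_eq_abs, sq_abs]
  refine ⟨hmem.toLp γ, ?_⟩
  filter_upwards [hmem.coeFn_toLp, hgood] with s h1 h2
  rw [h1]
  exact hγ s h2

theorem section_unique {γ γ' : Lp (Lp ℝ 2 μ) 2 m} {G : X × Z → ℝ}
    (h : ∀ᵐ s ∂m, (γ s : Z → ℝ) =ᵐ[μ] fun z => G (s, z))
    (h' : ∀ᵐ s ∂m, (γ' s : Z → ℝ) =ᵐ[μ] fun z => G (s, z)) : γ = γ' := by
  refine Lp.ext ?_
  filter_upwards [h, h'] with s h1 h2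
  exact Lp.ext (h1.trans h2.symm)

theorem inner_section {γ γ' : Lp (Lp ℝ 2 μ) 2 m} {G G' : X × Z → ℝ}
    (h : ∀ᵐ s ∂m, (γ s : Z → ℝ) =ᵐ[μ] fun z => G (s, z))
    (h' : ∀ᵐ s ∂m, (γ' s : Z → ℝ) =ᵐ[μ] fun z => G' (s, z))
    (hi : Integrable (fun p => G p * G' p) (m.prod μ)) :
    ⟪γ, γ'⟫ = ∫ p, G p * G' p ∂m.prod μ := by
  rw [integral_prod _ hi, L2.inner_def]
  refine integral_congr_ae ?_
  filter_upwards [h, h'] with s h1 h2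
  rw [L2.inner_def]
  refine integral_congr_ae ?_
  filter_upwards [h1, h2] with z e1 e2
  rw [e1, e2, mul_comm]
  rfl

theorem integrable_mul_coeFn (G G' : Lp ℝ 2 (m.prod μ)) :
    Integrable (fun p => G p * G' p) (m.prod μ) :=
  (Lp.memLp G).integrable_mul (Lp.memLp G')

/-- The isometry `L²(m ⊗ μ) → L²(m; L²(μ))`. -/
def sectionIso (m : Measure X) (μ : Measure Z) [IsFiniteMeasure m] [SFinite μ]
    [SecondCountableTopology (Lp ℝ 2 μ)] : Lp ℝ 2 (m.prod μ) →ₗᵢ[ℝ] Lp (Lp ℝ 2 μ) 2 m where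
  toFun G := (exists_section G).choose
  map_add' G G' := by
    refine section_unique (exists_section (G + G')).choose_spec ?_
    filter_upwards [(exists_section G).choose_spec, (exists_section G').choose_spec,
      Measure.ae_ae_of_ae_prod (Lp.coeFn_add G G'),
      Lp.coeFn_add (exists_section G).choose (exists_section G').choose] with s h1 h2 h3 h4
    rw [h4, Pi.add_apply]
    filter_upwards [h1, h2, h3, Lp.coeFn_add ((exists_section G).choose s)
      ((exists_section G').choose s)] with z e1 e2 e3 e4
    rw [e4, Pi.add_apply, e1, e2, e3, Pi.add_apply]
  map_smul' c G := by
    refine section_unique (exists_section (c • G)).choose_spec ?_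
    filter_upwards [(exists_section G).choose_spec,
      Measure.ae_ae_of_ae_prod (Lp.coeFn_smul c G),
      Lp.coeFn_smul c (exists_section G).choose] with s h1 h3 h4
    rw [RingHom.id_apply, h4, Pi.smul_apply]
    filter_upwards [h1, h3, Lp.coeFn_smul c ((exists_section G).choose s)] with z e1 e3 e4
    rw [e4, Pi.smul_apply, e1, e3, Pi.smul_apply]
  norm_map' G := by
    simp only [LinearMap.coe_mk, AddHom.coe_mk]
    refine (sq_eq_sq₀ (norm_nonneg _) (norm_nonneg _)).1 ?_
    rw [← real_inner_self_eq_norm_sq, ← real_inner_self_eq_norm_sq,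
      inner_section (exists_section G).choose_spec (exists_section G).choose_spec
        (integrable_mul_coeFn G G), L2.inner_def]
    rfl

theorem coeFn_sectionIso (G : Lp ℝ 2 (m.prod μ)) :
    ∀ᵐ s ∂m, (sectionIso m μ G s : Z → ℝ) =ᵐ[μ] fun z => G (s, z) :=
  (exists_section G).choose_spec

/-- The range of an isometry of complete spaces is closed. It contains `1_s ⊗ c` for measurable `s`
of finite measure, and these functions generate. -/
theorem sectionIso_surjective : Function.Surjective (sectionIso m μ) := by
  intro γ
  have hcl : IsClosed (range (sectionIso m μ)) :=
    (sectionIso m μ).isometry.isClosedEmbedding.isClosed_range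
  refine Lp.induction (by norm_num) (motive := fun γ => γ ∈ range (sectionIso m μ)) ?_ ?_ hcl γ
  · intro c s hs hms
    have h1 : MemLp (fun p : X × Z => s.indicator (fun _ => (1 : ℝ)) p.1 * c p.2) 2 (m.prod μ) := by
      have hm1 : StronglyMeasurable fun p : X × Z =>
          s.indicator (fun _ => (1 : ℝ)) p.1 * c p.2 :=
        ((stronglyMeasurable_const.indicator hs).comp_measurable measurable_fst).mul
          ((Lp.stronglyMeasurable c).comp_measurable measurable_snd)
      rw [memLp_two_iff_integrable_sq hm1.aestronglyMeasurable]
      simp only [mul_pow]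
      refine Integrable.mul_prod (f := fun x => s.indicator (fun _ => (1 : ℝ)) x ^ 2)
        (g := fun z => (c z : ℝ) ^ 2) ?_ ?_
      · refine Integrable.of_bound
          (((stronglyMeasurable_const.indicator hs).pow 2).aestronglyMeasurable) 1
          (.of_forall fun x => ?_)
        by_cases hx : x ∈ s <;> simp [hx]
      · exact (memLp_two_iff_integrable_sq (Lp.aestronglyMeasurable c)).1 (Lp.memLp c)
    refine ⟨h1.toLp _, ?_⟩
    refine section_unique (coeFn_sectionIso _) ?_
    filter_upwards [Measure.ae_ae_of_ae_prod h1.coeFn_toLp,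
      indicatorConstLp_coeFn (p := 2) (hs := hs) (hμs := hms.ne) (c := c)] with x hx hx2
    rw [Lp.simpleFunc.coe_indicatorConst, hx2]
    filter_upwards [hx, Lp.coeFn_zero ℝ 2 μ] with z hz hz0
    rw [hz]
    by_cases hxs : x ∈ s
    · simp [hxs]
    · simp only [hxs, not_false_eq_true, indicator_of_notMem, zero_mul]
      exact hz0
  · rintro f g hf hg - ⟨F, hF⟩ ⟨G, hG⟩
    exact ⟨F + G, by rw [map_add, hF, hG]⟩

end Sections

/-! ### `H¹₀(Ω)` as a separable Hilbert space. -/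

section SobolevSpace

variable {d : ℕ}

theorem continuous_gradient {ψ : E d → ℝ} (h : ContDiff ℝ ∞ ψ) : Continuous (gradient ψ) :=
  (InnerProductSpace.toDual ℝ (E d)).symm.continuous.comp
    (h.continuous_fderiv (by simp))

theorem hasCompactSupport_gradient {ψ : E d → ℝ} (h : HasCompactSupport ψ) :
    HasCompactSupport (gradient ψ) :=
  (h.fderiv ℝ).comp_left (g := (InnerProductSpace.toDual ℝ (E d)).symm) (map_zero _)

theorem gradient_add_of_contDiff {ψ ψ' : E d → ℝ} (h : ContDiff ℝ ∞ ψ) (h' : ContDiff ℝ ∞ ψ') :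
    gradient (ψ + ψ') = gradient ψ + gradient ψ' := by
  funext x
  simp only [gradient, Pi.add_apply]
  rw [fderiv_add (h.differentiable (by simp) x) (h'.differentiable (by simp) x), map_add]

theorem gradient_smul_of_contDiff {ψ : E d → ℝ} (h : ContDiff ℝ ∞ ψ) (c : ℝ) :
    gradient (c • ψ) = c • gradient ψ := by
  funext x
  simp only [gradient, Pi.smul_apply]
  rw [fderiv_const_smul (h.differentiable (by simp) x), map_smul]

/-- Test functions together with their gradients. -/
def testPairs (Ω : Set (E d)) : Submodule ℝ (L2 Ω × L2Vec Ω) where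
  carrier := {w | ∃ ψ : E d → ℝ, ContDiff ℝ ∞ ψ ∧ HasCompactSupport ψ ∧ tsupport ψ ⊆ Ω ∧
    (w.1 : E d → ℝ) =ᵐ[volume.restrict Ω] ψ ∧
    (w.2 : E d → E d) =ᵐ[volume.restrict Ω] gradient ψ}
  add_mem' := by
    rintro v w ⟨ψ, h1, h2, h3, h4, h5⟩ ⟨ψ', h1', h2', h3', h4', h5'⟩
    refine ⟨ψ + ψ', h1.add h1', h2.add h2', (tsupport_add ψ ψ').trans (union_subset h3 h3'), ?_, ?_⟩
    · exact (Lp.coeFn_add v.1 w.1).trans (h4.add h4')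
    · rw [gradient_add_of_contDiff h1 h1']
      exact (Lp.coeFn_add v.2 w.2).trans (h5.add h5')
  zero_mem' := by
    refine ⟨0, contDiff_const, HasCompactSupport.zero, by simp [tsupport], Lp.coeFn_zero _ _ _, ?_⟩
    have : gradient (0 : E d → ℝ) = 0 := by
      funext x
      simp [gradient]
    rw [this]
    exact Lp.coeFn_zero _ _ _
  smul_mem' := by
    rintro c w ⟨ψ, h1, h2, h3, h4, h5⟩
    refine ⟨c • ψ, h1.const_smul c, h2.smul_left (f := fun _ => c), ?_, ?_, ?_⟩
    · exact (closure_mono (Function.support_const_smul_subset c ψ)).trans h3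
    · exact (Lp.coeFn_smul c w.1).trans (h4.const_smul c)
    · rw [gradient_smul_of_contDiff h1]
      exact (Lp.coeFn_smul c w.2).trans (h5.const_smul c)

theorem coe_topologicalClosure_testPairs (Ω : Set (E d)) :
    ((testPairs Ω).topologicalClosure : Set (L2 Ω × L2Vec Ω)) = H10 Ω :=
  Submodule.topologicalClosure_coe _

/-- `H¹₀(Ω)` as a closed subspace of the Hilbert sum of `L²(Ω)` and `L²(Ω; ℝ^d)`. -/
def sobolev (Ω : Set (E d)) : Submodule ℝ (WithLp 2 (L2 Ω × L2Vec Ω)) :=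
  (testPairs Ω).topologicalClosure.comap
    (WithLp.prodContinuousLinearEquiv 2 ℝ (L2 Ω) (L2Vec Ω) :
      WithLp 2 (L2 Ω × L2Vec Ω) →ₗ[ℝ] L2 Ω × L2Vec Ω)

theorem mem_sobolev {Ω : Set (E d)} {w : WithLp 2 (L2 Ω × L2Vec Ω)} :
    w ∈ sobolev Ω ↔ (w.fst, w.snd) ∈ H10 Ω := by
  rw [← coe_topologicalClosure_testPairs]; rfl

theorem isClosed_sobolev (Ω : Set (E d)) : IsClosed (sobolev Ω : Set (WithLp 2 (L2 Ω × L2Vec Ω))) :=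
  (testPairs Ω).isClosed_topologicalClosure.preimage
    (WithLp.prodContinuousLinearEquiv 2 ℝ (L2 Ω) (L2Vec Ω)).continuous

instance (Ω : Set (E d)) : CompleteSpace (sobolev Ω) := (isClosed_sobolev Ω).completeSpace_coe

instance (Ω : Set (E d)) : SecondCountableTopology (L2 Ω) :=
  haveI : Fact ((2 : ENNReal) ≠ ⊤) := ⟨by norm_num⟩
  Lp.SecondCountableTopology

instance (Ω : Set (E d)) : SecondCountableTopology (L2Vec Ω) :=
  haveI : Fact ((2 : ENNReal) ≠ ⊤) := ⟨by norm_num⟩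
  Lp.SecondCountableTopology

instance (Ω : Set (E d)) : SecondCountableTopology (WithLp 2 (L2 Ω × L2Vec Ω)) :=
  WithLp.secondCountableTopology 2 (L2 Ω) (L2Vec Ω)

instance (Ω : Set (E d)) : SecondCountableTopology (sobolev Ω) :=
  TopologicalSpace.Subtype.secondCountableTopology _

/-- The embedding `H¹₀(Ω) → L²(Ω)`. -/
def sobolevEmb (Ω : Set (E d)) : sobolev Ω →L[ℝ] L2 Ω :=
  (WithLp.fstL 2 ℝ (L2 Ω) (L2Vec Ω)) ∘L (sobolev Ω).subtypeL

/-- The gradient `H¹₀(Ω) → L²(Ω; ℝ^d)`. -/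
def sobolevGrad (Ω : Set (E d)) : sobolev Ω →L[ℝ] L2Vec Ω :=
  (WithLp.sndL 2 ℝ (L2 Ω) (L2Vec Ω)) ∘L (sobolev Ω).subtypeL

theorem sobolev_norm_sq {Ω : Set (E d)} (w : sobolev Ω) :
    ‖w‖ ^ 2 = ‖sobolevEmb Ω w‖ ^ 2 + ‖sobolevGrad Ω w‖ ^ 2 :=
  WithLp.prod_norm_sq_eq_of_L2 w.1

/-- An element of the kernel is orthogonal to all test functions, so the fundamental lemma of the
calculus of variations applies. Injectivity of `ι†` expresses density of `H¹₀(Ω)` in `L²(Ω)`. -/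
theorem sobolevEmb_adjoint_injective {Ω : Set (E d)} (hΩ : IsOpen Ω) (x : L2 Ω)
    (h : (sobolevEmb Ω).adjoint x = 0) : x = 0 := by
  have hloc : LocallyIntegrableOn (x : E d → ℝ) Ω := by
    intro z hz
    obtain ⟨r, hr, hrΩ⟩ := Metric.isOpen_iff.1 hΩ z hz
    refine ⟨Metric.ball z r, mem_nhdsWithin_of_mem_nhds (Metric.ball_mem_nhds z hr), ?_⟩
    have : MemLp (x : E d → ℝ) 2 (volume.restrict (Metric.ball z r)) :=
      (Lp.memLp x).mono_measure (Measure.restrict_mono hrΩ le_rfl)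
    have hf : IsFiniteMeasure (volume.restrict (Metric.ball z r)) :=
      ⟨by rw [Measure.restrict_apply_univ]; exact measure_ball_lt_top⟩
    exact this.integrable (by norm_num)
  have h0 : ∀ᵐ z, z ∈ Ω → (x : E d → ℝ) z = 0 := by
    refine hΩ.ae_eq_zero_of_integral_contDiff_smul_eq_zero hloc fun ψ h1 h2 h3 => ?_
    have m1 : MemLp ψ 2 (volume.restrict Ω) :=
      (h1.continuous.memLp_of_hasCompactSupport h2).restrict Ω
    have m2 : MemLp (gradient ψ) 2 (volume.restrict Ω) :=
      ((continuous_gradient h1).memLp_of_hasCompactSupport (hasCompactSupport_gradient h2)).restrict Ω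
    let w : sobolev Ω := ⟨WithLp.toLp 2 (m1.toLp ψ, m2.toLp _), by
      rw [mem_sobolev]
      exact subset_closure ⟨ψ, h1, h2, h3, m1.coeFn_toLp, m2.coeFn_toLp⟩⟩
    have hw : ⟪x, sobolevEmb Ω w⟫ = 0 := by
      rw [← ContinuousLinearMap.adjoint_inner_left, h, inner_zero_left]
    rw [L2.inner_def] at hw
    rw [← setIntegral_eq_integral_of_forall_compl_eq_zero (s := Ω), ← hw]
    · refine integral_congr_ae ?_
      filter_upwards [m1.coeFn_toLp] with z hz
      have : (sobolevEmb Ω w : E d → ℝ) z = ψ z := hz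
      rw [this]
      rfl
    · intro z hz
      rw [image_eq_zero_of_notMem_tsupport fun hz' => hz (h3 hz'), zero_smul]
  refine Lp.ext ?_
  filter_upwards [(ae_restrict_iff' hΩ.measurableSet).2 h0, Lp.coeFn_zero ℝ 2 (volume.restrict Ω)]
    with z h1 h2
  rw [h1, h2]; rfl

end SobolevSpace

/-! ### Operators of first-order bilinear forms. -/

section FormOperator

variable {X Z V K K' : Type*} [MeasurableSpace X] [MeasurableSpace Z] {μ : Measure Z} [SFinite μ]
  [NormedAddCommGroup V] [InnerProductSpace ℝ V] [CompleteSpace V] [SecondCountableTopology V]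
  [NormedAddCommGroup K] [InnerProductSpace ℝ K] [CompleteSpace K] [SecondCountableTopology K]
  [NormedAddCommGroup K'] [InnerProductSpace ℝ K'] [CompleteSpace K'] [SecondCountableTopology K']

/-- The operator of the bilinear form `(v, w) ↦ ∫ ⟪w, r ∇v⟫ + ⟪∇w, q ∇v⟫`. -/
def formOp (ι : V →L[ℝ] Lp K' 2 μ) (D : V →L[ℝ] Lp K 2 μ) {r : X × Z → K →L[ℝ] K'}
    (hr : IsOpFamily r) {q : X × Z → K →L[ℝ] K} (hq : IsOpFamily q) (t : X) : V →L[ℝ] V :=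
  (ι.adjoint ∘L (hr.section_left t).pointwise μ +
    D.adjoint ∘L (hq.section_left t).pointwise μ) ∘L D

variable (ι : V →L[ℝ] Lp K' 2 μ) (D : V →L[ℝ] Lp K 2 μ) {r : X × Z → K →L[ℝ] K'}
  (hr : IsOpFamily r) {q : X × Z → K →L[ℝ] K} (hq : IsOpFamily q) (t : X)

theorem inner_formOp_eq_add (v w : V) : ⟪w, formOp ι D hr hq t v⟫ =
    ⟪ι w, (hr.section_left t).pointwise μ (D v)⟫ +
      ⟪D w, (hq.section_left t).pointwise μ (D v)⟫ := by
  simp only [formOp, ContinuousLinearMap.comp_apply, add_apply]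
  rw [inner_add_right, ContinuousLinearMap.adjoint_inner_right,
    ContinuousLinearMap.adjoint_inner_right]

theorem inner_formOp (v w : V) : ⟪w, formOp ι D hr hq t v⟫ =
    ∫ z, (⟪ι w z, r (t, z) (D v z)⟫ + ⟪D w z, q (t, z) (D v z)⟫) ∂μ := by
  rw [inner_formOp_eq_add, L2.inner_def, L2.inner_def,
    ← integral_add (L2.integrable_inner (𝕜 := ℝ) _ _) (L2.integrable_inner (𝕜 := ℝ) _ _)]
  refine integral_congr_ae ?_
  filter_upwards [(hr.section_left t).coeFn_pointwise (D v),
    (hq.section_left t).coeFn_pointwise (D v)] with x h1 h2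
  rw [h1, h2]

theorem isOpFamily_formOp [Nonempty (X × Z)] : IsOpFamily (formOp ι D hr hq) := by
  refine ⟨fun v => stronglyMeasurable_of_inner fun w => ?_, ?_⟩
  · simp only [inner_formOp_eq_add]
    exact (measurable_inner_pointwise hr _ _).add (measurable_inner_pointwise hq _ _)
  · obtain ⟨M, hM⟩ := hq.bdd
    obtain ⟨N, hN⟩ := hr.bdd
    have hM0 : 0 ≤ M := (norm_nonneg _).trans (hM (Classical.arbitrary _))
    have hN0 : 0 ≤ N := (norm_nonneg _).trans (hN (Classical.arbitrary _))
    refine ⟨(‖ι.adjoint‖ * N + ‖D.adjoint‖ * M) * ‖D‖, fun t => ?_⟩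
    refine (ContinuousLinearMap.opNorm_comp_le _ _).trans
      (mul_le_mul_of_nonneg_right ?_ (norm_nonneg _))
    refine (norm_add_le _ _).trans (add_le_add ?_ ?_)
    · exact (ContinuousLinearMap.opNorm_comp_le _ _).trans (mul_le_mul_of_nonneg_left
        (IsOpFamily.norm_pointwise_le _ hN0 fun x => hN _) (norm_nonneg _))
    · exact (ContinuousLinearMap.opNorm_comp_le _ _).trans (mul_le_mul_of_nonneg_left
        (IsOpFamily.norm_pointwise_le _ hM0 fun x => hM _) (norm_nonneg _))

/-- Gårding's inequality. -/
theorem garding_formOp (hnorm : ∀ v : V, ‖v‖ ^ 2 = ‖ι v‖ ^ 2 + ‖D v‖ ^ 2) {lam N : ℝ}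
    (hlam : 0 < lam) (hN : ∀ p, ‖r p‖ ≤ N)
    (hell : ∀ᵐ z ∂μ, ∀ ζ, 2 * lam * ‖ζ‖ ^ 2 ≤ ⟪ζ, q (t, z) ζ⟫) (v : V) :
    lam * ‖v‖ ^ 2 ≤ ⟪formOp ι D hr hq t v, v⟫ + (N ^ 2 / lam + lam) * ‖ι v‖ ^ 2 := by
  have i1 := L2.integrable_inner (𝕜 := ℝ) (ι v) ((hr.section_left t).pointwise μ (D v))
  have i2 := L2.integrable_inner (𝕜 := ℝ) (D v) ((hq.section_left t).pointwise μ (D v))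
  have i3 := (L2.integrable_inner (𝕜 := ℝ) (ι v) (ι v)).const_mul (N ^ 2 / lam)
  have i4 := (L2.integrable_inner (𝕜 := ℝ) (D v) (D v)).const_mul lam
  have h : lam * ‖D v‖ ^ 2 ≤ ⟪v, formOp ι D hr hq t v⟫ + N ^ 2 / lam * ‖ι v‖ ^ 2 := by
    rw [inner_formOp_eq_add, ← real_inner_self_eq_norm_sq, ← real_inner_self_eq_norm_sq,
      L2.inner_def, L2.inner_def, L2.inner_def, L2.inner_def, ← integral_const_mul,
      ← integral_const_mul, ← integral_add i1 i2]
    refine le_of_le_of_eq ?_ (integral_add (i1.add i2) i3)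
    refine integral_mono_ae i4 ((i1.add i2).add i3) ?_
    filter_upwards [(hr.section_left t).coeFn_pointwise (D v),
      (hq.section_left t).coeFn_pointwise (D v), hell] with x h1 h2 hx
    simp only [h1, h2, real_inner_self_eq_norm_sq]
    generalize (D v : Z → K) x = z
    generalize (ι v : Z → K') x = c
    have e1 := hx z
    have e2 : |⟪c, r (t, x) z⟫| ≤ ‖c‖ * (N * ‖z‖) :=
      (abs_real_inner_le_norm _ _).trans
        (mul_le_mul_of_nonneg_left ((r (t, x)).le_of_opNorm_le (hN _) z) (norm_nonneg _))
    have e3 := (abs_le.1 e2).1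
    -- Young's inequality: the lower-order term consumes half of the ellipticity `2 * lam`.
    have e4 : ‖c‖ * (N * ‖z‖) ≤ lam * ‖z‖ ^ 2 + N ^ 2 / lam * ‖c‖ ^ 2 := by
      have h5 : N ^ 2 / lam * ‖c‖ ^ 2 = lam * (N / lam * ‖c‖) ^ 2 := by field_simp
      have h6 : ‖c‖ * (N * ‖z‖) = lam * ((N / lam * ‖c‖) * ‖z‖) := by field_simp
      rw [h5, h6, ← mul_add]
      refine mul_le_mul_of_nonneg_left ?_ hlam.le
      nlinarith [sq_nonneg (‖z‖ - N / lam * ‖c‖), sq_nonneg (‖z‖), sq_nonneg (N / lam * ‖c‖)]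
    linarith
  rw [hnorm, real_inner_comm]
  linarith

end FormOperator

/-! ### Bounded measurable coefficients. -/

section Coefficients

variable {d : ℕ} (S : ControlSystem d)

/-- The function is bounded and measurable on `(0,T) × Ω`. -/
structure IsCoefficient (f : ℝ → E d → ℝ) : Prop where
  meas : Measurable (indicator (Ioo 0 S.T ×ˢ S.Ω) fun q : ℝ × E d => f q.1 q.2)
  bdd : ∃ C : ℝ, ∀ t ∈ Ioo 0 S.T, ∀ x ∈ S.Ω, |f t x| ≤ C

variable {S}

theorem measurableSet_cylinder : MeasurableSet (Ioo 0 S.T ×ˢ S.Ω) :=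
  measurableSet_Ioo.prod S.Ω_open.measurableSet

theorem IsCoefficient.add {f g : ℝ → E d → ℝ} (hf : IsCoefficient S f) (hg : IsCoefficient S g) :
    IsCoefficient S fun t x => f t x + g t x := by
  refine ⟨?_, ?_⟩
  · have := hf.meas.add hg.meas
    rwa [← indicator_add'] at this
  · obtain ⟨C, hC⟩ := hf.bdd
    obtain ⟨D, hD⟩ := hg.bdd
    exact ⟨C + D, fun t ht x hx => (abs_add_le _ _).trans (add_le_add (hC t ht x hx) (hD t ht x hx))⟩

theorem IsCoefficient.mul {f g : ℝ → E d → ℝ} (hf : IsCoefficient S f) (hg : IsCoefficient S g) :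
    IsCoefficient S fun t x => f t x * g t x := by
  refine ⟨?_, ?_⟩
  · have := hf.meas.mul hg.meas
    convert this using 1
    exact indicator_mul _ _ _
  · obtain ⟨C, hC⟩ := hf.bdd
    obtain ⟨D, hD⟩ := hg.bdd
    refine ⟨C * D, fun t ht x hx => ?_⟩
    rw [abs_mul]
    exact mul_le_mul (hC t ht x hx) (hD t ht x hx) (abs_nonneg _)
      ((abs_nonneg _).trans (hC t ht x hx))

theorem isCoefficient_const (c : ℝ) : IsCoefficient S fun _ _ => c :=
  ⟨measurable_const.indicator measurableSet_cylinder, |c|, fun _ _ _ _ => le_rfl⟩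

theorem isCoefficient_sum {ι : Type*} (s : Finset ι) {f : ι → ℝ → E d → ℝ}
    (hf : ∀ i, IsCoefficient S (f i)) : IsCoefficient S fun t x => ∑ i ∈ s, f i t x := by
  classical
  induction s using Finset.induction_on with
  | empty => simpa using isCoefficient_const 0
  | insert i s hi ih =>
    simp only [Finset.sum_insert hi]
    exact (hf i).add ih

theorem isCoefficient_of_continuousOn {f : ℝ → E d → ℝ}
    (hf : ContinuousOn (fun q : ℝ × E d => f q.1 q.2) (Icc 0 S.T ×ˢ univ)) :
    IsCoefficient S f := by
  have hsub : Ioo 0 S.T ×ˢ S.Ω ⊆ Icc 0 S.T ×ˢ (univ : Set (E d)) :=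
    prod_mono Ioo_subset_Icc_self (subset_univ _)
  refine ⟨?_, ?_⟩
  · refine measurable_of_restrict_of_restrict_compl (measurableSet_cylinder (S := S)) ?_ ?_
    · convert (continuousOn_iff_continuous_domRestrict.1 (hf.mono hsub)).measurable using 1
      funext q
      exact indicator_of_mem q.2 _
    · convert (measurable_const : Measurable fun _ => (0 : ℝ)) using 1
      funext q
      exact indicator_of_notMem q.2 _
  · have hK : IsCompact (Icc 0 S.T ×ˢ closure S.Ω) := isCompact_Icc.prod S.Ω_bounded.isCompact_closure
    obtain ⟨C, hC⟩ := hK.exists_bound_of_continuousOn (hf.mono (prod_mono_right (subset_univ _)))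
    exact ⟨C, fun t ht x hx => hC (t, x) ⟨Ioo_subset_Icc_self ht, subset_closure hx⟩⟩

end Coefficients

/-! ### The coefficients of the control system. -/

section SystemCoefficients

variable {d : ℕ} {S : ControlSystem d}

theorem IsCoefficient.indicator_bdd {f : ℝ → E d → ℝ} (hf : IsCoefficient S f) :
    ∃ C : ℝ, ∀ q, |indicator (Ioo 0 S.T ×ˢ S.Ω) (fun q : ℝ × E d => f q.1 q.2) q| ≤ C := by
  obtain ⟨C, hC⟩ := hf.bdd
  refine ⟨max C 0, fun q => ?_⟩
  by_cases hq : q ∈ Ioo 0 S.T ×ˢ S.Ω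
  · rw [indicator_of_mem hq]
    exact (hC q.1 hq.1 q.2 hq.2).trans (le_max_left _ _)
  · rw [indicator_of_notMem hq, abs_zero]
    exact le_max_right _ _

theorem continuousOn_a (i j : Fin d) :
    ContinuousOn (fun q : ℝ × E d => S.a q.1 q.2 i j) (Ici 0 ×ˢ univ) := by
  obtain ⟨K, hK⟩ := S.a_lipschitz i j
  exact hK.continuousOn

theorem isCoefficient_a (i j : Fin d) : IsCoefficient S fun t x => S.a t x i j :=
  isCoefficient_of_continuousOn ((continuousOn_a i j).mono (prod_mono_left Icc_subset_Ici_self))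

/-- The Lipschitz constant bounds the derivative, and the derivative in `x` of a jointly continuous
function is jointly measurable. -/
theorem isCoefficient_pd_a (k i j : Fin d) :
    IsCoefficient S fun t x => pd k (fun z => S.a t z i j) x := by
  obtain ⟨K, hK⟩ := S.a_lipschitz i j
  have hlip : ∀ t, 0 ≤ t → LipschitzWith K fun z => S.a t z i j := by
    intro t ht
    rw [← lipschitzOnWith_univ]
    intro x _ y _
    have := hK (show (t, x) ∈ Ici 0 ×ˢ univ from ⟨ht, trivial⟩)
      (show (t, y) ∈ Ici 0 ×ˢ univ from ⟨ht, trivial⟩)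
    simpa [Prod.edist_eq] using this
  refine ⟨?_, K * ‖EuclideanSpace.single k (1 : ℝ)‖, fun t ht x _ => ?_⟩
  -- Freezing the coefficient at time `0` for negative times makes it continuous on the whole space.
  · let f : ℝ → E d → ℝ := fun t x => S.a (max t 0) x i j
    have hf : Continuous f.uncurry := by
      refine (continuousOn_a i j).comp_continuous
        (f := fun q : ℝ × E d => (max q.1 0, q.2)) (by fun_prop) fun q => ?_
      exact ⟨show (0 : ℝ) ≤ max q.1 0 from le_max_right _ _, trivial⟩
    have hm : Measurable fun q : ℝ × E d => fderiv ℝ (f q.1) q.2 (EuclideanSpace.single k 1) :=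
      (measurable_fderiv_with_param ℝ hf).apply_continuousLinearMap _
    have := hm.indicator (measurableSet_cylinder (S := S))
    convert this using 1
    refine indicator_congr fun q hq => ?_
    simp only [pd, f, max_eq_left hq.1.1.le]
  · refine ((fderiv ℝ (fun z => S.a t z i j) x).le_of_opNorm_le ?_ _)
    exact norm_fderiv_le_of_lipschitz ℝ (hlip t ht.1.le)

theorem isCoefficient_drift (j : Fin d) : IsCoefficient S fun t x => S.drift t x j := by
  obtain ⟨K, hK⟩ := S.μ_lipschitz
  refine isCoefficient_of_continuousOn ?_
  have := hK.continuousOn.mono (prod_mono_left (Icc_subset_Ici_self : Icc 0 S.T ⊆ Ici 0))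
  exact (EuclideanSpace.proj (𝕜 := ℝ) j).continuous.comp_continuousOn this

/-- The added drift contains `∂ₖ log h = h⁻¹ ∂ₖ h`, which is continuous on `[0,T] × ℝ^d` since `h`
is positive there; boundedness on the cylinder follows by compactness of `[0,T] × closure Ω`. -/
theorem isCoefficient_driftH {h : ℝ → E d → ℝ} (hh : S.IsPerturbation h) (j : Fin d) :
    IsCoefficient S fun t x => S.driftH h t x j := by
  refine (isCoefficient_drift j).add (isCoefficient_sum _ fun k => (isCoefficient_a j k).mul ?_)
  refine isCoefficient_of_continuousOn ?_
  refine ((hh.smooth.cont.inv₀ fun q hq => (hh.pos q.1 hq.1 q.2).ne').mul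
    (hh.smooth.cont_space k)).congr fun q hq => ?_
  have hd : DifferentiableAt ℝ (h q.1) q.2 :=
    (hh.smooth.diff_space q.1 hq.1).differentiable (by norm_num) q.2
  simp only [pd]
  rw [fderiv.log hd (hh.pos q.1 hq.1 q.2).ne']
  rfl

/-- The matrix coefficient of the bilinear form, as an operator on `ℝ^d`. -/
def matrixCoeff (S : ControlSystem d) (q : ℝ × E d) : E d →L[ℝ] E d :=
  ∑ p : Fin d × Fin d, indicator (Ioo 0 S.T ×ˢ S.Ω)
    (fun q : ℝ × E d => 1 / 2 * S.a q.1 q.2 p.1 p.2) q •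
      (EuclideanSpace.proj (𝕜 := ℝ) p.2).smulRight (EuclideanSpace.single p.1 (1 : ℝ))

/-- The vector coefficient of the bilinear form, as a functional on `ℝ^d`. -/
def vectorCoeff (S : ControlSystem d) (b : ℝ → E d → Fin d → ℝ) (q : ℝ × E d) : E d →L[ℝ] ℝ :=
  ∑ j : Fin d, indicator (Ioo 0 S.T ×ˢ S.Ω)
    (fun q : ℝ × E d => 1 / 2 * (∑ i, pd i (fun z => S.a q.1 z i j) q.2) + -1 * b q.1 q.2 j) q •
      EuclideanSpace.proj (𝕜 := ℝ) j

theorem isOpFamily_matrixCoeff (S : ControlSystem d) : IsOpFamily (matrixCoeff S) := by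
  have h : ∀ p : Fin d × Fin d, IsCoefficient S fun t x => 1 / 2 * S.a t x p.1 p.2 := fun p =>
    (isCoefficient_const _).mul (isCoefficient_a p.1 p.2)
  exact isOpFamily_sum (fun p => (h p).meas) (fun p => (h p).indicator_bdd) _

theorem isOpFamily_vectorCoeff {b : ℝ → E d → Fin d → ℝ}
    (hb : ∀ j, IsCoefficient S fun t x => b t x j) : IsOpFamily (vectorCoeff S b) := by
  have h : ∀ j : Fin d, IsCoefficient S fun t x =>
      1 / 2 * (∑ i, pd i (fun z => S.a t z i j) x) + -1 * b t x j := fun j =>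
    ((isCoefficient_const _).mul (isCoefficient_sum _ fun i => isCoefficient_pd_a i i j)).add
      ((isCoefficient_const _).mul (hb j))
  exact isOpFamily_sum (fun p => (h p).meas) (fun p => (h p).indicator_bdd) _

theorem inner_matrixCoeff {t : ℝ} (ht : t ∈ Ioo 0 S.T) {x : E d} (hx : x ∈ S.Ω) (v w : E d) :
    ⟪w, matrixCoeff S (t, x) v⟫ = 1 / 2 * ∑ i, ∑ j, S.a t x i j * v j * w i := by
  have hq : (t, x) ∈ Ioo 0 S.T ×ˢ S.Ω := ⟨ht, hx⟩
  simp only [matrixCoeff, sum_apply, smul_apply, inner_sum, inner_smul_right,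
    indicator_of_mem hq, ContinuousLinearMap.smulRight_apply, PiLp.proj_apply,
    EuclideanSpace.inner_single_right, Fintype.sum_prod_type, Finset.mul_sum]
  refine Finset.sum_congr rfl fun i _ => Finset.sum_congr rfl fun j _ => ?_
  simp
  ring

theorem vectorCoeff_apply (b : ℝ → E d → Fin d → ℝ) {t : ℝ} (ht : t ∈ Ioo 0 S.T) {x : E d}
    (hx : x ∈ S.Ω) (v : E d) (c : ℝ) :
    ⟪c, vectorCoeff S b (t, x) v⟫ =
      1 / 2 * ∑ i, ∑ j, pd i (fun z => S.a t z i j) x * v j * c - ∑ j, b t x j * v j * c := by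
  have hq : (t, x) ∈ Ioo 0 S.T ×ˢ S.Ω := ⟨ht, hx⟩
  rw [Finset.sum_comm, Finset.mul_sum, ← Finset.sum_sub_distrib]
  simp only [vectorCoeff, sum_apply, smul_apply, indicator_of_mem hq, PiLp.proj_apply,
    inner_sum]
  refine Finset.sum_congr rfl fun j _ => ?_
  rw [← Finset.sum_mul, ← Finset.sum_mul]
  simp
  ring

theorem matrixCoeff_elliptic (S : ControlSystem d) : ∃ lam : ℝ, 0 < lam ∧
    ∀ t ∈ Ioo 0 S.T, ∀ x ∈ S.Ω, ∀ ζ, 2 * lam * ‖ζ‖ ^ 2 ≤ ⟪ζ, matrixCoeff S (t, x) ζ⟫ := by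
  obtain ⟨lam, hlam, h⟩ := S.a_elliptic
  -- The form carries `½ a`, and half of its ellipticity is reserved for Young's inequality.
  refine ⟨lam / 4, by positivity, fun t ht x hx ζ => ?_⟩
  have h1 := h t ht.1.le x ζ
  have e1 : ((ζ : Fin d → ℝ)) ⬝ᵥ ζ = ‖ζ‖ ^ 2 := by
    rw [EuclideanSpace.real_norm_sq_eq]
    simp [dotProduct, sq]
  have e2 : (ζ : Fin d → ℝ) ⬝ᵥ (S.a t x *ᵥ ζ) = ∑ i, ∑ j, S.a t x i j * ζ j * ζ i := by
    simp only [dotProduct, Matrix.mulVec, Finset.mul_sum]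
    exact Finset.sum_congr rfl fun i _ => Finset.sum_congr rfl fun j _ => by ring
  rw [e1, e2] at h1
  rw [inner_matrixCoeff ht hx]
  linarith

end SystemCoefficients

/-! ### The operator family on `H¹₀(Ω)`. -/

section SystemOperator

variable {d : ℕ} {S : ControlSystem d} {b : ℝ → E d → Fin d → ℝ}

/-- The operator family on `H¹₀(Ω)` which represents the bilinear form of the system. -/
def systemOp (hb : ∀ j, IsCoefficient S fun t x => b t x j) : ℝ → sobolev S.Ω →L[ℝ] sobolev S.Ω :=
  formOp (sobolevEmb S.Ω) (sobolevGrad S.Ω) (isOpFamily_vectorCoeff hb) (isOpFamily_matrixCoeff S)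

theorem isOpFamily_systemOp (hb : ∀ j, IsCoefficient S fun t x => b t x j) :
    IsOpFamily (systemOp hb) :=
  isOpFamily_formOp _ _ _ _

theorem inner_systemOp (hb : ∀ j, IsCoefficient S fun t x => b t x j) {t : ℝ}
    (ht : t ∈ Ioo 0 S.T) (v w : sobolev S.Ω) :
    ⟪w, systemOp hb t v⟫ =
      S.form b t (sobolevEmb S.Ω v, sobolevGrad S.Ω v) (sobolevEmb S.Ω w, sobolevGrad S.Ω w) := by
  refine (inner_formOp _ _ _ _ _ _ _).trans ?_
  refine setIntegral_congr_fun S.Ω_open.measurableSet fun x hx => ?_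
  simp only [inner_matrixCoeff ht hx, vectorCoeff_apply b ht hx]
  ring

/-- Gårding's inequality at a fixed time. -/
theorem garding_systemOp_of_bound (hb : ∀ j, IsCoefficient S fun t x => b t x j) {t lam N : ℝ}
    (hlam : 0 < lam) (hN : ∀ p, ‖vectorCoeff S b p‖ ≤ N)
    (h : ∀ᵐ x ∂volume.restrict S.Ω, ∀ ζ, 2 * lam * ‖ζ‖ ^ 2 ≤ ⟪ζ, matrixCoeff S (t, x) ζ⟫)
    (v : sobolev S.Ω) :
    lam * ‖v‖ ^ 2 ≤ ⟪systemOp hb t v, v⟫ + (N ^ 2 / lam + lam) * ‖sobolevEmb S.Ω v‖ ^ 2 :=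
  garding_formOp (sobolevEmb S.Ω) (sobolevGrad S.Ω) (isOpFamily_vectorCoeff hb)
    (isOpFamily_matrixCoeff S) t sobolev_norm_sq hlam hN h v

theorem garding_systemOp (hb : ∀ j, IsCoefficient S fun t x => b t x j) :
    ∃ c C : ℝ, 0 < c ∧ ∀ t ∈ Ioo 0 S.T, ∀ v : sobolev S.Ω,
      c * ‖v‖ ^ 2 ≤ ⟪systemOp hb t v, v⟫ + C * ‖sobolevEmb S.Ω v‖ ^ 2 := by
  obtain ⟨lam, hlam, hell⟩ := matrixCoeff_elliptic S
  obtain ⟨N, hN⟩ := (isOpFamily_vectorCoeff hb).bdd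
  refine ⟨lam, N ^ 2 / lam + lam, hlam, fun t ht v => ?_⟩
  have h : ∀ᵐ x ∂volume.restrict S.Ω, ∀ ζ,
      2 * lam * ‖ζ‖ ^ 2 ≤ ⟪ζ, matrixCoeff S (t, x) ζ⟫ := by
    filter_upwards [ae_restrict_mem S.Ω_open.measurableSet] with x hx using hell t ht x hx
  exact garding_systemOp_of_bound hb hlam hN h v

end SystemOperator

/-! ### From operator equations to equations tested with pairs `(w, ∇w)`. -/

section ComponentForm

variable {T : ℝ}

theorem inner_primAt {K : Type*} [NormedAddCommGroup K] [InnerProductSpace ℝ K] [CompleteSpace K]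
    [SecondCountableTopology K] (k : TimeL2 T K) (w : K) {f : ℝ → ℝ}
    (h : ∀ᵐ s ∂timeMeasure T, ⟪k s, w⟫ = f s) {t : ℝ} (ht : t ∈ Icc 0 T) :
    ⟪primAt T K t k, w⟫ = ∫ s in (0 : ℝ)..t, f s := by
  rw [real_inner_comm]
  refine (primAt_lift_const (innerSL ℝ w) k t).symm.trans (primAt_eq_of_ae _ ?_ ht)
  filter_upwards [(isOpFamily_const (innerSL ℝ w)).coeFn_lift k, h] with s h1 h2
  rw [h1, ← h2, real_inner_comm]; rfl

theorem inner_primAt_sub {K : Type*} [NormedAddCommGroup K] [InnerProductSpace ℝ K]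
    [CompleteSpace K] [SecondCountableTopology K] (k : TimeL2 T K) (w : K) {f : ℝ → ℝ}
    (h : ∀ᵐ s ∂timeMeasure T, ⟪k s, w⟫ = f s) {t : ℝ} (ht : t ∈ Icc 0 T) :
    ⟪primAt T K T k - primAt T K t k, w⟫ = ∫ s in t..T, f s := by
  have hT : 0 ≤ T := ht.1.trans ht.2
  have hi : IntervalIntegrable f volume 0 T := by
    rw [intervalIntegrable_iff_integrableOn_Ioo_of_le hT]
    exact ((timeL2_integrable k).inner_const w).congr h
  have hi' : IntervalIntegrable f volume 0 t := hi.mono_set (by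
    rw [uIcc_of_le hT, uIcc_of_le ht.1]; exact Icc_subset_Icc_right ht.2)
  rw [inner_sub_left, inner_primAt k w h ⟨hT, le_rfl⟩, inner_primAt k w h ht,
    intervalIntegral.integral_interval_sub_left hi hi']

variable {H H' : Type*} [NormedAddCommGroup H] [InnerProductSpace ℝ H] [CompleteSpace H]
  [SecondCountableTopology H] [NormedAddCommGroup H'] [InnerProductSpace ℝ H'] [CompleteSpace H']
  [SecondCountableTopology H'] (V : Submodule ℝ (WithLp 2 (H × H'))) [CompleteSpace V]
  [SecondCountableTopology V]

/-- The first component of the elements of a subspace of a Hilbert sum. -/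
def fstOn : V →L[ℝ] H := (WithLp.fstL 2 ℝ H H') ∘L V.subtypeL

variable {V}

theorem inner_residual {A : ℝ → V →L[ℝ] V} (hA : IsOpFamily A) (γ : TimeL2 T H)
    (v : TimeL2 T V) (w : V) : ∀ᵐ s ∂timeMeasure T,
    ⟪((isOpFamily_const (fstOn V).adjoint).lift T γ - hA.lift T v : TimeL2 T V) s, w⟫ =
      ⟪γ s, w.1.fst⟫ - ⟪w, A s (v s)⟫ := by
  filter_upwards [(isOpFamily_const (fstOn V).adjoint).coeFn_lift γ, hA.coeFn_lift v,
    Lp.coeFn_sub ((isOpFamily_const (fstOn V).adjoint).lift T γ) (hA.lift T v)] with s h1 h2 h3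
  rw [h3, Pi.sub_apply, h1, h2, inner_sub_left, ContinuousLinearMap.adjoint_inner_left,
    real_inner_comm w]
  rfl

variable {A : ℝ → V →L[ℝ] V} {hA : IsOpFamily A} {γ : TimeL2 T H} {F : ℝ → H → H' → V → ℝ}
  {γf : ℝ → V → ℝ} {y : C(Icc (0 : ℝ) T, H)} {ξ : H} {hT : 0 ≤ T}

theorem inner_residual_eq (hF : ∀ s ∈ Ioo 0 T, ∀ v w : V, F s v.1.fst v.1.snd w = ⟪w, A s v⟫)
    (hγ : ∀ w : V, ∀ᵐ s ∂timeMeasure T, γf s w = ⟪γ s, w.1.fst⟫) {g : ℝ → H'} {v : TimeL2 T V}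
    (hv : ∀ᵐ s ∂timeMeasure T, (v s).1.fst = IccExtend hT y s ∧ (v s).1.snd = g s) (w : V) :
    ∀ᵐ s ∂timeMeasure T,
    ⟪((isOpFamily_const (fstOn V).adjoint).lift T γ - hA.lift T v : TimeL2 T V) s, w⟫ =
      γf s w - F s (IccExtend hT y s) (g s) w := by
  filter_upwards [inner_residual hA γ v w, hγ w, hv, ae_restrict_mem measurableSet_Ioo]
    with s h1 h2 h3 hs
  rw [h1, h2, ← h3.1, ← h3.2, hF s hs]

/-- Membership in `V` holds only almost everywhere. The orthogonal projection onto `V` yields an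
honest `V`-valued function without changing these values. -/
theorem exists_lift_of_mem {g : ℝ → H'} (hg : MemLp g 2 (timeMeasure T))
    (hm : ∀ᵐ t ∂timeMeasure T, WithLp.toLp 2 (IccExtend hT y t, g t) ∈ V) : ∃ v : TimeL2 T V,
    ∀ᵐ s ∂timeMeasure T, (v s).1.fst = IccExtend hT y s ∧ (v s).1.snd = g s := by
  let P : WithLp 2 (H × H') →L[ℝ] V := V.orthogonalProjectionOnto
  have h1 : MemLp (fun t => WithLp.toLp 2 (IccExtend hT y t, g t)) 2 (timeMeasure T) :=
    MemLp.of_fst_of_snd_prodLp ⟨memLp_IccExtend hT y, hg⟩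
  refine ⟨(P.comp_memLp' h1).toLp _, ?_⟩
  filter_upwards [(P.comp_memLp' h1).coeFn_toLp, hm] with s h2 h3
  have h4 : P (WithLp.toLp 2 (IccExtend hT y s, g s)) = ⟨_, h3⟩ :=
    V.orthogonalProjectionOnto_mem_subspace_eq_self ⟨_, h3⟩
  rw [h2, Function.comp_apply, h4]
  exact ⟨rfl, rfl⟩

theorem memLp_snd (v : TimeL2 T V) : MemLp (fun t => (v t).1.snd) 2 (timeMeasure T) :=
  ((WithLp.sndL 2 ℝ H H') ∘L V.subtypeL).comp_memLp' (Lp.memLp v)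

/-- The gradient is the second component of the `V`-valued representative. The equation in `V` holds
exactly when it holds after pairing with every `w`, and pairing commutes with time integration. -/
theorem weakForward_iff_components
    (hF : ∀ s ∈ Ioo 0 T, ∀ v w : V, F s v.1.fst v.1.snd w = ⟪w, A s v⟫)
    (hγ : ∀ w : V, ∀ᵐ s ∂timeMeasure T, γf s w = ⟪γ s, w.1.fst⟫) :
    WeakForward hT (fstOn V) hA γ y ↔ ∃ g : ℝ → H', (MemLp g 2 (timeMeasure T) ∧
      ∀ᵐ t ∂timeMeasure T, WithLp.toLp 2 (IccExtend hT y t, g t) ∈ V) ∧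
      ∀ w : V, ∀ t ∈ Icc 0 T, ⟪IccExtend hT y t, w.1.fst⟫ =
        ∫ s in (0 : ℝ)..t, (γf s w - F s (IccExtend hT y s) (g s) w) := by
  constructor
  · rintro ⟨v, hv1, hv2⟩
    refine ⟨fun t => (v t).1.snd, ⟨memLp_snd v, ?_⟩, fun w t ht => ?_⟩
    · filter_upwards [hv1] with t h
      rw [← h]
      exact (v t).2
    · have h := inner_primAt _ w (inner_residual_eq hF hγ (hA := hA)
        (g := fun t => (v t).1.snd) (by filter_upwards [hv1] with t h using ⟨h, rfl⟩) w) ht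
      rw [← hv2 t ht, ContinuousLinearMap.adjoint_inner_left] at h
      exact h
  · rintro ⟨g, ⟨hg, hm⟩, h⟩
    obtain ⟨v, hv⟩ := exists_lift_of_mem hg hm
    refine ⟨v, by filter_upwards [hv] with t h using h.1, fun t ht => ?_⟩
    refine ext_inner_right ℝ fun w => ?_
    rw [inner_primAt _ w (inner_residual_eq hF hγ hv w) ht, ← h w t ht,
      ContinuousLinearMap.adjoint_inner_left]
    rfl

theorem weakBackward_iff_components
    (hF : ∀ s ∈ Ioo 0 T, ∀ v w : V, F s v.1.fst v.1.snd w = ⟪w, A s v⟫)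
    (hγ : ∀ w : V, ∀ᵐ s ∂timeMeasure T, γf s w = ⟪γ s, w.1.fst⟫) :
    WeakBackward hT (fstOn V) hA γ ξ y ↔ ∃ g : ℝ → H', (MemLp g 2 (timeMeasure T) ∧
      ∀ᵐ t ∂timeMeasure T, WithLp.toLp 2 (IccExtend hT y t, g t) ∈ V) ∧
      ∀ w : V, ∀ t ∈ Icc 0 T, ⟪IccExtend hT y t, w.1.fst⟫ = ⟪ξ, w.1.fst⟫ +
        ∫ s in t..T, (γf s w - F s (IccExtend hT y s) (g s) w) := by
  constructor
  · rintro ⟨v, hv1, hv2⟩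
    refine ⟨fun t => (v t).1.snd, ⟨memLp_snd v, ?_⟩, fun w t ht => ?_⟩
    · filter_upwards [hv1] with t h
      rw [← h]
      exact (v t).2
    · have h := inner_primAt_sub _ w (inner_residual_eq hF hγ (hA := hA)
        (g := fun t => (v t).1.snd) (by filter_upwards [hv1] with t h using ⟨h, rfl⟩) w) ht
      have h2 := congrArg (fun x => ⟪x, w⟫) (hv2 t ht)
      simp only [inner_add_left, h, ContinuousLinearMap.adjoint_inner_left] at h2
      exact h2
  · rintro ⟨g, ⟨hg, hm⟩, h⟩
    obtain ⟨v, hv⟩ := exists_lift_of_mem hg hm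
    refine ⟨v, by filter_upwards [hv] with t h using h.1, fun t ht => ?_⟩
    refine ext_inner_right ℝ fun w => ?_
    rw [inner_add_left, inner_primAt_sub _ w (inner_residual_eq hF hγ hv w) ht,
      ContinuousLinearMap.adjoint_inner_left, ContinuousLinearMap.adjoint_inner_left]
    exact h w t ht

end ComponentForm

/-! ### Concrete weak solutions in operator form. -/

section SystemSolutions

variable {d : ℕ} {S : ControlSystem d} {b : ℝ → E d → Fin d → ℝ}

/-- The element `γ` of `L²(0,T;L²(Ω))` represents the source `f`. -/
def Represents (S : ControlSystem d) (γ : TimeL2 S.T (L2 S.Ω)) (f : ℝ → E d → ℝ) : Prop :=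
  ∀ᵐ t ∂timeMeasure S.T, (γ t : E d → ℝ) =ᵐ[volume.restrict S.Ω] f t

theorem Represents.inner {γ : TimeL2 S.T (L2 S.Ω)} {f : ℝ → E d → ℝ} (h : Represents S γ f)
    (w : L2 S.Ω) : ∀ᵐ s ∂timeMeasure S.T, ∫ x in S.Ω, f s x * w x = ⟪γ s, w⟫ := by
  filter_upwards [h] with s hs
  rw [L2.inner_def]
  refine integral_congr_ae ?_
  filter_upwards [hs] with x hx
  rw [hx]
  exact mul_comm _ _

theorem mem_sobolev_mk {Ω : Set (E d)} (u : L2 Ω) (u' : L2Vec Ω) :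
    WithLp.toLp 2 (u, u') ∈ sobolev Ω ↔ (u, u') ∈ H10 Ω := mem_sobolev

/-- Weak solutions of `∂ₜy - (½ tr(a D²y) + b · ∇y) = γ`, `y(0) = 0`. -/
def ForwardSol (hb : ∀ j, IsCoefficient S fun t x => b t x j) (γ : TimeL2 S.T (L2 S.Ω))
    (y : S.State) : Prop :=
  WeakForward S.T_pos.le (sobolevEmb S.Ω) (isOpFamily_systemOp hb) γ y

/-- Weak solutions of the equation adjoint to the one of `ForwardSol`, with terminal value `ξ`. -/
def BackwardSol (hb : ∀ j, IsCoefficient S fun t x => b t x j) (γ : TimeL2 S.T (L2 S.Ω))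
    (ξ : L2 S.Ω) (p : S.State) : Prop :=
  WeakBackward S.T_pos.le (sobolevEmb S.Ω) (isOpFamily_systemOp hb).adjoint γ ξ p

theorem isForwardSol_iff (hb : ∀ j, IsCoefficient S fun t x => b t x j)
    {γ : TimeL2 S.T (L2 S.Ω)} {f : ℝ → E d → ℝ} (hf : Represents S γ f) (y : S.State) :
    S.IsForwardSol b f 0 y ↔ ForwardSol hb γ y := by
  refine Iff.trans ?_ (weakForward_iff_components (V := sobolev S.Ω)
    (hA := isOpFamily_systemOp hb) (y := y) (γ := γ) (hT := S.T_pos.le)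
    (F := fun s u u' w => S.form b s (u, u') (w.1.fst, w.1.snd))
    (γf := fun s w => ∫ x in S.Ω, f s x * w.1.fst x)
    (fun s hs v w => (inner_systemOp hb hs v w).symm) fun w => hf.inner _).symm
  refine exists_congr fun g => and_congr (and_congr Iff.rfl (Filter.eventually_congr
    (.of_forall fun t => (mem_sobolev_mk _ _).symm))) ?_
  constructor
  · intro h w t ht
    have := h (w.1.fst, w.1.snd) (mem_sobolev.1 w.2) t ht
    rwa [inner_zero_left, zero_add] at this
  · intro h w hw t ht
    rw [inner_zero_left, zero_add]
    exact h ⟨WithLp.toLp 2 w, mem_sobolev.2 hw⟩ t ht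

theorem isBackwardSol_iff (hb : ∀ j, IsCoefficient S fun t x => b t x j)
    {γ : TimeL2 S.T (L2 S.Ω)} {f : ℝ → E d → ℝ} (hf : Represents S γ f) (ξ : L2 S.Ω)
    (p : S.State) :
    S.IsBackwardSol b f ξ p ↔ BackwardSol hb γ ξ p := by
  refine Iff.trans ?_ (weakBackward_iff_components (V := sobolev S.Ω)
    (hA := (isOpFamily_systemOp hb).adjoint) (y := p) (γ := γ) (hT := S.T_pos.le) (ξ := ξ)
    (F := fun s u u' w => S.form b s (w.1.fst, w.1.snd) (u, u'))
    (γf := fun s w => ∫ x in S.Ω, f s x * w.1.fst x)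
    (fun s hs v w => ?_) fun w => hf.inner _).symm
  swap
  · rw [ContinuousLinearMap.adjoint_inner_right, real_inner_comm]
    exact (inner_systemOp hb hs w v).symm
  refine exists_congr fun g => and_congr (and_congr Iff.rfl (Filter.eventually_congr
    (.of_forall fun t => (mem_sobolev_mk _ _).symm))) ?_
  constructor
  · intro h w t ht
    exact h (w.1.fst, w.1.snd) (mem_sobolev.1 w.2) t ht
  · intro h w hw t ht
    exact h ⟨WithLp.toLp 2 w, mem_sobolev.2 hw⟩ t ht

end SystemSolutions

/-! ### The abstract Stackelberg game. -/

section Game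

theorem eq_zero_of_forall_nonneg {a b : ℝ} (h : ∀ t : ℝ, 0 ≤ t * a + t ^ 2 * b) : a = 0 := by
  by_contra ha
  have hb : 0 < |b| + 1 := by positivity
  -- A step against the sign of `a`, short enough for the linear term to dominate the quadratic one.
  have h1 := h (-a / (2 * (|b| + 1)))
  have h2 : -a / (2 * (|b| + 1)) * a + (-a / (2 * (|b| + 1))) ^ 2 * b =
      a ^ 2 / (4 * (|b| + 1) ^ 2) * (b - 2 * (|b| + 1)) := by
    field_simp
    ring
  have h3 : b - 2 * (|b| + 1) < 0 := by linarith [le_abs_self b, abs_nonneg b]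
  have h4 : 0 < a ^ 2 / (4 * (|b| + 1) ^ 2) := by positivity
  nlinarith

/-- An abstract linear-quadratic Stackelberg game in Hilbert spaces: two forward evolution
equations (`FwdH` for the perturbed and `Fwd` for the approximate model) with zero initial value,
their adjoint equations (`BwdH`, `Bwd`), trajectories `X` that are observed in `K` and at the final
time in `H`, and controls in `U₁` and `U₂`. -/
structure Game (X H K U₁ U₂ : Type*) [AddCommGroup X] [Module ℝ X]
    [NormedAddCommGroup H] [InnerProductSpace ℝ H] [NormedAddCommGroup K] [InnerProductSpace ℝ K]
    [NormedAddCommGroup U₁] [InnerProductSpace ℝ U₁]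
    [NormedAddCommGroup U₂] [InnerProductSpace ℝ U₂] where
  traj : X →ₗ[ℝ] K
  final : X → H
  FwdH : K → X → Prop
  Fwd : K → X → Prop
  BwdH : K → H → X → Prop
  Bwd : K → H → X → Prop
  ext₁ : U₁ →ₗ[ℝ] K
  ext₂ : U₂ →ₗ[ℝ] K
  res₁ : K → U₁
  res₂ : K → U₂
  ref : K
  β : ℝ
  β_pos : 0 < β
  inner_ext₁ : ∀ u k, ⟪ext₁ u, k⟫ = ⟪u, res₁ k⟫
  inner_ext₂ : ∀ u k, ⟪ext₂ u, k⟫ = ⟪u, res₂ k⟫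
  greenH : ∀ {γ γ' ξ y p}, FwdH γ y → BwdH γ' ξ p →
    ⟪γ, traj p⟫ = ⟪final y, ξ⟫ + ⟪traj y, γ'⟫
  green : ∀ {γ γ' ξ y p}, Fwd γ y → Bwd γ' ξ p → ⟪γ, traj p⟫ = ⟪final y, ξ⟫ + ⟪traj y, γ'⟫
  fwd_smul : ∀ {γ y} (c : ℝ), Fwd γ y → Fwd (c • γ) (c • y)
  exists_fwd : ∀ γ, ∃ y, Fwd γ y
  exists_bwd : ∀ γ, ∃ p, Bwd γ 0 p

namespace Game

variable {X H K U₁ U₂ : Type*} [AddCommGroup X] [Module ℝ X]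
  [NormedAddCommGroup H] [InnerProductSpace ℝ H] [NormedAddCommGroup K] [InnerProductSpace ℝ K]
  [NormedAddCommGroup U₁] [InnerProductSpace ℝ U₁]
  [NormedAddCommGroup U₂] [InnerProductSpace ℝ U₂] (G : Game X H K U₁ U₂)

/-- The coupled system of the state and the adjoint state of the follower. -/
def StateSystem (u : U₁) (y p : X) : Prop :=
  G.FwdH (G.ext₁ u - G.β⁻¹ • G.ext₂ (G.res₂ (G.traj p))) y ∧ G.Bwd (G.traj y - G.ref) 0 p

/-- The adjoint of the system `StateSystem`. -/
def AdjointSystem (ξ : H) (φ ϑ : X) : Prop :=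
  G.BwdH (G.traj ϑ) ξ φ ∧ G.Fwd (-(G.β⁻¹ • G.ext₂ (G.res₂ (G.traj φ)))) ϑ

/-- The cost of the follower. -/
def cost (y : X) (u₁ : U₁) (u₂ : U₂) : ℝ :=
  1 / 2 * ‖G.traj y - G.ref‖ ^ 2 + G.β / 2 * (‖u₁‖ ^ 2 + ‖u₂‖ ^ 2)

/-- `u₂` is a response of the follower to `u₁`, with state `y`. -/
def Response (u₁ : U₁) (u₂ : U₂) (y : X) : Prop :=
  G.FwdH (G.ext₁ u₁ + G.ext₂ u₂) y ∧
    ∀ δu δy, G.Fwd (G.ext₂ δu) δy → G.cost y u₁ u₂ ≤ G.cost (y + δy) u₁ (u₂ + δu)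

theorem cost_add (y δy : X) (u₁ : U₁) (u₂ δu : U₂) : G.cost (y + δy) u₁ (u₂ + δu) =
    G.cost y u₁ u₂ + (⟪G.traj δy, G.traj y - G.ref⟫ + G.β * ⟪δu, u₂⟫) +
      (1 / 2 * ‖G.traj δy‖ ^ 2 + G.β / 2 * ‖δu‖ ^ 2) := by
  have e : G.traj (y + δy) - G.ref = (G.traj y - G.ref) + G.traj δy := by
    rw [map_add]; abel
  rw [cost, cost, e, norm_add_sq_real, norm_add_sq_real, real_inner_comm (G.traj δy),
    real_inner_comm δu]
  ring

/-- By Green's formula for the approximate model, the first variation of the cost vanishes at `-β⁻¹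
p`; the remaining term in `cost_add` is a sum of squares. -/
theorem StateSystem.response {G : Game X H K U₁ U₂} {u : U₁} {y p : X}
    (h : G.StateSystem u y p) : G.Response u (-(G.β⁻¹ • G.res₂ (G.traj p))) y := by
  refine ⟨?_, fun δu δy hδ => ?_⟩
  · rw [map_neg, map_smul, ← sub_eq_add_neg]
    exact h.1
  · have h1 := G.green hδ h.2
    rw [inner_zero_right, zero_add, G.inner_ext₂] at h1
    rw [cost_add, ← h1, inner_neg_right, inner_smul_right, mul_neg,
      mul_inv_cancel_left₀ G.β_pos.ne', add_neg_cancel, add_zero]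
    have := G.β_pos
    exact le_add_of_nonneg_right (by positivity)

/-- Solve the backward equation for `p`. Scaling a variation by `t` of either sign makes the first
variation vanish, which determines `u₂`. -/
theorem Response.exists_stateSystem {G : Game X H K U₁ U₂} {u₁ : U₁} {u₂ : U₂} {y : X}
    (h : G.Response u₁ u₂ y) : ∃ p, G.StateSystem u₁ y p := by
  obtain ⟨p, hp⟩ := G.exists_bwd (G.traj y - G.ref)
  have hu : u₂ = -(G.β⁻¹ • G.res₂ (G.traj p)) := by
    have h0 : ∀ δu, ⟪δu, G.res₂ (G.traj p) + G.β • u₂⟫ = 0 := by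
      intro δu
      obtain ⟨δy, hδ⟩ := G.exists_fwd (G.ext₂ δu)
      have h1 := G.green hδ hp
      rw [inner_zero_right, zero_add, G.inner_ext₂] at h1
      rw [inner_add_right, inner_smul_right, h1]
      refine eq_zero_of_forall_nonneg (b := 1 / 2 * ‖G.traj δy‖ ^ 2 + G.β / 2 * ‖δu‖ ^ 2)
        fun t => ?_
      have h2 := h.2 (t • δu) (t • δy) (by rw [map_smul]; exact G.fwd_smul t hδ)
      rw [cost_add, map_smul, inner_smul_left, inner_smul_left, norm_smul, norm_smul, mul_pow,
        mul_pow, Real.norm_eq_abs, sq_abs, RCLike.conj_to_real] at h2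
      linarith
    have h3 : G.res₂ (G.traj p) + G.β • u₂ = 0 := inner_self_eq_zero.1 (h0 _)
    rw [← smul_neg, ← eq_neg_of_add_eq_zero_right h3, inv_smul_smul₀ G.β_pos.ne']
  refine ⟨p, ?_, hp⟩
  have h1 := h.1
  rwa [hu, map_neg, map_smul, ← sub_eq_add_neg] at h1

/-- Subtract Green's formula for `(ϑ, p)` from the one for `(y, φ)`: the products of `p` with `φ` on
the follower's region and of `y` with `ϑ` cancel. -/
theorem inner_final {u : U₁} {ξ : H} {y p φ ϑ : X} (h : G.StateSystem u y p)
    (h' : G.AdjointSystem ξ φ ϑ) :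
    ⟪G.final y, ξ⟫ = ⟪u, G.res₁ (G.traj φ)⟫ - ⟪G.traj ϑ, G.ref⟫ := by
  have h1 := G.greenH h.1 h'.1
  have h2 := G.green h'.2 h.2
  rw [inner_sub_left, inner_smul_left, G.inner_ext₁, G.inner_ext₂, RCLike.conj_to_real] at h1
  rw [inner_neg_left, inner_smul_left, G.inner_ext₂, inner_zero_right, inner_sub_right,
    real_inner_comm (G.res₂ (G.traj p)), RCLike.conj_to_real, real_inner_comm (G.traj y)] at h2
  linarith

/-- `u` is an optimal strategy of the leader for the target ball with centre `η` and
radius `α`. -/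
def Optimal (η : H) (α : ℝ) (u : U₁) : Prop :=
  (∃ u₂ y, G.Response u u₂ y ∧ ‖G.final y - η‖ ≤ α) ∧
    ∀ v v₂ y, G.Response v v₂ y → ‖G.final y - η‖ ≤ α → 1 / 2 * ‖u‖ ^ 2 ≤ 1 / 2 * ‖v‖ ^ 2

/-- The optimality system. -/
def OptimalitySystem (ξ : H) (y p φ ϑ : X) : Prop :=
  G.StateSystem (G.res₁ (G.traj φ)) y p ∧ G.AdjointSystem ξ φ ϑ

variable {G}

theorem existsUnique_optimalitySystem
    (hstate : ∀ u, ∃! s : X × X, G.StateSystem u s.1 s.2)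
    (hadj : ∀ ξ, ∃! s : X × X, G.AdjointSystem ξ s.1 s.2) (ξ : H) :
    ∃! s : X × X × X × X, G.OptimalitySystem ξ s.1 s.2.1 s.2.2.1 s.2.2.2 := by
  obtain ⟨⟨φ, ϑ⟩, h1, h2⟩ := hadj ξ
  obtain ⟨⟨y, p⟩, h3, h4⟩ := hstate (G.res₁ (G.traj φ))
  refine ⟨(y, p, φ, ϑ), ⟨h3, h1⟩, ?_⟩
  rintro ⟨y', p', φ', ϑ'⟩ ⟨h5, h6⟩
  obtain ⟨rfl, rfl⟩ := Prod.mk.inj (h2 (φ', ϑ') h6)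
  obtain ⟨rfl, rfl⟩ := Prod.mk.inj (h4 (y', p') h5)
  rfl

/-- Uniqueness makes the terminal state a function of `u` and the leader's strategy a function of
`ξ`, so that the game becomes a minimal norm problem. -/
theorem exists_solution_maps (hstate : ∀ u, ∃! s : X × X, G.StateSystem u s.1 s.2)
    (hadj : ∀ ξ, ∃! s : X × X, G.AdjointSystem ξ s.1 s.2) :
    ∃ (Y : U₁ → H) (R : H → U₁) (ℓ : H → ℝ), (∀ u ξ, ⟪Y u, ξ⟫ = ⟪u, R ξ⟫ - ℓ ξ) ∧
      (∀ u y p, G.StateSystem u y p → G.final y = Y u) ∧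
      ∀ ξ φ ϑ, G.AdjointSystem ξ φ ϑ → G.res₁ (G.traj φ) = R ξ := by
  choose s hs hs' using hstate
  choose r hr hr' using hadj
  refine ⟨fun u => G.final (s u).1, fun ξ => G.res₁ (G.traj (r ξ).1),
    fun ξ => ⟪G.traj (r ξ).2, G.ref⟫, fun u ξ => G.inner_final (hs u) (hr ξ), ?_, ?_⟩
  · intro u y p h
    exact congrArg (fun s => G.final s.1) (hs' u (y, p) h)
  · intro ξ φ ϑ h
    exact congrArg (fun s => G.res₁ (G.traj s.1)) (hr' ξ (φ, ϑ) h)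

theorem optimal_of_varIneq [CompleteSpace U₁]
    (hstate : ∀ u, ∃! s : X × X, G.StateSystem u s.1 s.2)
    (hadj : ∀ ξ, ∃! s : X × X, G.AdjointSystem ξ s.1 s.2) {η ξ : H} {α : ℝ} (hα : 0 ≤ α)
    {y p φ ϑ : X} (h : G.OptimalitySystem ξ y p φ ϑ)
    (hv : ∀ ξ', 0 ≤ ⟪G.final y - η, ξ' - ξ⟫ + α * (‖ξ'‖ - ‖ξ‖)) :
    ‖G.final y - η‖ ≤ α ∧ G.Optimal η α (G.res₁ (G.traj φ)) ∧
      ∀ v, G.Optimal η α v → v = G.res₁ (G.traj φ) := by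
  obtain ⟨Y, R, ℓ, hYR, hY, hR⟩ := exists_solution_maps hstate hadj
  have hy : G.final y = Y (R ξ) := by rw [hY _ _ _ h.1, hR _ _ _ h.2]
  have hle : ‖G.final y - η‖ ≤ α := (varIneq_consequences hα hv).1
  rw [hy] at hv
  have key : ∀ v v₂ z, G.Response v v₂ z → ‖G.final z - η‖ ≤ α →
      ‖R ξ‖ ^ 2 + ‖v - R ξ‖ ^ 2 ≤ ‖v‖ ^ 2 := by
    intro v v₂ z hz hzα
    obtain ⟨q, hq⟩ := hz.exists_stateSystem
    rw [hY _ _ _ hq] at hzα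
    exact norm_sq_add_le_of_varIneq hYR hα hv hzα
  refine ⟨hle, ⟨⟨_, y, h.1.response, hle⟩, fun v v₂ z hz hzα => ?_⟩, fun v hvo => ?_⟩
  · have := key v v₂ z hz hzα
    rw [hR _ _ _ h.2]
    have := sq_nonneg ‖v - R ξ‖
    linarith
  · obtain ⟨⟨v₂, z, hz, hzα⟩, hmin⟩ := hvo
    have h1 := key v v₂ z hz hzα
    have h2 := hmin _ _ y h.1.response hle
    rw [hR _ _ _ h.2] at h2 ⊢
    have h3 : ‖v - R ξ‖ ^ 2 = 0 := le_antisymm (by linarith) (sq_nonneg _)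
    exact sub_eq_zero.1 (by simpa using h3)

theorem existsUnique_varIneq [CompleteSpace U₁]
    (hstate : ∀ u, ∃! s : X × X, G.StateSystem u s.1 s.2)
    (hadj : ∀ ξ, ∃! s : X × X, G.AdjointSystem ξ s.1 s.2)
    (hd : Dense {ζ | ∃ u₁ u₂ y, G.Response u₁ u₂ y ∧ ζ = G.final y}) (η : H) {α : ℝ}
    (hα : 0 < α) : ∃! ξ : H, ∃ y p φ ϑ : X, G.OptimalitySystem ξ y p φ ϑ ∧
      ∀ ξ', 0 ≤ ⟪G.final y - η, ξ' - ξ⟫ + α * (‖ξ'‖ - ‖ξ‖) := by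
  obtain ⟨Y, R, ℓ, hYR, hY, hR⟩ := exists_solution_maps hstate hadj
  have hd' : Dense (range Y) := by
    refine hd.mono ?_
    rintro _ ⟨u₁, u₂, y, hy, rfl⟩
    obtain ⟨p, hp⟩ := hy.exists_stateSystem
    exact ⟨u₁, (hY _ _ _ hp).symm⟩
  have hy : ∀ {ξ y p φ ϑ}, G.OptimalitySystem ξ y p φ ϑ → G.final y = Y (R ξ) :=
    fun h => by rw [hY _ _ _ h.1, hR _ _ _ h.2]
  obtain ⟨ξ, hξ⟩ := exists_varIneq hYR hd' η hα
  obtain ⟨⟨y, p, φ, ϑ⟩, hs, -⟩ := existsUnique_optimalitySystem hstate hadj ξ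
  refine ⟨ξ, ⟨y, p, φ, ϑ, hs, by rwa [hy hs]⟩, ?_⟩
  rintro ζ ⟨y', p', φ', ϑ', hs', hv'⟩
  rw [hy hs'] at hv'
  exact varIneq_unique hYR hd' hv' hξ

end Game

end Game

/-! ### Extension by zero and its adjoint, restriction. -/

section Extension

variable {X Z : Type*} [MeasurableSpace X] [MeasurableSpace Z] {m : Measure X} {μ : Measure Z}
  [IsFiniteMeasure m] [SFinite μ] [SecondCountableTopology (Lp ℝ 2 μ)] {U : Set Z}
  {ρ : Measure (X × Z)}

theorem restrict_snd_preimage (hρ : ρ = m.prod (μ.restrict U)) :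
    (m.prod μ).restrict (univ ×ˢ U) = ρ := by
  rw [hρ, ← Measure.prod_restrict, Measure.restrict_univ]

theorem memLp_extension (hρ : ρ = m.prod (μ.restrict U)) (hU : MeasurableSet U) (u : Lp ℝ 2 ρ) :
    MemLp ((univ ×ˢ U).indicator u) 2 (m.prod μ) := by
  rw [memLp_indicator_iff_restrict (MeasurableSet.univ.prod hU), restrict_snd_preimage hρ]
  exact Lp.memLp u

/-- Extension by zero, viewed as a map from `L²(X × U)` to `L²(X; L²(Z))`. -/
def extension (hρ : ρ = m.prod (μ.restrict U)) (hU : MeasurableSet U) :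
    Lp ℝ 2 ρ →ₗ[ℝ] Lp (Lp ℝ 2 μ) 2 m :=
  (sectionIso m μ).toLinearMap ∘ₗ
    { toFun := fun u => (memLp_extension hρ hU u).toLp _
      map_add' := fun u v => by
        rw [← MemLp.toLp_add]
        refine MemLp.toLp_congr _ _ ?_
        rw [← indicator_add', ← ae_eq_restrict_iff_indicator_ae_eq (MeasurableSet.univ.prod hU),
          restrict_snd_preimage hρ]
        exact Lp.coeFn_add u v
      map_smul' := fun c u => by
        rw [RingHom.id_apply, ← MemLp.toLp_const_smul]
        refine MemLp.toLp_congr _ _ ?_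
        have e : c • (univ ×ˢ U).indicator (u : X × Z → ℝ) =
            (univ ×ˢ U).indicator (c • (u : X × Z → ℝ)) :=
          (indicator_const_smul (univ ×ˢ U) c (u : X × Z → ℝ)).symm
        rw [e, ← ae_eq_restrict_iff_indicator_ae_eq
          (MeasurableSet.univ.prod hU), restrict_snd_preimage hρ]
        exact Lp.coeFn_smul c u }

theorem coeFn_extension (hρ : ρ = m.prod (μ.restrict U)) (hU : MeasurableSet U) (u : Lp ℝ 2 ρ) :
    ∀ᵐ s ∂m, (extension hρ hU u s : Z → ℝ) =ᵐ[μ] U.indicator fun z => u (s, z) := by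
  filter_upwards [coeFn_sectionIso ((memLp_extension hρ hU u).toLp _),
    Measure.ae_ae_of_ae_prod (memLp_extension hρ hU u).coeFn_toLp] with s h1 h2
  filter_upwards [h1, h2] with z h3 h4
  refine h3.trans (h4.trans ?_)
  by_cases hz : z ∈ U <;> simp [hz]

/-- Surjectivity of `sectionIso` provides a jointly measurable representative of `k`, which can be
restricted to `X × U`. -/
theorem exists_restriction (hρ : ρ = m.prod (μ.restrict U)) (hU : MeasurableSet U)
    (k : Lp (Lp ℝ 2 μ) 2 m) : ∃ g : Lp ℝ 2 ρ, (∀ u, ⟪extension hρ hU u, k⟫ = ⟪u, g⟫) ∧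
      ∀ᵐ s ∂m, ∀ᵐ z ∂μ.restrict U, g (s, z) = k s z := by
  obtain ⟨f, rfl⟩ := sectionIso_surjective k
  have hf : MemLp f 2 ρ := by
    rw [← restrict_snd_preimage hρ]
    exact (Lp.memLp f).restrict _
  refine ⟨hf.toLp _, fun u => ?_, ?_⟩
  · refine ((sectionIso m μ).inner_map_map _ f).trans ?_
    rw [L2.inner_def, L2.inner_def]
    calc _ = ∫ q, (univ ×ˢ U).indicator (fun q => u q * f q) q ∂m.prod μ := by
          refine integral_congr_ae ?_
          filter_upwards [(memLp_extension hρ hU u).coeFn_toLp] with q hq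
          refine (congrArg (fun r : ℝ => ⟪r, f q⟫) hq).trans ?_
          by_cases hqU : q ∈ (univ : Set X) ×ˢ U
          · simp only [indicator_of_mem hqU]
            exact mul_comm _ _
          · simp only [indicator_of_notMem hqU, inner_zero_left]
      _ = ∫ q, u q * f q ∂ρ := by
          rw [integral_indicator (MeasurableSet.univ.prod hU), restrict_snd_preimage hρ]
      _ = _ := by
          refine integral_congr_ae ?_
          filter_upwards [hf.coeFn_toLp] with q hq
          rw [hq]
          exact mul_comm _ _
  · have h1 := hf.coeFn_toLp
    rw [Filter.EventuallyEq] at h1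
    have h2 : ∀ᵐ q ∂m.prod (μ.restrict U), hf.toLp _ q = f q := by rwa [← hρ]
    filter_upwards [Measure.ae_ae_of_ae_prod h2, coeFn_sectionIso f] with s h3 h4
    filter_upwards [h3, ae_restrict_of_ae h4] with z h5 h6
    rw [h5, h6]

end Extension

/-! ### Solvability and Green's formula for the system. -/

section SolutionTheory

variable {d : ℕ} {S : ControlSystem d} {b : ℝ → E d → Fin d → ℝ}
  {hb : ∀ j, IsCoefficient S fun t x => b t x j}

theorem trajL2_add {T : ℝ} {H : Type*} [NormedAddCommGroup H] [InnerProductSpace ℝ H]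
    [CompleteSpace H] [SecondCountableTopology H] (hT : 0 ≤ T) (y z : C(Icc (0 : ℝ) T, H)) :
    trajL2 hT (y + z) = trajL2 hT y + trajL2 hT z := MemLp.toLp_add _ _

theorem trajL2_smul {T : ℝ} {H : Type*} [NormedAddCommGroup H] [InnerProductSpace ℝ H]
    [CompleteSpace H] [SecondCountableTopology H] (hT : 0 ≤ T) (c : ℝ) (y : C(Icc (0 : ℝ) T, H)) :
    trajL2 hT (c • y) = c • trajL2 hT y := MemLp.toLp_const_smul c _

theorem exists_weakBackward_adjoint {T : ℝ} {V H : Type*} [NormedAddCommGroup V]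
    [InnerProductSpace ℝ V] [CompleteSpace V] [SecondCountableTopology V] [NormedAddCommGroup H]
    [InnerProductSpace ℝ H] [CompleteSpace H] [SecondCountableTopology H] (hT : 0 ≤ T)
    {ι : V →L[ℝ] H} (hι : ∀ x, ι.adjoint x = 0 → x = 0) {A : ℝ → V →L[ℝ] V} (hA : IsOpFamily A)
    {c C : ℝ} (hc : 0 < c)
    (hG : ∀ s ∈ Ioo 0 T, ∀ v, c * ‖v‖ ^ 2 ≤ ⟪A s v, v⟫ + C * ‖ι v‖ ^ 2) (γ : TimeL2 T H) :
    ∃ p, WeakBackward hT ι hA.adjoint γ 0 p := by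
  refine exists_weakBackward (C := C) hT hι hA.adjoint hc (fun s hs v => ?_) γ
  rw [ContinuousLinearMap.adjoint_inner_left, real_inner_comm]
  exact hG s hs v

/-- A trajectory of the system as an element of `L²(0,T;L²(Ω))`. -/
def obs (S : ControlSystem d) : S.State →ₗ[ℝ] TimeL2 S.T (L2 S.Ω) where
  toFun y := trajL2 S.T_pos.le y
  map_add' := trajL2_add _
  map_smul' := trajL2_smul _

theorem coeFn_obs (y : S.State) : ∀ᵐ t ∂timeMeasure S.T, obs S y t = S.at' y t :=
  coeFn_trajL2 S.T_pos.le y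

theorem ForwardSol.green {γ γ' : TimeL2 S.T (L2 S.Ω)} {ξ : L2 S.Ω} {y p : S.State}
    (hy : ForwardSol hb γ y) (hp : BackwardSol hb γ' ξ p) :
    ⟪γ, obs S p⟫ = ⟪S.at' y S.T, ξ⟫ + ⟪obs S y, γ'⟫ :=
  weakForward_green S.T_pos.le (sobolevEmb_adjoint_injective S.Ω_open)
    (fun s _ v w => (ContinuousLinearMap.adjoint_inner_right (systemOp hb s) v w).symm) hy hp

theorem ForwardSol.smul {γ : TimeL2 S.T (L2 S.Ω)} {y : S.State} (c : ℝ)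
    (hy : ForwardSol hb γ y) : ForwardSol hb (c • γ) (c • y) := WeakForward.smul hy c

theorem exists_forwardSol (hb : ∀ j, IsCoefficient S fun t x => b t x j)
    (γ : TimeL2 S.T (L2 S.Ω)) : ∃ y, ForwardSol hb γ y := by
  obtain ⟨c, C, hc, h⟩ := garding_systemOp hb
  exact exists_weakForward S.T_pos.le (sobolevEmb_adjoint_injective S.Ω_open)
    (isOpFamily_systemOp hb) hc h γ

theorem exists_backwardSol (hb : ∀ j, IsCoefficient S fun t x => b t x j)
    (γ : TimeL2 S.T (L2 S.Ω)) : ∃ p, BackwardSol hb γ 0 p := by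
  obtain ⟨c, C, hc, h⟩ := garding_systemOp hb
  exact exists_weakBackward_adjoint S.T_pos.le (sobolevEmb_adjoint_injective S.Ω_open)
    (isOpFamily_systemOp hb) hc h γ

end SolutionTheory

/-! ### Controls, sources and costs as Hilbert space objects. -/

section Controls

variable {d : ℕ} {S : ControlSystem d} {U : Set (E d)}

theorem volume_restrict_cylinder (hU : U ⊆ S.Ω) :
    (volume.restrict (Ioo 0 S.T ×ˢ U) : Measure (ℝ × E d)) =
      (timeMeasure S.T).prod ((volume.restrict S.Ω).restrict U) := by
  rw [Measure.restrict_restrict_of_subset hU, Measure.prod_restrict, Measure.volume_eq_prod]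

/-- The source `u χ_U` of a control `u`, as an element of `L²(0,T;L²(Ω))`. -/
def source (hU : U ⊆ S.Ω) (hm : IsOpen U) : S.Control U →ₗ[ℝ] TimeL2 S.T (L2 S.Ω) :=
  extension (volume_restrict_cylinder hU) hm.measurableSet

theorem represents_source (hU : U ⊆ S.Ω) (hm : IsOpen U) (u : S.Control U) :
    Represents S (source hU hm u) (S.src u) :=
  coeFn_extension (volume_restrict_cylinder hU) hm.measurableSet u

/-- The restriction of an element of `L²(0,T;L²(Ω))` to a control region. -/
def restriction (hU : U ⊆ S.Ω) (hm : IsOpen U) (k : TimeL2 S.T (L2 S.Ω)) : S.Control U :=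
  (exists_restriction (volume_restrict_cylinder hU) hm.measurableSet k).choose

theorem inner_source (hU : U ⊆ S.Ω) (hm : IsOpen U) (u : S.Control U)
    (k : TimeL2 S.T (L2 S.Ω)) : ⟪source hU hm u, k⟫ = ⟪u, restriction hU hm k⟫ :=
  (exists_restriction (volume_restrict_cylinder hU) hm.measurableSet k).choose_spec.1 u

theorem coeFn_restriction (hU : U ⊆ S.Ω) (hm : IsOpen U) (k : TimeL2 S.T (L2 S.Ω)) :
    ∀ᵐ t ∂timeMeasure S.T, ∀ᵐ x ∂volume.restrict U, restriction hU hm k (t, x) = k t x := by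
  have h : ∀ᵐ t ∂timeMeasure S.T, ∀ᵐ x ∂(volume.restrict S.Ω).restrict U,
      restriction hU hm k (t, x) = k t x :=
    (exists_restriction (volume_restrict_cylinder hU) hm.measurableSet k).choose_spec.2
  rwa [Measure.restrict_restrict_of_subset hU] at h

theorem isRestriction_smul (hU : U ⊆ S.Ω) (hm : IsOpen U) (c : ℝ) (y : S.State) :
    S.IsRestriction (c • restriction hU hm (obs S y)) c y := by
  have h := Lp.coeFn_smul c (restriction hU hm (obs S y))
  have h' : ∀ᵐ q ∂(timeMeasure S.T).prod (volume.restrict U),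
      (c • restriction hU hm (obs S y) : S.Control U) q = c * restriction hU hm (obs S y) q := by
    rw [Measure.prod_restrict, ← Measure.volume_eq_prod]
    exact h
  filter_upwards [Measure.ae_ae_of_ae_prod h', coeFn_restriction hU hm (obs S y), coeFn_obs y]
    with t h1 h2 h3
  filter_upwards [h1, h2] with x h4 h5
  rw [h4, h5, h3]

theorem represents_restriction (hU : U ⊆ S.Ω) (hm : IsOpen U) (y : S.State) :
    Represents S (source hU hm (restriction hU hm (obs S y)))
      fun t x => U.indicator (S.at' y t) x := by
  filter_upwards [represents_source hU hm (restriction hU hm (obs S y)),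
    coeFn_restriction hU hm (obs S y), coeFn_obs y] with t h1 h2 h3
  refine h1.trans ?_
  rw [h3] at h2
  have h4 := (ae_restrict_iff' hm.measurableSet).1 h2
  filter_upwards [ae_restrict_of_ae h4] with x hx
  by_cases hxU : x ∈ U
  · simp only [ControlSystem.src, indicator_of_mem hxU, hx hxU]
  · simp only [ControlSystem.src, indicator_of_notMem hxU]

theorem represents_obs (y : S.State) : Represents S (obs S y) fun t x => S.at' y t x := by
  filter_upwards [coeFn_obs y] with t h
  rw [h]

theorem Represents.add {γ γ' : TimeL2 S.T (L2 S.Ω)} {f f' : ℝ → E d → ℝ} (h : Represents S γ f)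
    (h' : Represents S γ' f') : Represents S (γ + γ') fun t x => f t x + f' t x := by
  filter_upwards [h, h', Lp.coeFn_add γ γ'] with t h1 h2 h3
  rw [h3]
  exact (Lp.coeFn_add (γ t) (γ' t)).trans (h1.add h2)

theorem Represents.sub {γ γ' : TimeL2 S.T (L2 S.Ω)} {f f' : ℝ → E d → ℝ} (h : Represents S γ f)
    (h' : Represents S γ' f') : Represents S (γ - γ') fun t x => f t x - f' t x := by
  filter_upwards [h, h', Lp.coeFn_sub γ γ'] with t h1 h2 h3
  rw [h3]
  exact (Lp.coeFn_sub (γ t) (γ' t)).trans (h1.sub h2)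

theorem Represents.neg {γ : TimeL2 S.T (L2 S.Ω)} {f : ℝ → E d → ℝ} (h : Represents S γ f) :
    Represents S (-γ) fun t x => -f t x := by
  filter_upwards [h, Lp.coeFn_neg γ] with t h1 h3
  rw [h3]
  exact (Lp.coeFn_neg (γ t)).trans h1.neg

theorem Represents.const_smul {γ : TimeL2 S.T (L2 S.Ω)} {f : ℝ → E d → ℝ} (h : Represents S γ f)
    (c : ℝ) : Represents S (c • γ) fun t x => c * f t x := by
  filter_upwards [h, Lp.coeFn_smul c γ] with t h1 h3
  rw [h3]
  exact (Lp.coeFn_smul c (γ t)).trans (h1.const_smul c)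

theorem represents_reference (yrf : S.Control S.Ω) :
    Represents S (source subset_rfl S.Ω_open yrf) fun t x => yrf (t, x) := by
  filter_upwards [represents_source subset_rfl S.Ω_open yrf] with t h
  refine h.trans ?_
  filter_upwards [ae_restrict_mem S.Ω_open.measurableSet] with x hx
  exact indicator_of_mem hx _

theorem norm_sq_eq_integral {X : Type*} [MeasurableSpace X] {ν : Measure X} (u : Lp ℝ 2 ν) :
    ‖u‖ ^ 2 = ∫ q, u q ^ 2 ∂ν := by
  rw [← real_inner_self_eq_norm_sq, L2.inner_def]
  refine integral_congr_ae (.of_forall fun q => ?_)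
  exact (sq (u q)).symm

theorem norm_sq_eq_integral_section {X Z : Type*} [MeasurableSpace X] [MeasurableSpace Z]
    {m : Measure X} {μ : Measure Z} {γ : Lp (Lp ℝ 2 μ) 2 m} {f : X → Z → ℝ}
    (h : ∀ᵐ s ∂m, (γ s : Z → ℝ) =ᵐ[μ] f s) : ‖γ‖ ^ 2 = ∫ s, ∫ z, f s z ^ 2 ∂μ ∂m := by
  rw [← real_inner_self_eq_norm_sq, L2.inner_def]
  refine integral_congr_ae ?_
  filter_upwards [h] with s hs
  rw [real_inner_self_eq_norm_sq, norm_sq_eq_integral]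
  refine integral_congr_ae ?_
  filter_upwards [hs] with z hz
  rw [hz]

theorem J₁_eq (u : S.Control S.U₁) : S.J₁ u = 1 / 2 * ‖u‖ ^ 2 := by
  rw [ControlSystem.J₁, norm_sq_eq_integral]

theorem J₂_eq (β : ℝ) (yrf : S.Control S.Ω) (y : S.State) (u₁ : S.Control S.U₁)
    (u₂ : S.Control S.U₂) : S.J₂ β yrf y u₁ u₂ =
      1 / 2 * ‖obs S y - source subset_rfl S.Ω_open yrf‖ ^ 2 +
        β / 2 * (‖u₁‖ ^ 2 + ‖u₂‖ ^ 2) := by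
  have h := norm_sq_eq_integral_section ((represents_obs y).sub (represents_reference yrf))
  rw [ControlSystem.J₂, h, norm_sq_eq_integral u₁, norm_sq_eq_integral u₂,
    intervalIntegral.integral_of_le S.T_pos.le, integral_Ioc_eq_integral_Ioo]

end Controls

/-! ### The control system as an instance of the abstract game. -/

section StackelbergGame

variable {d : ℕ} {S : ControlSystem d} {h : ℝ → E d → ℝ}

/-- The Stackelberg game of the controlled system. -/
def game (hh : S.IsPerturbation h) {β : ℝ} (hβ : 0 < β) (yrf : S.Control S.Ω) :
    Game S.State (L2 S.Ω) (TimeL2 S.T (L2 S.Ω)) (S.Control S.U₁) (S.Control S.U₂) where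
  traj := obs S
  final y := S.at' y S.T
  FwdH := ForwardSol (isCoefficient_driftH hh)
  Fwd := ForwardSol isCoefficient_drift
  BwdH := BackwardSol (isCoefficient_driftH hh)
  Bwd := BackwardSol isCoefficient_drift
  ext₁ := source S.U₁_subset S.U₁_open
  ext₂ := source S.U₂_subset S.U₂_open
  res₁ := restriction S.U₁_subset S.U₁_open
  res₂ := restriction S.U₂_subset S.U₂_open
  ref := source subset_rfl S.Ω_open yrf
  β := β
  β_pos := hβ
  inner_ext₁ := inner_source _ _
  inner_ext₂ := inner_source _ _
  greenH := ForwardSol.green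
  green := ForwardSol.green
  fwd_smul := ForwardSol.smul
  exists_fwd := exists_forwardSol _
  exists_bwd := exists_backwardSol _

variable (hh : S.IsPerturbation h) {β : ℝ} (hβ : 0 < β) (yrf : S.Control S.Ω)

/-- Only the class of the source matters; this covers both a given control and the indicator form `φ
χ_{U₁}` of the optimality system. -/
theorem isStateSystem_iff_of_represents {f : ℝ → E d → ℝ} {u : S.Control S.U₁}
    (hu : Represents S (source S.U₁_subset S.U₁_open u) f) (y p : S.State) :
    S.IsStateSystem h β yrf f y p ↔ (game hh hβ yrf).StateSystem u y p :=
  and_congr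
    (isForwardSol_iff _ (hu.sub ((represents_restriction S.U₂_subset S.U₂_open p).const_smul _)) y)
    (isBackwardSol_iff _ ((represents_obs y).sub (represents_reference yrf)) 0 p)

theorem isStateSystem_iff (u : S.Control S.U₁) (y p : S.State) :
    S.IsStateSystem h β yrf (S.src u) y p ↔ (game hh hβ yrf).StateSystem u y p :=
  isStateSystem_iff_of_represents hh hβ yrf (represents_source _ _ u) y p

theorem isAdjointSystem_iff (ξ : L2 S.Ω) (φ ϑ : S.State) :
    S.IsAdjointSystem h β ξ φ ϑ ↔ (game hh hβ yrf).AdjointSystem ξ φ ϑ :=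
  and_congr
    (isBackwardSol_iff _ (represents_obs ϑ) ξ φ)
    (isForwardSol_iff _ ((represents_restriction S.U₂_subset S.U₂_open φ).const_smul _).neg ϑ)

theorem isOptimalitySystem_iff (ξ : L2 S.Ω) (y p φ ϑ : S.State) :
    S.IsOptimalitySystem h β yrf ξ y p φ ϑ ↔
      (game hh hβ yrf).OptimalitySystem ξ y p φ ϑ :=
  and_congr
    (isStateSystem_iff_of_represents hh hβ yrf
      (represents_restriction S.U₁_subset S.U₁_open φ) y p)
    (isAdjointSystem_iff hh hβ yrf ξ φ ϑ)

theorem isFollowerResponse_iff (u₁ : S.Control S.U₁) (u₂ : S.Control S.U₂) (y : S.State) :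
    S.IsFollowerResponse h β yrf u₁ u₂ y ↔ (game hh hβ yrf).Response u₁ u₂ y := by
  refine and_congr (isForwardSol_iff _ ((represents_source S.U₁_subset S.U₁_open u₁).add
    (represents_source S.U₂_subset S.U₂_open u₂)) y) (forall₂_congr fun δu δy => ?_)
  refine imp_congr (isForwardSol_iff _ (represents_source S.U₂_subset S.U₂_open δu) δy) ?_
  rw [J₂_eq, J₂_eq]
  exact Iff.rfl

theorem hitsTarget_iff (ytg : L2 S.Ω) (α : ℝ) (y : S.State) :
    S.HitsTarget ytg α y ↔ ‖S.at' y S.T - ytg‖ ≤ α := mem_closedBall_iff_norm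

theorem isLeaderOptimal_iff (ytg : L2 S.Ω) (α : ℝ) (u : S.Control S.U₁) :
    S.IsLeaderOptimal h β yrf ytg α u ↔ (game hh hβ yrf).Optimal ytg α u := by
  refine and_congr (exists₂_congr fun u₂ y => and_congr (isFollowerResponse_iff hh hβ yrf u u₂ y)
    (hitsTarget_iff ytg α y)) (forall₃_congr fun v v₂ y => ?_)
  refine imp_congr (isFollowerResponse_iff hh hβ yrf v v₂ y)
    (imp_congr (hitsTarget_iff ytg α y) ?_)
  rw [J₁_eq, J₁_eq]

end StackelbergGame

end Stackelberg

end

/-! ### The theorem, by transfer to the abstract game. -/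

theorem proposition2 {d : ℕ} (S : Stackelberg.ControlSystem d)
    (h : ℝ → Stackelberg.E d → ℝ) (hh : S.IsPerturbation h)
    (β α : ℝ) (hβ : 0 < β) (hα : 0 < α)
    (yrf : S.Control S.Ω) (ytg : Stackelberg.L2 S.Ω)
    (hstate : ∀ u₁ : S.Control S.U₁,
      ∃! s : S.State × S.State, S.IsStateSystem h β yrf (S.src u₁) s.1 s.2)
    (hadj : ∀ ξ : Stackelberg.L2 S.Ω,
      ∃! s : S.State × S.State, S.IsAdjointSystem h β ξ s.1 s.2) :
    (∀ ξ : Stackelberg.L2 S.Ω, ∃! s : S.State × S.State × S.State × S.State,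
      S.IsOptimalitySystem h β yrf ξ s.1 s.2.1 s.2.2.1 s.2.2.2) ∧
    (∀ (ξ : Stackelberg.L2 S.Ω) (y p φ ϑ : S.State),
      S.IsOptimalitySystem h β yrf ξ y p φ ϑ → S.VarIneq ytg α y ξ →
      ∃ (u₁ : S.Control S.U₁) (u₂ : S.Control S.U₂),
        S.IsRestriction u₁ 1 φ ∧ S.IsRestriction u₂ (-β⁻¹) p ∧
        S.IsFollowerResponse h β yrf u₁ u₂ y ∧ S.HitsTarget ytg α y ∧
        S.IsLeaderOptimal h β yrf ytg α u₁ ∧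
        ∀ v₁, S.IsLeaderOptimal h β yrf ytg α v₁ → v₁ = u₁) ∧
    (Dense (S.reachable h β yrf) →
      ∃! ξ : Stackelberg.L2 S.Ω, ∃ y p φ ϑ : S.State,
        S.IsOptimalitySystem h β yrf ξ y p φ ϑ ∧ S.VarIneq ytg α y ξ) := by
  open Stackelberg in
  have hs : ∀ u, ∃! s : S.State × S.State, (game hh hβ yrf).StateSystem u s.1 s.2 := by
    simpa only [isStateSystem_iff hh hβ yrf] using hstate
  have ha : ∀ ξ, ∃! s : S.State × S.State, (game hh hβ yrf).AdjointSystem ξ s.1 s.2 := by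
    simpa only [isAdjointSystem_iff hh hβ yrf] using hadj
  simp only [isOptimalitySystem_iff hh hβ yrf, isFollowerResponse_iff hh hβ yrf,
    isLeaderOptimal_iff hh hβ yrf]
  refine ⟨Game.existsUnique_optimalitySystem hs ha, fun ξ y p φ ϑ ho hv => ?_, fun hd => ?_⟩
  · obtain ⟨h1, h2, h3⟩ := Game.optimal_of_varIneq hs ha hα.le ho hv
    have h4 := isRestriction_smul S.U₁_subset S.U₁_open 1 φ
    rw [one_smul] at h4
    have h5 := isRestriction_smul S.U₂_subset S.U₂_open (-β⁻¹) p
    rw [neg_smul] at h5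
    exact ⟨_, _, h4, h5, ho.1.response, (hitsTarget_iff ytg α y).2 h1, h2, h3⟩
  · refine Game.existsUnique_varIneq hs ha ?_ ytg hα
    convert hd using 1
    simp only [ControlSystem.reachable, isFollowerResponse_iff hh hβ yrf]
    rfl
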